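/- **Setting.** A value is an integer, a Boolean or $\mathrm{Null}$. A tuple is a list of (attribute name, value) pairs, a relation is a list of tuples, a schema $\mathcal S$ maps relation names to lists of typed attributes ($\mathrm{Null}$ has every type), and a database $\mathcal D$ over $\mathcal S$ maps the same relation names to relations whose tuples have these attributes and types. Relations are read as bags, except for the result of an $\mathrm{OrderBy}$, which is a list. A query is a subquery $Q$ or $\mathrm{OrderBy}(Q,\vec E,b)$, where $$Q ::= R \mid \Pi_L(Q) \mid \sigma_\phi(Q) \mid \rho_R(Q) \mid Q\oplus Q \mid \mathrm{Distinct}(Q) \mid Q\otimes Q \mid \mathrm{GroupBy}(Q,\vec E,L,\phi) \mid \mathrm{With}(\vec Q,\vec R,Q),$$ $\oplus$ is set or bag union, intersection or difference, and $\otimes$ is the product or an inner, left, right or full outer join $\bowtie_\phi$. Attribute lists $L$ consist of attribute expressions $A$, possibly renamed; $A ::= \mathrm{Cast}(\phi)\mid E\mid \mathcal G(E)\mid A\diamond A$ with $\mathcal G\in\{\mathrm{Count},\mathrm{Min},\mathrm{Max},\mathrm{Sum},\mathrm{Avg}\}$ and $\diamond\in\{+,-,\times,/,\%\}$ (Euclidean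 integer operations, total); $E ::= a\mid v\mid E\diamond E\mid \mathrm{ITE}(\phi,E,E)\mid\mathrm{Case}(\vec\phi,\vec E,E)$; predicates are $\top$, $\bot$, $\mathrm{Null}$, comparisons $A\odot A$, $\mathrm{IsNull}(E)$, $\vec E\in\vec v$ (a list of constant rows), $\vec E\in Q$, and $\wedge,\vee,\neg$. $[\![Q]\!]_{\mathcal D}$ is the usual bag semantics of SQL: predicates are evaluated in three-valued (Kleene) logic, arithmetic and comparisons with a $\mathrm{Null}$ operand give $\mathrm{Null}$, set operations and grouping identify equal values (including $\mathrm{Null}$), aggregates ignore $\mathrm{Null}$ and are $\mathrm{Null}$ if there is no other value, $\mathrm{OrderBy}$ is the stated selection sort by the lexicographic order of the values of $\vec E$ with $\mathrm{Null}=-\infty$ (ascending iff $b=\top$). Queries are well formed: relation names are declared, attribute names inside one intermediate result are distinct, attributes used by a projection exist, operands of $\oplus$ have the same attributes, list lengths match, grouping keys contain no aggregates, and outside of aggregate functions an aggregating projection uses no attribute and the list and condition of a $\mathrm{GroupBy}$ use attributes only through the grouping keys. **Encoding.** A symbolic database $\Gamma$ over $\mathcal S$ maps the relation names of $\mathcal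 S$ to finite lists of tuple variables. An interpretation $\mathcal I$ assigns, to the symbols in its domain, a tuple and a truth value $\mathrm{Del}(t)$ for a tuple variable $t$, and predicates or functions for the symbols $g$, $\mathrm{Paired}$, $\mathrm{find}$ below; $\mathcal I([t_1,\dots,t_n])$ is the list of the tuples $\mathcal I(t_i)$ with $\neg\mathrm{Del}(t_i)$. $\mathcal I'\sqsupseteq\mathcal I$ means that the domain of $\mathcal I'$ contains that of $\mathcal I$ and that both agree, also on $\mathrm{Del}$, on the symbols of the latter. Write $t'=t$ for equality of all attribute values and of $\mathrm{Del}$, and $t\in\vec s$ if some $s_j$ with $\neg\mathrm{Del}(s_j)$ has the same values as $t$. $\Gamma\vdash Q\hookrightarrow R$ computes the list $R$ of symbolic tuples of $Q$, and $\mathcal S,\Gamma\vdash Q\leadsto\Phi$ the formula. For a relation name, $R=\Gamma(R)$ and $\Phi=\top$. Every other operator generates fresh tuples $t'$, one per tuple $t$ of its (first) input unless said otherwise, and adds to the formulas of its operands: * $\Pi_L$ without aggregates: the attributes of $t_i'$ are the values of $L$ on $[t_i]$, and $\mathrm{Del}(t_i')\leftrightarrow\mathrm{Del}(t_i)$; with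 aggregates: a single, not deleted tuple, with the values of $L$ on the whole list; * $\sigma_\phi$: $\neg\mathrm{Del}(t_i)\wedge\phi(t_i)=\top\to t_i'=t_i$, and $\mathrm{Del}(t'_i)$ otherwise; $\rho$: $t_i'=t_i$ up to names; bag union: copies of both lists; * product: tuples $t''_{ij}$ that merge $t_i,t_j'$ if neither is deleted, and are deleted otherwise; inner join: $\sigma_\phi$ of the product; outer joins add one $\mathrm{Null}$-extended tuple for each tuple of the left and/or right operand, not deleted iff that tuple is not deleted and all its joined tuples are; * $\mathrm{Distinct}$: $t_i'$ is deleted if $t_i$ occurs in $t_1,\dots,t_{i-1}$, else $t_i'=t_i$; set union: $\mathrm{Distinct}$ of the bag union; set intersection and difference: the tuples of $\mathrm{Distinct}(Q_1)$ that are, respectively are not, members of the list of $Q_2$; * bag difference: $\mathrm{Paired}(i,j)\leftrightarrow \mathrm{Eq}(t_i,s_j)\wedge\bigwedge_{k<i}\neg\mathrm{Paired}(k,j)\wedge\bigwedge_{k<j}\neg\mathrm{Paired}(i,k)$, where $\mathrm{Eq}$ says that both are not deleted and have equal values; $t_i'=t_i$ if $t_i$ is neither deleted nor paired, else $\mathrm{Del}(t_i')$;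 bag intersection is $Q_1-(Q_1-Q_2)$; * $\mathrm{GroupBy}$: $\sum_{j\le i}[g(t_i,j)]=[\neg\mathrm{Del}(t_i)]$; for $j<i$, $g(t_i,j)\leftrightarrow\neg\mathrm{Del}(t_i)\wedge g(t_j,j)\wedge\vec E(t_i)=\vec E(t_j)$; for $j>i$, $\neg g(t_i,j)$; if $g(t_i,i)$ and $\phi=\top$ on $g^{-1}(i)$, then $t'_i$ is not deleted and has the values of $L$ on $g^{-1}(i)$; otherwise $\mathrm{Del}(t_i')$; * $\mathrm{With}$: the formulas of all $Q_i$, and that of the body under $\mathcal S$ and $\Gamma$ updated at $\vec R$; * $\mathrm{OrderBy}$: $\vec t''$ is $\vec t$ with the deleted tuples moved stably to the end; $t_i'=t''_{\mathrm{find}(i)}$, where $\mathrm{find}$ is a bijection of the positions, preserves deletion at every position, and lists the non-deleted tuples so that no later one comes strictly before an earlier one in the order given by $\vec E,b$. Attribute expressions and predicates are translated into terms by the three-valued rules above, with aggregates over the non-deleted tuples; $\vec E\in Q$ becomes $\Phi_Q\wedge\bigvee_i(\neg\mathrm{Del}(t_i)\wedge\bigwedge_jE_j=t_i.a_j)$,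 where $t_i$, $a_j$ and $\Phi_Q$ are the tuples, attributes and formula of $Q$. **Theorem.** Let $\mathcal D$ be a database over a schema $\mathcal S$, let $\Gamma$ be a symbolic database over $\mathcal S$, let $Q$ be a well-formed query and let $o_R$ be a name for its output relation. Suppose $\Gamma\vdash Q\hookrightarrow R$ and $\mathcal S,\Gamma\vdash Q\leadsto\Phi$. Let $\mathcal I$ be any interpretation that is defined on the tuple variables of $\Gamma$, not on the symbols generated by the encoding, with $\mathcal I(\Gamma)=\mathcal D$. Then there is an extension $\mathcal I'\sqsupseteq\mathcal I$, defined on $R$, such that $$\mathcal I'(R)=[\![Q]\!]_{\mathcal D}\qquad\text{and}\qquad \mathcal I',\ \mathcal D[o_R\mapsto\mathcal I'(R)]\models\Phi .$$ -/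

import Mathlib

namespace VeriEQL

/-! ### Values, names, tuples, relations, schemas, databases -/

inductive Ty where
  | int
  | bool
  deriving DecidableEq

/-- Values: integers, booleans and `NULL`. -/
inductive Value where
  | null
  | int (n : ℤ)
  | bool (b : Bool)
  deriving DecidableEq

/-- The integer carried by a value; booleans are read as `0` and `1`. It is only consulted on values
that have already been tested to be different from `null`. -/
def Value.num : Value → ℤ
  | .null => 0
  | .int n => n
  | .bool b => if b then 1 else 0

/-- `null` has both types. -/
def Value.HasType : Value → Ty → Prop
  | .null, _ => True
  | .int _, .int => True
  | .bool _, .bool => True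
  | _, _ => False

abbrev RelName := String

/-- The pieces of a (qualified or derived) attribute name: relation names, column names, constants,
and the symbols of operators and aggregate functions. -/
inductive Token where
  | rel (R : RelName)
  | col (a : String)
  | val (v : Value)
  | sym (n : ℕ)
  deriving DecidableEq

/-- Attribute names. The column `age` of `EMP` has the qualified name `[rel EMP, col age]`; the name
of a compound attribute expression is its printed form. -/
abbrev AttrName := List Token

def Token.isRel : Token → Bool
  | .rel _ => true
  | _ => false

/-- `rename(R, a)`: every relation name inside `a` is replaced by `R`; an unqualified name becomes
qualified by `R`. -/
def rename (R : RelName) (a : AttrName) : AttrName :=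
  if a.any Token.isRel then a.map (fun k => if k.isRel then Token.rel R else k)
  else Token.rel R :: a

/-- A tuple is a list of values with their attribute names. -/
abbrev Tuple := List (AttrName × Value)

def lookup : Tuple → AttrName → Value
  | [], _ => .null
  | (b, v) :: x, a => if a = b then v else lookup x a

abbrev Relation := List Tuple

abbrev Database := RelName → Option Relation

abbrev Schema := RelName → Option (List (AttrName × Ty))

/-- A schema from which the types have been dropped; intermediate results carry no types. -/
abbrev SchemaEnv := RelName → Option (List AttrName)

def Schema.names (S : Schema) : SchemaEnv := fun R => (S R).map (List.map Prod.fst)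

/-- `D` is a database over the schema `S`. -/
def Conforms (S : Schema) (D : Database) : Prop :=
  ∀ R, Option.Rel
    (fun cols rows => ∀ x ∈ rows,
      List.Forall₂ (fun (c : AttrName × Ty) (cell : AttrName × Value) =>
        cell.1 = c.1 ∧ cell.2.HasType c.2) cols x)
    (S R) (D R)

/-- `m[R₁ ↦ x₁, …, Rₙ ↦ xₙ]`. -/
def update {α : Type} (m : RelName → Option α) (Rs : List RelName) (xs : List α) :
    RelName → Option α :=
  (Rs.zip xs).foldl (fun m' Rx => Function.update m' Rx.1 (some Rx.2)) m

/-! ### Syntax of queries -/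

inductive ArithOp where
  | add | sub | mul | div | mod
  deriving DecidableEq

inductive CmpOp where
  | le | lt | eq | ne | gt | ge
  deriving DecidableEq

inductive AggOp where
  | count | min | max | sum | avg
  deriving DecidableEq

/-- `∪`, `∩`, `∖` on sets and `⊎`, bag intersection, `−` on bags. -/
inductive CollOp where
  | union | inter | diff | unionAll | interAll | diffAll
  deriving DecidableEq

inductive JoinKind where
  | inner | left | right | full
  deriving DecidableEq

mutual

/-- Subqueries (everything but a topmost `OrderBy`). -/
inductive Query where
  | rel (R : RelName)
  | proj (L : List Item) (Q : Query)
  | select (φ : Pred) (Q : Query)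
  | rename (R : RelName) (Q : Query)
  | coll (op : CollOp) (Q₁ Q₂ : Query)
  | distinct (Q : Query)
  | prod (Q₁ Q₂ : Query)
  | join (k : JoinKind) (φ : Pred) (Q₁ Q₂ : Query)
  | groupBy (Q : Query) (Es : List Expr) (L : List Item) (φ : Pred)
  | withQ (Qs : List Query) (Rs : List RelName) (Q : Query)

/-- Elements `id(A)` and `ρ_a(A)` of attribute lists. -/
inductive Item where
  | id (A : Attr)
  | named (a : AttrName) (A : Attr)

inductive Attr where
  | cast (φ : Pred)
  | expr (E : Expr)
  | agg (G : AggOp) (E : Expr)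
  | arith (op : ArithOp) (A₁ A₂ : Attr)

inductive Pred where
  | lit (b : Bool)
  | null
  | cmp (op : CmpOp) (A₁ A₂ : Attr)
  | isNull (E : Expr)
  | inVals (Es : List Expr) (rows : List (List Value))
  | inQuery (Es : List Expr) (Q : Query)
  | and (φ₁ φ₂ : Pred)
  | or (φ₁ φ₂ : Pred)
  | not (φ : Pred)

inductive Expr where
  | attr (a : AttrName)
  | val (v : Value)
  | arith (op : ArithOp) (E₁ E₂ : Expr)
  | ite (φ : Pred) (E₁ E₂ : Expr)
  | case (φs : List Pred) (Es : List Expr) (E : Expr)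

end

/-- Queries: a subquery, or `OrderBy` at the topmost level (`asc = true`: ascending). -/
inductive TopQuery where
  | sub (Q : Query)
  | orderBy (Q : Query) (Es : List Expr) (asc : Bool)

/-! ### Printing attribute expressions (names of the columns that are not renamed) -/

def ArithOp.code : ArithOp → ℕ
  | .add => 0 | .sub => 1 | .mul => 2 | .div => 3 | .mod => 4

def CmpOp.code : CmpOp → ℕ
  | .le => 10 | .lt => 11 | .eq => 12 | .ne => 13 | .gt => 14 | .ge => 15

def AggOp.code : AggOp → ℕ
  | .count => 20 | .min => 21 | .max => 22 | .sum => 23 | .avg => 24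

def CollOp.code : CollOp → ℕ
  | .union => 30 | .inter => 31 | .diff => 32 | .unionAll => 33 | .interAll => 34 | .diffAll => 35

def JoinKind.code : JoinKind → ℕ
  | .inner => 40 | .left => 41 | .right => 42 | .full => 43

mutual

def Query.print : Query → AttrName
  | .rel R => [.sym 50, .rel R]
  | .proj L Q => .sym 51 :: Item.printList L ++ Q.print
  | .select φ Q => .sym 52 :: φ.print ++ Q.print
  | .rename R Q => .sym 53 :: .rel R :: Q.print
  | .coll op Q₁ Q₂ => .sym op.code :: Q₁.print ++ Q₂.print
  | .distinct Q => .sym 54 :: Q.print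
  | .prod Q₁ Q₂ => .sym 55 :: Q₁.print ++ Q₂.print
  | .join k φ Q₁ Q₂ => .sym k.code :: φ.print ++ Q₁.print ++ Q₂.print
  | .groupBy Q Es L φ =>
      .sym 56 :: Q.print ++ Expr.printList Es ++ Item.printList L ++ φ.print
  | .withQ Qs Rs Q => .sym 57 :: Query.printList Qs ++ Rs.map Token.rel ++ .sym 99 :: Q.print

def Query.printList : List Query → AttrName
  | [] => [.sym 99]
  | Q :: Qs => Q.print ++ Query.printList Qs

def Item.print : Item → AttrName
  | .id A => .sym 60 :: A.print
  | .named a A => .sym 61 :: a ++ A.print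

def Item.printList : List Item → AttrName
  | [] => [.sym 99]
  | e :: L => e.print ++ Item.printList L

/-- `ToString(A)`; on a plain attribute this is the attribute name itself. -/
def Attr.print : Attr → AttrName
  | .cast φ => .sym 70 :: φ.print
  | .expr E => E.print
  | .agg G E => .sym G.code :: E.print
  | .arith op A₁ A₂ => .sym op.code :: A₁.print ++ A₂.print

def Pred.print : Pred → AttrName
  | .lit b => [.sym 80, .val (.bool b)]
  | .null => [.sym 81]
  | .cmp op A₁ A₂ => .sym op.code :: A₁.print ++ A₂.print
  | .isNull E => .sym 82 :: E.print
  | .inVals Es rows =>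
      .sym 83 :: Expr.printList Es ++ rows.flatMap (fun r => r.map Token.val ++ [.sym 99])
  | .inQuery Es Q => .sym 84 :: Expr.printList Es ++ Q.print
  | .and φ₁ φ₂ => .sym 85 :: φ₁.print ++ φ₂.print
  | .or φ₁ φ₂ => .sym 86 :: φ₁.print ++ φ₂.print
  | .not φ => .sym 87 :: φ.print

def Pred.printList : List Pred → AttrName
  | [] => [.sym 99]
  | φ :: φs => φ.print ++ Pred.printList φs

def Expr.print : Expr → AttrName
  | .attr a => a
  | .val v => [.val v]
  | .arith op E₁ E₂ => .sym op.code :: E₁.print ++ E₂.print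
  | .ite φ E₁ E₂ => .sym 90 :: φ.print ++ E₁.print ++ E₂.print
  | .case φs Es E => .sym 91 :: Pred.printList φs ++ Expr.printList Es ++ E.print

def Expr.printList : List Expr → AttrName
  | [] => [.sym 99]
  | E :: Es => E.print ++ Expr.printList Es

end

/-- The name of a column produced by an attribute list. -/
def Item.name : Item → AttrName
  | .id A => A.print
  | .named a _ => a

/-! ### Attributes of intermediate results -/

mutual

/-- `S ⊢ Q : attrs Q S`. -/
def Query.attrs : Query → SchemaEnv → List AttrName
  | .rel R, S => (S R).getD []
  | .proj L _, _ => L.map Item.name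
  | .select _ Q, S => Q.attrs S
  | .rename R Q, S => (Q.attrs S).map (VeriEQL.rename R)
  | .coll _ Q₁ _, S => Q₁.attrs S
  | .distinct Q, S => Q.attrs S
  | .prod Q₁ Q₂, S => Q₁.attrs S ++ Q₂.attrs S
  | .join _ _ Q₁ Q₂, S => Q₁.attrs S ++ Q₂.attrs S
  | .groupBy _ _ L _, _ => L.map Item.name
  | .withQ Qs Rs Q, S => Q.attrs (update S Rs (Query.attrsList Qs S))

def Query.attrsList : List Query → SchemaEnv → List (List AttrName)
  | [], _ => []
  | Q :: Qs, S => Q.attrs S :: Query.attrsList Qs S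

end

/-! ### Aggregation, attributes occurring in expressions

None of these descends into the query `Q` of a membership test `E⃗ ∈ Q`, which is evaluated on its
own. -/

mutual

def Attr.hasAgg : Attr → Bool
  | .cast φ => φ.hasAgg
  | .expr E => E.hasAgg
  | .agg _ _ => true
  | .arith _ A₁ A₂ => A₁.hasAgg || A₂.hasAgg

def Pred.hasAgg : Pred → Bool
  | .lit _ => false
  | .null => false
  | .cmp _ A₁ A₂ => A₁.hasAgg || A₂.hasAgg
  | .isNull E => E.hasAgg
  | .inVals Es _ => Expr.hasAggList Es
  | .inQuery Es _ => Expr.hasAggList Es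
  | .and φ₁ φ₂ => φ₁.hasAgg || φ₂.hasAgg
  | .or φ₁ φ₂ => φ₁.hasAgg || φ₂.hasAgg
  | .not φ => φ.hasAgg

def Pred.hasAggList : List Pred → Bool
  | [] => false
  | φ :: φs => φ.hasAgg || Pred.hasAggList φs

def Expr.hasAgg : Expr → Bool
  | .attr _ => false
  | .val _ => false
  | .arith _ E₁ E₂ => E₁.hasAgg || E₂.hasAgg
  | .ite φ E₁ E₂ => φ.hasAgg || E₁.hasAgg || E₂.hasAgg
  | .case φs Es E => Pred.hasAggList φs || Expr.hasAggList Es || E.hasAgg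

def Expr.hasAggList : List Expr → Bool
  | [] => false
  | E :: Es => E.hasAgg || Expr.hasAggList Es

end

def Item.attr : Item → Attr
  | .id A => A
  | .named _ A => A

/-- Does the attribute list compute an aggregation? -/
def hasAgg (L : List Item) : Bool := L.any (fun e => e.attr.hasAgg)

mutual

/-- The attribute names occurring in an attribute expression. -/
def Attr.used : Attr → List AttrName
  | .cast φ => φ.used
  | .expr E => E.used
  | .agg _ E => E.used
  | .arith _ A₁ A₂ => A₁.used ++ A₂.used

def Pred.used : Pred → List AttrName
  | .lit _ => []
  | .null => []
  | .cmp _ A₁ A₂ => A₁.used ++ A₂.used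
  | .isNull E => E.used
  | .inVals Es _ => Expr.usedList Es
  | .inQuery Es _ => Expr.usedList Es
  | .and φ₁ φ₂ => φ₁.used ++ φ₂.used
  | .or φ₁ φ₂ => φ₁.used ++ φ₂.used
  | .not φ => φ.used

def Pred.usedList : List Pred → List AttrName
  | [] => []
  | φ :: φs => φ.used ++ Pred.usedList φs

def Expr.used : Expr → List AttrName
  | .attr a => [a]
  | .val _ => []
  | .arith _ E₁ E₂ => E₁.used ++ E₂.used
  | .ite φ E₁ E₂ => φ.used ++ E₁.used ++ E₂.used
  | .case φs Es E => Pred.usedList φs ++ Expr.usedList Es ++ E.used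

def Expr.usedList : List Expr → List AttrName
  | [] => []
  | E :: Es => E.used ++ Expr.usedList Es

end

/-! ### Well-formedness

`Det Ks` says that an expression is determined by the grouping keys `Ks`: outside of aggregate
functions it reads attributes only through expressions from `Ks`. With `Ks = []` it says that no
attribute occurs outside of an aggregate function. -/

mutual

def Attr.Det (Ks : List Expr) : Attr → Prop
  | .cast φ => φ.Det Ks
  | .expr E => E.Det Ks
  | .agg _ _ => True
  | .arith _ A₁ A₂ => A₁.Det Ks ∧ A₂.Det Ks

def Pred.Det (Ks : List Expr) : Pred → Prop
  | .lit _ => True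
  | .null => True
  | .cmp _ A₁ A₂ => A₁.Det Ks ∧ A₂.Det Ks
  | .isNull E => E.Det Ks
  | .inVals Es _ => Expr.DetList Ks Es
  | .inQuery Es _ => Expr.DetList Ks Es
  | .and φ₁ φ₂ => φ₁.Det Ks ∧ φ₂.Det Ks
  | .or φ₁ φ₂ => φ₁.Det Ks ∧ φ₂.Det Ks
  | .not φ => φ.Det Ks

def Pred.DetList (Ks : List Expr) : List Pred → Prop
  | [] => True
  | φ :: φs => φ.Det Ks ∧ Pred.DetList Ks φs

def Expr.Det (Ks : List Expr) : Expr → Prop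
  | .attr a => Expr.attr a ∈ Ks
  | .val _ => True
  | .arith op E₁ E₂ => Expr.arith op E₁ E₂ ∈ Ks ∨ (E₁.Det Ks ∧ E₂.Det Ks)
  | .ite φ E₁ E₂ => Expr.ite φ E₁ E₂ ∈ Ks ∨ (φ.Det Ks ∧ E₁.Det Ks ∧ E₂.Det Ks)
  | .case φs Es E =>
      Expr.case φs Es E ∈ Ks ∨ (Pred.DetList Ks φs ∧ Expr.DetList Ks Es ∧ E.Det Ks)

def Expr.DetList (Ks : List Expr) : List Expr → Prop
  | [] => True
  | E :: Es => E.Det Ks ∧ Expr.DetList Ks Es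

end

mutual

/-- Well-formedness under a schema: relation names are declared, the columns of every intermediate
result have distinct names, the side conditions of the attribute rules hold, and grouping and
aggregating queries are unambiguous. -/
def Query.WF : Query → SchemaEnv → Prop
  | .rel R, S => ∃ A, S R = some A ∧ A.Nodup
  | .proj L Q, S => Q.WF S ∧ Item.WFList L S ∧ (L.map Item.name).Nodup ∧
      (∀ e ∈ L, ∀ a ∈ e.attr.used, a ∈ Q.attrs S) ∧
      (hasAgg L = true → ∀ e ∈ L, e.attr.Det [])
  | .select φ Q, S => Q.WF S ∧ φ.WF S
  | .rename R Q, S => Q.WF S ∧ ((Q.attrs S).map (VeriEQL.rename R)).Nodup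
  | .coll _ Q₁ Q₂, S => Q₁.WF S ∧ Q₂.WF S ∧ Q₁.attrs S = Q₂.attrs S
  | .distinct Q, S => Q.WF S
  | .prod Q₁ Q₂, S => Q₁.WF S ∧ Q₂.WF S ∧ (Q₁.attrs S ++ Q₂.attrs S).Nodup
  | .join _ φ Q₁ Q₂, S => Q₁.WF S ∧ Q₂.WF S ∧ φ.WF S ∧ (Q₁.attrs S ++ Q₂.attrs S).Nodup
  | .groupBy Q Es L φ, S => Q.WF S ∧ Expr.WFList Es S ∧ Item.WFList L S ∧ φ.WF S ∧
      (L.map Item.name).Nodup ∧ Expr.hasAggList Es = false ∧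
      (∀ e ∈ L, e.attr.Det Es) ∧ φ.Det Es
  | .withQ Qs Rs Q, S => Query.WFList Qs S ∧ Qs.length = Rs.length ∧
      Q.WF (update S Rs (Query.attrsList Qs S))

def Query.WFList : List Query → SchemaEnv → Prop
  | [], _ => True
  | Q :: Qs, S => Q.WF S ∧ Query.WFList Qs S

def Item.WF : Item → SchemaEnv → Prop
  | .id A, S => A.WF S
  | .named _ A, S => A.WF S

def Item.WFList : List Item → SchemaEnv → Prop
  | [], _ => True
  | e :: L, S => e.WF S ∧ Item.WFList L S

def Attr.WF : Attr → SchemaEnv → Prop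
  | .cast φ, S => φ.WF S
  | .expr E, S => E.WF S
  | .agg _ E, S => E.WF S
  | .arith _ A₁ A₂, S => A₁.WF S ∧ A₂.WF S

def Pred.WF : Pred → SchemaEnv → Prop
  | .lit _, _ => True
  | .null, _ => True
  | .cmp _ A₁ A₂, S => A₁.WF S ∧ A₂.WF S
  | .isNull E, S => E.WF S
  | .inVals Es rows, S => Expr.WFList Es S ∧ ∀ r ∈ rows, r.length = Es.length
  | .inQuery Es Q, S => Expr.WFList Es S ∧ Q.WF S ∧ (Q.attrs S).length = Es.length
  | .and φ₁ φ₂, S => φ₁.WF S ∧ φ₂.WF S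
  | .or φ₁ φ₂, S => φ₁.WF S ∧ φ₂.WF S
  | .not φ, S => φ.WF S

def Pred.WFList : List Pred → SchemaEnv → Prop
  | [], _ => True
  | φ :: φs, S => φ.WF S ∧ Pred.WFList φs S

def Expr.WF : Expr → SchemaEnv → Prop
  | .attr _, _ => True
  | .val _, _ => True
  | .arith _ E₁ E₂, S => E₁.WF S ∧ E₂.WF S
  | .ite φ E₁ E₂, S => φ.WF S ∧ E₁.WF S ∧ E₂.WF S
  | .case φs Es E, S =>
      Pred.WFList φs S ∧ Expr.WFList Es S ∧ E.WF S ∧ φs.length = Es.length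

def Expr.WFList : List Expr → SchemaEnv → Prop
  | [], _ => True
  | E :: Es, S => E.WF S ∧ Expr.WFList Es S

end

def TopQuery.WF : TopQuery → SchemaEnv → Prop
  | .sub Q, S => Q.WF S
  | .orderBy Q Es _, S => Q.WF S ∧ Expr.WFList Es S

/-! ### Operations on values -/

/-- Integer arithmetic; `/` and `%` are the Euclidean ones, made total as Lean makes them total. -/
def ArithOp.eval : ArithOp → ℤ → ℤ → ℤ
  | .add, m, n => m + n
  | .sub, m, n => m - n
  | .mul, m, n => m * n
  | .div, m, n => m / n
  | .mod, m, n => m % n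

def CmpOp.eval : CmpOp → ℤ → ℤ → Bool
  | .le, m, n => decide (m ≤ n)
  | .lt, m, n => decide (m < n)
  | .eq, m, n => decide (m = n)
  | .ne, m, n => decide (m ≠ n)
  | .gt, m, n => decide (m > n)
  | .ge, m, n => decide (m ≥ n)

def vArith (op : ArithOp) (x y : Value) : Value :=
  if x = .null ∨ y = .null then .null else .int (op.eval x.num y.num)

def vCmp (op : CmpOp) (x y : Value) : Value :=
  if x = .null ∨ y = .null then .null else .bool (op.eval x.num y.num)

def vAnd (x y : Value) : Value :=
  if (x = .null ∧ y = .null) ∨ (x = .null ∧ y = .bool true) ∨ (x = .bool true ∧ y = .null)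
  then .null else .bool (decide (x = .bool true ∧ y = .bool true))

def vOr (x y : Value) : Value :=
  if (x = .null ∧ y = .null) ∨ (x = .null ∧ y = .bool false) ∨ (x = .bool false ∧ y = .null)
  then .null else .bool (decide (x = .bool true ∨ y = .bool true))

def vNot (x : Value) : Value :=
  if x = .null then .null else .bool (decide (x ≠ .bool true))

/-- Minimum of integers, where `null` stands for `+∞`. -/
def vMin (x y : Value) : Value :=
  if x = .null then (if y = .null then .null else .int y.num)
  else if y = .null then .int x.num else .int (min x.num y.num)

/-- Maximum of integers, where `null` stands for `-∞`. -/
def vMax (x y : Value) : Value :=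
  if x = .null then (if y = .null then .null else .int y.num)
  else if y = .null then .int x.num else .int (max x.num y.num)

/-- The three-valued truth value of `⋁ᵢ ⋀ⱼ uⱼ = vᵢⱼ`. -/
def vMember (us : List Value) (rows : List (List Value)) : Value :=
  rows.foldl (fun acc r =>
    vOr acc ((List.zipWith (vCmp .eq) us r).foldr vAnd (.bool true))) (.bool false)

/-- First-match evaluation of `Case`. -/
def vCase : List Value → List Value → Value → Value
  | b :: bs, v :: vs, d => if b = .bool true then v else vCase bs vs d
  | _, _, d => d

/-- An aggregate function applied to the list of the values of its argument. -/
def vAgg (G : AggOp) (us : List Value) : Value :=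
  let allNull := us.all (fun u => decide (u = .null))
  let count : Value := if allNull then .null else
    .int ((us.map (fun u => if u = .null then (0 : ℤ) else 1)).foldl (· + ·) 0)
  let sum : Value := if allNull then .null else
    .int ((us.map (fun u => if u = .null then (0 : ℤ) else u.num)).foldl (· + ·) 0)
  match G with
  | .count => count
  | .sum => sum
  | .avg => vArith .div sum count
  | .min => if allNull then .null else us.foldl vMin .null
  | .max => if allNull then .null else us.foldl vMax .null

/-! ### Operations on relations -/

def dedup {α : Type} [DecidableEq α] (xs : List α) : List α :=
  xs.foldr (fun x acc => x :: acc.filter (fun y => decide (x ≠ y))) []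

/-- Bag difference: every `y` deletes one occurrence of itself, if there is one. -/
def bagDiff (xs ys : Relation) : Relation :=
  ys.foldl (fun acc y => if y ∈ acc then acc.erase y else acc) xs

def cross (xs ys : Relation) : Relation :=
  xs.foldl (fun acc x => acc ++ ys.map (fun y => x ++ y)) []

def nullTuple (A : List AttrName) : Tuple := A.map (fun a => (a, Value.null))

/-- Joins; `f` is the join predicate, `A₁` and `A₂` are the attributes of the operands. -/
def joinRel (k : JoinKind) (A₁ A₂ : List AttrName) (f : Tuple → Bool) (xs ys : Relation) :
    Relation :=
  let inner : Relation → Relation → Relation := fun xs ys => (cross xs ys).filter f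
  let left := xs.foldl (fun acc x => acc ++
    (if (inner [x] ys).length = 0 then [x ++ nullTuple A₂] else inner [x] ys)) []
  match k with
  | .inner => inner xs ys
  | .left => left
  | .right => ys.foldl (fun acc y => acc ++
      (if (inner xs [y]).length = 0 then [nullTuple A₁ ++ y] else inner xs [y])) []
  | .full => left ++
      (ys.filter (fun y => decide ((inner xs [y]).length = 0))).map (fun y => nullTuple A₁ ++ y)

def collRel : CollOp → Relation → Relation → Relation
  | .union, xs, ys => dedup (xs ++ ys)
  | .inter, xs, ys => (dedup xs).filter (fun x => decide (x ∈ ys))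
  | .diff, xs, ys => (dedup xs).filter (fun x => decide (x ∉ ys))
  | .unionAll, xs, ys => xs ++ ys
  | .interAll, xs, ys => bagDiff xs (bagDiff xs ys)
  | .diffAll, xs, ys => bagDiff xs ys

/-- The groups of `xs` with respect to the key function `key`. -/
def groups (key : Tuple → List Value) (xs : Relation) : List Relation :=
  (dedup (xs.map key)).map (fun y => xs.filter (fun z => decide (key z = y)))

/-! ### Semantics of queries -/

mutual

/-- `⟦Q⟧_D`. The schema is only used to find the attributes of the `NULL` tuples in outer joins. -/
def Query.denot : Query → SchemaEnv → Database → Relation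
  | .rel R, _, D => (D R).getD []
  | .proj L Q, S, D =>
      if hasAgg L then [Item.denotList L S D (Q.denot S D)]
      else (Q.denot S D).map (fun x => Item.denotList L S D [x])
  | .select φ Q, S, D => (Q.denot S D).filter (fun x => decide (φ.denot S D [x] = .bool true))
  | .rename R Q, S, D =>
      (Q.denot S D).map (fun x => x.map (fun nv => (VeriEQL.rename R nv.1, nv.2)))
  | .coll op Q₁ Q₂, S, D => collRel op (Q₁.denot S D) (Q₂.denot S D)
  | .distinct Q, S, D => dedup (Q.denot S D)
  | .prod Q₁ Q₂, S, D => cross (Q₁.denot S D) (Q₂.denot S D)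
  | .join k φ Q₁ Q₂, S, D =>
      joinRel k (Q₁.attrs S) (Q₂.attrs S) (fun x => decide (φ.denot S D [x] = .bool true))
        (Q₁.denot S D) (Q₂.denot S D)
  | .groupBy Q Es L φ, S, D =>
      ((groups (fun z => Expr.denotList Es S D [z]) (Q.denot S D)).filter
        (fun xs => decide (φ.denot S D xs = .bool true))).map (fun xs => Item.denotList L S D xs)
  | .withQ Qs Rs Q, S, D =>
      Q.denot (update S Rs (Query.attrsList Qs S)) (update D Rs (Query.denotList Qs S D))

def Query.denotList : List Query → SchemaEnv → Database → List Relation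
  | [], _, _ => []
  | Q :: Qs, S, D => Q.denot S D :: Query.denotList Qs S D

def Item.denot : Item → SchemaEnv → Database → Relation → AttrName × Value
  | .id A, S, D, xs => (A.print, A.denot S D xs)
  | .named a A, S, D, xs => (a, A.denot S D xs)

def Item.denotList : List Item → SchemaEnv → Database → Relation → Tuple
  | [], _, _, _ => []
  | e :: L, S, D, xs => e.denot S D xs :: Item.denotList L S D xs

def Attr.denot : Attr → SchemaEnv → Database → Relation → Value
  | .cast φ, S, D, xs =>
      if φ.denot S D xs = .null then .null
      else if φ.denot S D xs = .bool true then .int 1 else .int 0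
  | .expr E, S, D, xs => E.denot S D xs
  | .agg G E, S, D, xs => vAgg G (xs.map (fun y => E.denot S D [y]))
  | .arith op A₁ A₂, S, D, xs => vArith op (A₁.denot S D xs) (A₂.denot S D xs)

def Pred.denot : Pred → SchemaEnv → Database → Relation → Value
  | .lit b, _, _, _ => .bool b
  | .null, _, _, _ => .null
  | .cmp op A₁ A₂, S, D, xs => vCmp op (A₁.denot S D xs) (A₂.denot S D xs)
  | .isNull E, S, D, xs => .bool (decide (E.denot S D xs = .null))
  | .inVals Es rows, S, D, xs => vMember (Expr.denotList Es S D xs) rows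
  | .inQuery Es Q, S, D, xs =>
      vMember (Expr.denotList Es S D xs) ((Q.denot S D).map (fun y => y.map Prod.snd))
  | .and φ₁ φ₂, S, D, xs => vAnd (φ₁.denot S D xs) (φ₂.denot S D xs)
  | .or φ₁ φ₂, S, D, xs => vOr (φ₁.denot S D xs) (φ₂.denot S D xs)
  | .not φ, S, D, xs => vNot (φ.denot S D xs)

def Pred.denotList : List Pred → SchemaEnv → Database → Relation → List Value
  | [], _, _, _ => []
  | φ :: φs, S, D, xs => φ.denot S D xs :: Pred.denotList φs S D xs

def Expr.denot : Expr → SchemaEnv → Database → Relation → Value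
  | .attr a, _, _, xs => lookup (xs.headD []) a
  | .val v, _, _, _ => v
  | .arith op E₁ E₂, S, D, xs => vArith op (E₁.denot S D xs) (E₂.denot S D xs)
  | .ite φ E₁ E₂, S, D, xs =>
      if φ.denot S D xs = .bool true then E₁.denot S D xs else E₂.denot S D xs
  | .case φs Es E, S, D, xs =>
      vCase (Pred.denotList φs S D xs) (Expr.denotList Es S D xs) (E.denot S D xs)

def Expr.denotList : List Expr → SchemaEnv → Database → Relation → List Value
  | [], _, _, _ => []
  | E :: Es, S, D, xs => E.denot S D xs :: Expr.denotList Es S D xs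

end

/-- Comparison of sort keys: `NULL` counts as `-∞`. -/
def keyLess : Value → Value → Bool
  | .null, .null => false
  | .null, _ => true
  | _, .null => false
  | x, y => decide (x.num < y.num)

/-- `Cmp`: should `x₂` be preferred to `x₁`? The arguments are the lists of key values. -/
def sortCmp (asc : Bool) (k₁ k₂ : List Value) : Bool :=
  asc != (k₁.zip k₂).foldr (fun uv acc =>
    if keyLess uv.1 uv.2 then true else if keyLess uv.2 uv.1 then false else acc) true

def minTuple (key : Tuple → List Value) (asc : Bool) (xs : Relation) : Tuple :=
  xs.foldl (fun x y => if sortCmp asc (key x) (key y) then y else x) (xs.headD [])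

/-- Selection sort. -/
def sortRel (key : Tuple → List Value) (asc : Bool) (xs : Relation) : Relation :=
  xs.foldl (fun acc _ => acc ++ [minTuple key asc (bagDiff xs acc)]) []

def TopQuery.denot : TopQuery → SchemaEnv → Database → Relation
  | .sub Q, S, D => Q.denot S D
  | .orderBy Q Es asc, S, D => sortRel (fun x => Expr.denotList Es S D [x]) asc (Q.denot S D)

/-! ### Symbolic tuples, terms and formulas -/

/-- Positions in a query. -/
abbrev Path := List ℕ

/-- Tuple variables: those of the initial symbolic database, and those generated while encoding.
`fresh p k i` is the `i`-th variable of the `k`-th list generated at the position `p`. -/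
inductive TupVar where
  | base (n : ℕ)
  | fresh (p : Path) (k i : ℕ)
  deriving DecidableEq

/-- A symbolic database maps relation names to lists of symbolic tuples. -/
abbrev SymDB := RelName → Option (List TupVar)

/-- `n` fresh tuples. -/
def freshTuples (p : Path) (k n : ℕ) : List TupVar := (List.range n).map (TupVar.fresh p k)

/-- Symbols that an interpretation has to give a meaning: tuple variables (with their attribute
values and their `Del` status), the grouping predicate `g` of a `GroupBy`, the predicate `Paired`
of a bag difference, and the function `find` of an `OrderBy`. -/
inductive Sym where
  | tup (t : TupVar)
  | grp (p : Path)
  | paired (p : Path) (k : ℕ)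
  | find (p : Path)
  deriving DecidableEq

mutual

/-- Terms. `arith` is plain integer arithmetic, `min` and `max` treat `NULL` as `±∞`. -/
inductive Term where
  | const (v : Value)
  | attr (a : AttrName) (t : TupVar)
  | arith (op : ArithOp) (x y : Term)
  | min (x y : Term)
  | max (x y : Term)
  | ite (c : Formula) (x y : Term)

/-- Formulas. `eq` is identity of values (so `NULL` equals `NULL`), `cmp` is plain integer
comparison, `grp p i j` is `g(tᵢ, j)`, and `findEq p i k` is `find(i) = k`. -/
inductive Formula where
  | lit (b : Bool)
  | del (t : TupVar)
  | eq (x y : Term)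
  | cmp (op : CmpOp) (x y : Term)
  | and (A B : Formula)
  | or (A B : Formula)
  | not (A : Formula)
  | grp (p : Path) (i j : ℕ)
  | paired (p : Path) (k i j : ℕ)
  | findEq (p : Path) (i k : ℕ)

end

/-- An interpretation: a set `dom` of symbols and their meanings. What the components do outside of
`dom` is irrelevant. -/
structure Interp where
  dom : Set Sym
  tup : TupVar → Tuple
  del : TupVar → Bool
  grp : Path → ℕ → ℕ → Bool
  paired : Path → ℕ → ℕ → ℕ → Bool
  find : Path → ℕ → ℕ

mutual

def Term.eval (I : Interp) : Term → Value
  | .const v => v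
  | .attr a t => lookup (I.tup t) a
  | .arith op x y => .int (op.eval (x.eval I).num (y.eval I).num)
  | .min x y => vMin (x.eval I) (y.eval I)
  | .max x y => vMax (x.eval I) (y.eval I)
  | .ite c x y => if c.eval I then x.eval I else y.eval I

def Formula.eval (I : Interp) : Formula → Bool
  | .lit b => b
  | .del t => I.del t
  | .eq x y => decide (x.eval I = y.eval I)
  | .cmp op x y => op.eval (x.eval I).num (y.eval I).num
  | .and A B => A.eval I && B.eval I
  | .or A B => A.eval I || B.eval I
  | .not A => !(A.eval I)
  | .grp p i j => I.grp p i j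
  | .paired p k i j => I.paired p k i j
  | .findEq p i k => decide (I.find p i = k)

end

mutual

/-- The symbols occurring in a term. -/
def Term.syms : Term → List Sym
  | .const _ => []
  | .attr _ t => [.tup t]
  | .arith _ x y => x.syms ++ y.syms
  | .min x y => x.syms ++ y.syms
  | .max x y => x.syms ++ y.syms
  | .ite c x y => c.syms ++ x.syms ++ y.syms

/-- The symbols occurring in a formula. -/
def Formula.syms : Formula → List Sym
  | .lit _ => []
  | .del t => [.tup t]
  | .eq x y => x.syms ++ y.syms
  | .cmp _ x y => x.syms ++ y.syms
  | .and A B => A.syms ++ B.syms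
  | .or A B => A.syms ++ B.syms
  | .not A => A.syms
  | .grp p _ _ => [.grp p]
  | .paired p k _ _ => [.paired p k]
  | .findEq p _ _ => [.find p]

end

/-- `I(T)`: the concrete relation denoted by a list of symbolic tuples. Deleted tuples are absent. -/
def Interp.rel (I : Interp) (T : List TupVar) : Relation :=
  (T.filter (fun t => !(I.del t))).map I.tup

/-- The interpretations `I'` and `I` give the same meaning to a symbol. -/
def Interp.AgreeOn (I' I : Interp) : Sym → Prop
  | .tup t => I'.tup t = I.tup t ∧ I'.del t = I.del t
  | .grp p => I'.grp p = I.grp p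
  | .paired p k => I'.paired p k = I.paired p k
  | .find p => I'.find p = I.find p

/-- `I' ⊒ I`. -/
def Interp.Extends (I' I : Interp) : Prop :=
  I.dom ⊆ I'.dom ∧ ∀ s ∈ I.dom, I'.AgreeOn I s

/-- `I, D ⊨ Φ`: all symbols of `Φ` are interpreted and `Φ` is true. The database interprets the
relation names; the formulas of the encoding speak about symbolic tuples only. -/
def Models (I : Interp) (_D : Database) (Φ : Formula) : Prop :=
  (∀ s ∈ Φ.syms, s ∈ I.dom) ∧ Φ.eval I = true

/-! ### Derived formulas and terms -/

def Formula.imp (A B : Formula) : Formula := .or (.not A) B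

def Formula.iff (A B : Formula) : Formula := .and (A.imp B) (B.imp A)

def Formula.all (l : List Formula) : Formula := l.foldr .and (.lit true)

def Formula.any (l : List Formula) : Formula := l.foldr .or (.lit false)

def Term.int (n : ℤ) : Term := .const (.int n)

def Term.nil : Term := .const .null

def Term.isNull (x : Term) : Formula := .eq x .nil

def Term.isTrue (x : Term) : Formula := .eq x (.const (.bool true))

def Term.isFalse (x : Term) : Formula := .eq x (.const (.bool false))

/-- A formula as a term with a boolean value. -/
def Formula.toTerm (A : Formula) : Term := .ite A (.const (.bool true)) (.const (.bool false))

def Term.sum (l : List Term) : Term := l.foldl (Term.arith .add) (.int 0)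

def tArith (op : ArithOp) (x y : Term) : Term :=
  .ite (.or x.isNull y.isNull) .nil (.arith op x y)

def tCmp (op : CmpOp) (x y : Term) : Term :=
  .ite (.or x.isNull y.isNull) .nil (Formula.cmp op x y).toTerm

def tAnd (x y : Term) : Term :=
  .ite (.or (.and x.isNull y.isNull) (.or (.and x.isNull y.isTrue) (.and x.isTrue y.isNull)))
    .nil (Formula.and x.isTrue y.isTrue).toTerm

def tOr (x y : Term) : Term :=
  .ite (.or (.and x.isNull y.isNull) (.or (.and x.isNull y.isFalse) (.and x.isFalse y.isNull)))
    .nil (Formula.or x.isTrue y.isTrue).toTerm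

def tNot (x : Term) : Term := .ite x.isNull .nil (Formula.not x.isTrue).toTerm

/-- `⟦⋀ⱼ uⱼ = vⱼ⟧`, three-valued. -/
def tRowEq (us vs : List Term) : Term :=
  (List.zipWith (tCmp .eq) us vs).foldr tAnd (.const (.bool true))

/-- `⟦⋁ᵢ φᵢ⟧`, three-valued. -/
def tAny (l : List Term) : Term := l.foldl tOr (.const (.bool false))

def tCase : List Term → List Term → Term → Term
  | b :: bs, v :: vs, d => .ite b.isTrue v (tCase bs vs d)
  | _, _, d => d

/-- A list of symbolic tuples in which each tuple is present under a condition. Plain lists have the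
condition `⊤`; the list `g⁻¹(i)` of the members of the group `i` has the conditions `g(t, i)`. -/
abbrev GTuples := List (Formula × TupVar)

def plain (T : List TupVar) : GTuples := T.map (fun t => (Formula.lit true, t))

/-- The attribute `a` of the first tuple of the list. -/
def firstAttr (a : AttrName) : GTuples → Term
  | [] => .nil
  | (c, t) :: T => .ite c (.attr a t) (firstAttr a T)

/-- Aggregates; `u t` is the argument evaluated on `[t]`. Tuples that are absent or deleted do not
count. -/
def tAgg (G : AggOp) (u : TupVar → Term) (T : GTuples) : Term :=
  let live : Formula × TupVar → Formula := fun ct => .and ct.1 (.not (.del ct.2))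
  let allNull := Formula.all (T.map (fun ct => (live ct).imp (u ct.2).isNull))
  let skip : Formula × TupVar → Formula := fun ct => .or (.not (live ct)) (u ct.2).isNull
  let count : Term := .ite allNull .nil
    (Term.sum (T.map (fun ct => .ite (skip ct) (.int 0) (.int 1))))
  let sum : Term := .ite allNull .nil
    (Term.sum (T.map (fun ct => .ite (skip ct) (.int 0) (u ct.2))))
  match G with
  | .count => count
  | .sum => sum
  | .avg => tArith .div sum count
  | .min => .ite allNull .nil
      ((T.map (fun ct => Term.ite (skip ct) .nil (u ct.2))).foldl Term.min .nil)
  | .max => .ite allNull .nil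
      ((T.map (fun ct => Term.ite (skip ct) .nil (u ct.2))).foldl Term.max .nil)

/-! ### Symbolic tuples of intermediate results -/

mutual

/-- `Γ ⊢ Q ↪ symTuples Q Γ p`, for the query `Q` at the position `p`. -/
def Query.symTuples : Query → SymDB → Path → List TupVar
  | .rel R, Γ, _ => (Γ R).getD []
  | .proj L Q, Γ, p =>
      if hasAgg L then freshTuples p 0 1 else freshTuples p 0 (Q.symTuples Γ (1 :: p)).length
  | .select _ Q, Γ, p => freshTuples p 0 (Q.symTuples Γ (1 :: p)).length
  | .rename _ Q, Γ, p => freshTuples p 0 (Q.symTuples Γ (0 :: p)).length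
  | .coll op Q₁ Q₂, Γ, p =>
      let n := (Q₁.symTuples Γ (0 :: p)).length
      let m := (Q₂.symTuples Γ (1 :: p)).length
      match op with
      | .unionAll => freshTuples p 0 (n + m)
      | .union => freshTuples p 1 (n + m)
      | .diffAll => freshTuples p 0 n
      | .inter | .diff | .interAll => freshTuples p 1 n
  | .distinct Q, Γ, p => freshTuples p 0 (Q.symTuples Γ (0 :: p)).length
  | .prod Q₁ Q₂, Γ, p =>
      freshTuples p 0 ((Q₁.symTuples Γ (0 :: p)).length * (Q₂.symTuples Γ (1 :: p)).length)
  | .join k _ Q₁ Q₂, Γ, p =>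
      let n := (Q₁.symTuples Γ (0 :: p)).length
      let m := (Q₂.symTuples Γ (1 :: p)).length
      match k with
      | .inner => freshTuples p 1 (n * m)
      | .left => freshTuples p 1 (n * m) ++ freshTuples p 2 n
      | .right => freshTuples p 1 (n * m) ++ freshTuples p 3 m
      | .full => freshTuples p 1 (n * m) ++ (freshTuples p 3 m ++ freshTuples p 2 n)
  | .groupBy Q _ _ _, Γ, p => freshTuples p 0 (Q.symTuples Γ (0 :: p)).length
  | .withQ Qs Rs Q, Γ, p =>
      Q.symTuples (update Γ Rs (Query.symTuplesList Qs Γ (0 :: p))) (1 :: p)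

def Query.symTuplesList : List Query → SymDB → Path → List (List TupVar)
  | [], _, _ => []
  | Q :: Qs, Γ, p => Q.symTuples Γ (0 :: p) :: Query.symTuplesList Qs Γ (1 :: p)

end

/-- `Γ ⊢ Q ↪ R` for complete queries. -/
def TopQuery.symTuples : TopQuery → SymDB → List TupVar
  | .sub Q, Γ => Q.symTuples Γ []
  | .orderBy Q _ _, Γ => freshTuples [] 1 (Q.symTuples Γ [0]).length

/-! ### Encoding of the operators -/

/-- `t'.a = t.a` for all `a` in `A`. -/
def sameOn (A : List AttrName) (t' t : TupVar) : Formula :=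
  Formula.all (A.map (fun a => .eq (.attr a t') (.attr a t)))

/-- `t' = t`, for tuples with attributes `A'` and `A`: the same values and the same `Del`. -/
def copy (A' A : List AttrName) (t' t : TupVar) : Formula :=
  .and (Formula.all (List.zipWith (fun a' a => .eq (.attr a' t') (.attr a t)) A' A))
    (Formula.iff (.del t') (.del t))

def copyAll (A' A : List AttrName) (T' T : List TupVar) : Formula :=
  Formula.all (List.zipWith (copy A' A) T' T)

/-- `t ∈ T`: some tuple of `T` that is not deleted has the same values. -/
def memTuples (A : List AttrName) (t : TupVar) (T : List TupVar) : Formula :=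
  Formula.any (T.map (fun s => .and (.not (.del s)) (sameOn A t s)))

def projF (names : List AttrName) (u : TupVar → List Term) (T T' : List TupVar) : Formula :=
  Formula.all (List.zipWith (fun t t' =>
    .and (Formula.all (List.zipWith (fun a x => .eq (.attr a t') x) names (u t)))
      (Formula.iff (.del t') (.del t))) T T')

def aggF (names : List AttrName) (us : List Term) (t' : TupVar) : Formula :=
  .and (Formula.all (List.zipWith (fun a x => .eq (.attr a t') x) names us)) (.not (.del t'))

def filterF (A : List AttrName) (φ : TupVar → Term) (T T' : List TupVar) : Formula :=
  Formula.all (List.zipWith (fun t t' =>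
    .and (Formula.imp (.and (.not (.del t)) (φ t).isTrue) (copy A A t' t))
      (Formula.imp (.or (.del t) (.not (φ t).isTrue)) (.del t'))) T T')

/-- `T` is the list of the `tup i j`, row by row. -/
def prodF (A₁ A₂ : List AttrName) (T₁ T₂ : List TupVar) (tup : ℕ → ℕ → TupVar) : Formula :=
  Formula.all (T₁.zipIdx.flatMap (fun ti => T₂.zipIdx.map (fun tj =>
    let t := ti.1
    let t' := tj.1
    let t'' := tup ti.2 tj.2
    .and
      (Formula.imp (.and (.not (.del t)) (.not (.del t')))
        (.and (.and (sameOn A₁ t'' t) (sameOn A₂ t'' t')) (.not (.del t''))))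
      (Formula.imp (.or (.del t) (.del t')) (.del t'')))))

def nullOn (A : List AttrName) (t : TupVar) : Formula :=
  Formula.all (A.map (fun a => (Term.attr a t).isNull))

/-- The `NULL` extensions of the left operand: `ext i` is present exactly if `tᵢ` is and all
`tup i j` are deleted. -/
def leftF (A₁ A₂ : List AttrName) (T₁ : List TupVar) (m : ℕ) (tup : ℕ → ℕ → TupVar)
    (ext : ℕ → TupVar) : Formula :=
  Formula.all (T₁.zipIdx.map (fun ti =>
    .and (.and (sameOn A₁ (ext ti.2) ti.1) (nullOn A₂ (ext ti.2)))
      (Formula.iff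
        (.and (.not (.del ti.1))
          (Formula.all ((List.range m).map (fun j => .del (tup ti.2 j)))))
        (.not (.del (ext ti.2))))))

/-- The `NULL` extensions of the right operand. -/
def rightF (A₁ A₂ : List AttrName) (T₂ : List TupVar) (n : ℕ) (tup : ℕ → ℕ → TupVar)
    (ext : ℕ → TupVar) : Formula :=
  Formula.all (T₂.zipIdx.map (fun tj =>
    .and (.and (nullOn A₁ (ext tj.2)) (sameOn A₂ (ext tj.2) tj.1))
      (Formula.iff
        (.and (.not (.del tj.1))
          (Formula.all ((List.range n).map (fun i => .del (tup i tj.2)))))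
        (.not (.del (ext tj.2))))))

/-- The encoding of a join at the position `p`, without that of its operands. Lists generated at `p`:
`0` the product, `1` the filtered product, `2` and `3` the left and right `NULL` extensions. -/
def joinF (k : JoinKind) (A₁ A₂ : List AttrName) (φ : TupVar → Term) (T₁ T₂ : List TupVar)
    (p : Path) : Formula :=
  let n := T₁.length
  let m := T₂.length
  let inner := Formula.and (prodF A₁ A₂ T₁ T₂ (fun i j => .fresh p 0 (i * m + j)))
    (filterF (A₁ ++ A₂) φ (freshTuples p 0 (n * m)) (freshTuples p 1 (n * m)))
  let left := leftF A₁ A₂ T₁ m (fun i j => .fresh p 1 (i * m + j)) (.fresh p 2)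
  let right := rightF A₁ A₂ T₂ n (fun i j => .fresh p 1 (i * m + j)) (.fresh p 3)
  match k with
  | .inner => inner
  | .left => .and inner left
  | .right => .and inner right
  | .full => .and (.and inner left) right

/-- De-duplication: a tuple survives if it does not occur among the earlier ones. -/
def dedupF (A : List AttrName) (T T' : List TupVar) : Formula :=
  Formula.all (List.zipWith (fun ti t' =>
    let earlier := memTuples A ti.1 (T.take ti.2)
    .and (Formula.imp earlier (.del t')) (Formula.imp (.not earlier) (copy A A t' ti.1)))
    T.zipIdx T')

def interF (A : List AttrName) (T T₂ T' : List TupVar) : Formula :=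
  Formula.all (List.zipWith (fun t t' =>
    .and (Formula.imp (memTuples A t T₂) (copy A A t' t))
      (Formula.imp (.not (memTuples A t T₂)) (.del t'))) T T')

def diffF (A : List AttrName) (T T₂ T' : List TupVar) : Formula :=
  Formula.all (List.zipWith (fun t t' =>
    .and (Formula.imp (.not (memTuples A t T₂)) (copy A A t' t))
      (Formula.imp (memTuples A t T₂) (.del t'))) T T')

/-- Bag difference, with the predicate `Paired` number `k` of the position `p`. -/
def diffAllF (A : List AttrName) (T₁ T₂ T' : List TupVar) (p : Path) (k : ℕ) : Formula :=
  .and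
    (Formula.all (T₁.zipIdx.flatMap (fun ti => T₂.zipIdx.map (fun tj =>
      Formula.iff (.paired p k ti.2 tj.2)
        (.and
          (.and (.and (.not (.del ti.1)) (.not (.del tj.1))) (sameOn A ti.1 tj.1))
          (.and (Formula.all ((List.range ti.2).map (fun l => .not (.paired p k l tj.2))))
            (Formula.all ((List.range tj.2).map (fun l => .not (.paired p k ti.2 l))))))))))
    (Formula.all (List.zipWith (fun ti t' =>
      let unpaired := Formula.all ((List.range T₂.length).map (fun j => .not (.paired p k ti.2 j)))
      let hit := Formula.any ((List.range T₂.length).map (fun j => .paired p k ti.2 j))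
      .and (Formula.imp (.and (.not (.del ti.1)) unpaired) (copy A A t' ti.1))
        (Formula.imp (.or (.del ti.1) hit) (.del t'))) T₁.zipIdx T'))

/-- The encoding of a collection operator at the position `p`, without that of its operands. -/
def collF (op : CollOp) (A : List AttrName) (T₁ T₂ : List TupVar) (p : Path) : Formula :=
  let n := T₁.length
  let m := T₂.length
  match op with
  | .unionAll => copyAll A A (freshTuples p 0 (n + m)) (T₁ ++ T₂)
  | .union => .and (copyAll A A (freshTuples p 0 (n + m)) (T₁ ++ T₂))
      (dedupF A (freshTuples p 0 (n + m)) (freshTuples p 1 (n + m)))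
  | .inter => .and (dedupF A T₁ (freshTuples p 0 n))
      (interF A (freshTuples p 0 n) T₂ (freshTuples p 1 n))
  | .diff => .and (dedupF A T₁ (freshTuples p 0 n))
      (diffF A (freshTuples p 0 n) T₂ (freshTuples p 1 n))
  | .diffAll => diffAllF A T₁ T₂ (freshTuples p 0 n) p 0
  | .interAll => .and (diffAllF A T₁ T₂ (freshTuples p 0 n) p 0)
      (diffAllF A T₁ (freshTuples p 0 n) (freshTuples p 1 n) p 1)

/-- `g⁻¹(k)`. -/
def groupMembers (p : Path) (T : List TupVar) (k : ℕ) : GTuples :=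
  T.zipIdx.map (fun ti => (Formula.grp p ti.2 k, ti.1))

/-- The encoding of `GroupBy` at the position `p`. A tuple belongs to the group whose index is that of
the first tuple with the same keys; deleted tuples belong to no group. -/
def groupF (names : List AttrName) (keys : TupVar → List Term) (L : GTuples → List Term)
    (φ : GTuples → Term) (T T' : List TupVar) (p : Path) : Formula :=
  .and
    (Formula.all (T.zipIdx.map (fun ti =>
      .and
        (.eq (Term.sum ((List.range (ti.2 + 1)).map
            (fun j => .ite (.grp p ti.2 j) (.int 1) (.int 0))))
          (.ite (.del ti.1) (.int 0) (.int 1)))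
        (.and
          (Formula.all ((T.zipIdx.take ti.2).map (fun tj =>
            Formula.iff (.grp p ti.2 tj.2)
              (.and (.not (.del ti.1)) (.and (.grp p tj.2 tj.2)
                (Formula.all (List.zipWith Formula.eq (keys ti.1) (keys tj.1))))))))
          (Formula.all ((T.zipIdx.drop (ti.2 + 1)).map (fun tj =>
            .not (.grp p ti.2 tj.2))))))))
    (Formula.all (T'.zipIdx.map (fun ti =>
      let i := ti.2
      let t' := ti.1
      let G := groupMembers p T i
      .and
        (Formula.imp (.and (.grp p i i) (φ G).isTrue)
          (.and (.not (.del t'))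
            (Formula.all (List.zipWith (fun a x => .eq (.attr a t') x) names (L G)))))
        (Formula.imp (.or (.not (.grp p i i)) (.not (φ G).isTrue)) (.del t')))))

/-! ### Encoding of queries, predicates and expressions

The last list argument of the functions on expressions is the list of symbolic tuples on which they
are evaluated. -/

mutual

/-- `S, Γ ⊢ Q ⇝ encode Q S Γ p`, for the query `Q` at the position `p`. -/
def Query.encode : Query → SchemaEnv → SymDB → Path → Formula
  | .rel _, _, _, _ => .lit true
  | .proj L Q, S, Γ, p =>
      let T := Q.symTuples Γ (1 :: p)
      .and (Q.encode S Γ (1 :: p))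
        (if hasAgg L then
          aggF (L.map Item.name) (Item.encodeList L S Γ (0 :: p) (plain T)) (.fresh p 0 0)
        else
          projF (L.map Item.name) (fun t => Item.encodeList L S Γ (0 :: p) (plain [t]))
            T (freshTuples p 0 T.length))
  | .select φ Q, S, Γ, p =>
      let T := Q.symTuples Γ (1 :: p)
      .and (Q.encode S Γ (1 :: p))
        (filterF (Q.attrs S) (fun t => φ.encode S Γ (0 :: p) (plain [t]))
          T (freshTuples p 0 T.length))
  | .rename R Q, S, Γ, p =>
      let T := Q.symTuples Γ (0 :: p)
      .and (Q.encode S Γ (0 :: p))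
        (copyAll ((Q.attrs S).map (VeriEQL.rename R)) (Q.attrs S) (freshTuples p 0 T.length) T)
  | .coll op Q₁ Q₂, S, Γ, p =>
      .and (.and (Q₁.encode S Γ (0 :: p)) (Q₂.encode S Γ (1 :: p)))
        (collF op (Q₁.attrs S) (Q₁.symTuples Γ (0 :: p)) (Q₂.symTuples Γ (1 :: p)) p)
  | .distinct Q, S, Γ, p =>
      let T := Q.symTuples Γ (0 :: p)
      .and (Q.encode S Γ (0 :: p)) (dedupF (Q.attrs S) T (freshTuples p 0 T.length))
  | .prod Q₁ Q₂, S, Γ, p =>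
      let T₁ := Q₁.symTuples Γ (0 :: p)
      let T₂ := Q₂.symTuples Γ (1 :: p)
      .and (.and (Q₁.encode S Γ (0 :: p)) (Q₂.encode S Γ (1 :: p)))
        (prodF (Q₁.attrs S) (Q₂.attrs S) T₁ T₂ (fun i j => .fresh p 0 (i * T₂.length + j)))
  | .join k φ Q₁ Q₂, S, Γ, p =>
      .and (.and (Q₁.encode S Γ (0 :: p)) (Q₂.encode S Γ (1 :: p)))
        (joinF k (Q₁.attrs S) (Q₂.attrs S) (fun t => φ.encode S Γ (2 :: p) (plain [t]))
          (Q₁.symTuples Γ (0 :: p)) (Q₂.symTuples Γ (1 :: p)) p)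
  | .groupBy Q Es L φ, S, Γ, p =>
      let T := Q.symTuples Γ (0 :: p)
      .and (Q.encode S Γ (0 :: p))
        (groupF (L.map Item.name) (fun t => Expr.encodeList Es S Γ (1 :: p) (plain [t]))
          (fun G => Item.encodeList L S Γ (2 :: p) G) (fun G => φ.encode S Γ (3 :: p) G)
          T (freshTuples p 0 T.length) p)
  | .withQ Qs Rs Q, S, Γ, p =>
      .and (Query.encodeList Qs S Γ (0 :: p))
        (Q.encode (update S Rs (Query.attrsList Qs S))
          (update Γ Rs (Query.symTuplesList Qs Γ (0 :: p))) (1 :: p))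

def Query.encodeList : List Query → SchemaEnv → SymDB → Path → Formula
  | [], _, _, _ => .lit true
  | Q :: Qs, S, Γ, p => .and (Q.encode S Γ (0 :: p)) (Query.encodeList Qs S Γ (1 :: p))

def Item.encode : Item → SchemaEnv → SymDB → Path → GTuples → Term
  | .id A, S, Γ, p, T => A.encode S Γ (0 :: p) T
  | .named _ A, S, Γ, p, T => A.encode S Γ (0 :: p) T

def Item.encodeList : List Item → SchemaEnv → SymDB → Path → GTuples → List Term
  | [], _, _, _, _ => []
  | e :: L, S, Γ, p, T => e.encode S Γ (0 :: p) T :: Item.encodeList L S Γ (1 :: p) T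

def Attr.encode : Attr → SchemaEnv → SymDB → Path → GTuples → Term
  | .cast φ, S, Γ, p, T =>
      let v := φ.encode S Γ (0 :: p) T
      .ite v.isNull .nil (.ite v.isTrue (.int 1) (.int 0))
  | .expr E, S, Γ, p, T => E.encode S Γ (0 :: p) T
  | .agg G E, S, Γ, p, T => tAgg G (fun t => E.encode S Γ (0 :: p) (plain [t])) T
  | .arith op A₁ A₂, S, Γ, p, T =>
      tArith op (A₁.encode S Γ (0 :: p) T) (A₂.encode S Γ (1 :: p) T)

def Pred.encode : Pred → SchemaEnv → SymDB → Path → GTuples → Term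
  | .lit b, _, _, _, _ => .const (.bool b)
  | .null, _, _, _, _ => .nil
  | .cmp op A₁ A₂, S, Γ, p, T => tCmp op (A₁.encode S Γ (0 :: p) T) (A₂.encode S Γ (1 :: p) T)
  | .isNull E, S, Γ, p, T => (E.encode S Γ (0 :: p) T).isNull.toTerm
  | .inVals Es rows, S, Γ, p, T =>
      tAny (rows.map (fun r => tRowEq (Expr.encodeList Es S Γ (0 :: p) T) (r.map Term.const)))
  | .inQuery Es Q, S, Γ, p, T =>
      tAnd (Q.encode S Γ (1 :: p)).toTerm
        (tAny ((Q.symTuples Γ (1 :: p)).map (fun t =>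
          tAnd (Formula.not (.del t)).toTerm
            (tRowEq (Expr.encodeList Es S Γ (0 :: p) T)
              ((Q.attrs S).map (fun a => Term.attr a t))))))
  | .and φ₁ φ₂, S, Γ, p, T => tAnd (φ₁.encode S Γ (0 :: p) T) (φ₂.encode S Γ (1 :: p) T)
  | .or φ₁ φ₂, S, Γ, p, T => tOr (φ₁.encode S Γ (0 :: p) T) (φ₂.encode S Γ (1 :: p) T)
  | .not φ, S, Γ, p, T => tNot (φ.encode S Γ (0 :: p) T)

def Pred.encodeList : List Pred → SchemaEnv → SymDB → Path → GTuples → List Term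
  | [], _, _, _, _ => []
  | φ :: φs, S, Γ, p, T => φ.encode S Γ (0 :: p) T :: Pred.encodeList φs S Γ (1 :: p) T

def Expr.encode : Expr → SchemaEnv → SymDB → Path → GTuples → Term
  | .attr a, _, _, _, T => firstAttr a T
  | .val v, _, _, _, _ => .const v
  | .arith op E₁ E₂, S, Γ, p, T =>
      tArith op (E₁.encode S Γ (0 :: p) T) (E₂.encode S Γ (1 :: p) T)
  | .ite φ E₁ E₂, S, Γ, p, T =>
      .ite (φ.encode S Γ (0 :: p) T).isTrue (E₁.encode S Γ (1 :: p) T) (E₂.encode S Γ (2 :: p) T)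
  | .case φs Es E, S, Γ, p, T =>
      tCase (Pred.encodeList φs S Γ (0 :: p) T) (Expr.encodeList Es S Γ (1 :: p) T)
        (E.encode S Γ (2 :: p) T)

def Expr.encodeList : List Expr → SchemaEnv → SymDB → Path → GTuples → List Term
  | [], _, _, _, _ => []
  | E :: Es, S, Γ, p, T => E.encode S Γ (0 :: p) T :: Expr.encodeList Es S Γ (1 :: p) T

end

/-! ### Encoding of `OrderBy` -/

/-- The position of the `k`-th tuple once the deleted tuples have been moved to the end. -/
def posTerm (T : List TupVar) (k : ℕ) (t : TupVar) : Term :=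
  let dels : List TupVar → Term := fun l => Term.sum (l.map (fun s => .ite (.del s) (.int 1) (.int 0)))
  let lives : List TupVar → Term := fun l => Term.sum (l.map (fun s => .ite (.del s) (.int 0) (.int 1)))
  .ite (.del t) (.arith .add (lives T) (dels (T.take k))) (lives (T.take k))

/-- `moveDelToEnd(T, T'')`. -/
def moveDelToEndF (A : List AttrName) (T T'' : List TupVar) : Formula :=
  Formula.all (T.zipIdx.flatMap (fun tk => T''.zipIdx.map (fun ti =>
    Formula.imp (.eq (posTerm T tk.2 tk.1) (.int ti.2)) (copy A A ti.1 tk.1))))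

/-- Sort keys: `NULL` is below every integer. -/
def keyLt (x y : Term) : Formula :=
  .or (.and x.isNull (.not y.isNull))
    (.and (.and (.not x.isNull) (.not y.isNull)) (.cmp .lt x y))

def lexLt : List Term → List Term → Formula
  | x :: xs, y :: ys => .or (keyLt x y) (.and (.not (keyLt y x)) (lexLt xs ys))
  | _, _ => .lit false

/-- `t'ᵢ = t''_{find(i)}`, where `find` lists the tuples that are not deleted in the order given by
`keys` and `asc`: it is a bijection, it respects deletion, and no later tuple comes strictly before
an earlier one. -/
def findF (A : List AttrName) (keys : TupVar → List Term) (asc : Bool) (T'' T' : List TupVar)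
    (p : Path) : Formula :=
  let n := T''.length
  let before : TupVar → TupVar → Formula := fun s t =>
    if asc then lexLt (keys s) (keys t) else lexLt (keys t) (keys s)
  .and
    (Formula.all ((List.range n).map (fun k =>
      .eq (Term.sum ((List.range n).map (fun i => .ite (.findEq p i k) (.int 1) (.int 0))))
        (.int 1))))
    (.and
      (Formula.all ((T''.zip T').zipIdx.flatMap (fun si => T''.zipIdx.map (fun tk =>
        Formula.imp (.findEq p si.2 tk.2)
          (.and (Formula.iff (.del si.1.1) (.del tk.1)) (copy A A si.1.2 tk.1))))))
      (Formula.all (T'.zipIdx.flatMap (fun ti => (T'.drop (ti.2 + 1)).map (fun t =>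
        Formula.imp (.and (.not (.del ti.1)) (.not (.del t))) (.not (before t ti.1)))))))

/-- `S, Γ ⊢ Q ⇝ Φ` for complete queries. -/
def TopQuery.encode : TopQuery → SchemaEnv → SymDB → Formula
  | .sub Q, S, Γ => Q.encode S Γ []
  | .orderBy Q Es asc, S, Γ =>
      let T := Q.symTuples Γ [0]
      let A := Q.attrs S
      let T'' := freshTuples [] 0 T.length
      let T' := freshTuples [] 1 T.length
      .and (Q.encode S Γ [0])
        (.and (moveDelToEndF A T T'')
          (findF A (fun t => Expr.encodeList Es S Γ [1] (plain [t])) asc T'' T' []))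

/-! ### Symbolic databases and results -/

/-- `Γ` is a symbolic database over the schema `S`: it has the same relation names, and its tuples are
variables that exist before the encoding. -/
def SymOver (S : Schema) (Γ : SymDB) : Prop :=
  ∀ R, Option.Rel (fun _ T => ∀ t ∈ T, ∃ n, t = TupVar.base n) (S R) (Γ R)

/-- `I` interprets the tuples of `Γ` and `I(Γ) = D`, relations being bags. -/
def Interp.Realizes (I : Interp) (Γ : SymDB) (D : Database) : Prop :=
  ∀ R, Option.Rel (fun T rows => (∀ t ∈ T, Sym.tup t ∈ I.dom) ∧ (I.rel T).Perm rows) (Γ R) (D R)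

/-- Equality of results: of lists for `OrderBy`, of bags otherwise. -/
def TopQuery.SameResult : TopQuery → Relation → Relation → Prop
  | .sub _, xs, ys => xs.Perm ys
  | .orderBy _ _ _, xs, ys => xs = ys

end VeriEQL

namespace VeriEQL

/-! ### Evaluation of the derived formulas and terms -/

section Eval

variable (J : Interp)

@[simp] theorem Formula.eval_imp (A B : Formula) :
    (A.imp B).eval J = true ↔ (A.eval J = true → B.eval J = true) := by
  simp only [Formula.imp, Formula.eval]
  cases A.eval J <;> simp

@[simp] theorem Formula.eval_iff (A B : Formula) :
    (A.iff B).eval J = true ↔ (A.eval J = true ↔ B.eval J = true) := by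
  simp only [Formula.iff, Formula.eval, Bool.and_eq_true, Formula.eval_imp]
  tauto

@[simp] theorem Formula.eval_all (l : List Formula) :
    (Formula.all l).eval J = true ↔ ∀ A ∈ l, A.eval J = true := by
  induction l with
  | nil => simp [Formula.all, Formula.eval]
  | cons A l ih =>
    have : Formula.all (A :: l) = .and A (Formula.all l) := rfl
    simp [this, Formula.eval, ih]

@[simp] theorem Formula.eval_any (l : List Formula) :
    (Formula.any l).eval J = true ↔ ∃ A ∈ l, A.eval J = true := by
  induction l with
  | nil => simp [Formula.any, Formula.eval]
  | cons A l ih =>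
    have : Formula.any (A :: l) = .or A (Formula.any l) := rfl
    simp [this, Formula.eval, ih]

theorem Formula.eval_and_true (A B : Formula) :
    (Formula.and A B).eval J = true ↔ A.eval J = true ∧ B.eval J = true := by
  simp [Formula.eval]

theorem Formula.eval_or_true (A B : Formula) :
    (Formula.or A B).eval J = true ↔ A.eval J = true ∨ B.eval J = true := by
  simp [Formula.eval]

theorem Formula.eval_not_true (A : Formula) :
    (Formula.not A).eval J = true ↔ ¬ A.eval J = true := by
  simp [Formula.eval]

@[simp] theorem Term.eval_int (n : ℤ) : (Term.int n).eval J = .int n := by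
  simp [Term.int, Term.eval]

@[simp] theorem Term.eval_nil : Term.nil.eval J = .null := by
  simp [Term.nil, Term.eval]

theorem Term.eval_isNull (x : Term) : x.isNull.eval J = decide (x.eval J = .null) := by
  simp [Term.isNull, Formula.eval]

theorem Term.eval_isTrue (x : Term) : x.isTrue.eval J = decide (x.eval J = .bool true) := by
  rw [Bool.eq_iff_iff]
  simp only [Term.isTrue, Formula.eval, Term.eval, decide_eq_true_eq]
  exact decide_eq_true_iff

theorem Term.eval_isFalse (x : Term) : x.isFalse.eval J = decide (x.eval J = .bool false) := by
  rw [Bool.eq_iff_iff]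
  simp only [Term.isFalse, Formula.eval, Term.eval, decide_eq_true_eq]
  exact decide_eq_true_iff

theorem Formula.eval_toTerm (A : Formula) : A.toTerm.eval J = .bool (A.eval J) := by
  simp only [Formula.toTerm, Term.eval]
  cases A.eval J <;> simp

theorem Term.eval_sum (l : List Term) :
    (Term.sum l).eval J = .int ((l.map (fun x => (x.eval J).num)).sum) := by
  have key : ∀ (l : List Term) (x : Term) (n : ℤ), x.eval J = .int n →
      (l.foldl (Term.arith .add) x).eval J =
        .int (n + (l.map (fun x => (x.eval J).num)).sum) := by
    intro l
    induction l with
    | nil => intro x n h; simp [h]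
    | cons y l ih =>
      intro x n h
      rw [List.foldl_cons, ih (.arith .add x y) (n + (y.eval J).num)]
      · simp [add_assoc]
      · simp [Term.eval, h, Value.num, ArithOp.eval]
  simpa [Term.sum] using key l (.int 0) 0 (by simp)

theorem eval_tArith (op : ArithOp) (x y : Term) :
    (tArith op x y).eval J = vArith op (x.eval J) (y.eval J) := by
  simp [tArith, Term.eval, Formula.eval, Term.eval_isNull, vArith]

theorem eval_tCmp (op : CmpOp) (x y : Term) :
    (tCmp op x y).eval J = vCmp op (x.eval J) (y.eval J) := by
  simp [tCmp, Term.eval, Formula.eval, Term.eval_isNull, vCmp, Formula.eval_toTerm]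

theorem eval_tAnd (x y : Term) : (tAnd x y).eval J = vAnd (x.eval J) (y.eval J) := by
  simp [tAnd, Term.eval, Formula.eval, Term.eval_isNull, Term.eval_isTrue, vAnd,
    Formula.eval_toTerm]

theorem eval_tOr (x y : Term) : (tOr x y).eval J = vOr (x.eval J) (y.eval J) := by
  simp [tOr, Term.eval, Formula.eval, Term.eval_isNull, Term.eval_isTrue, Term.eval_isFalse, vOr,
    Formula.eval_toTerm]

theorem eval_tNot (x : Term) : (tNot x).eval J = vNot (x.eval J) := by
  simp [tNot, Term.eval, Formula.eval, Term.eval_isNull, Term.eval_isTrue, vNot,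
    Formula.eval_toTerm]

theorem eval_tCase (bs vs : List Term) (d : Term) :
    (tCase bs vs d).eval J =
      vCase (bs.map (Term.eval J)) (vs.map (Term.eval J)) (d.eval J) := by
  induction bs generalizing vs with
  | nil => simp [tCase, vCase]
  | cons b bs ih =>
    cases vs with
    | nil => simp [tCase, vCase]
    | cons v vs => simp [tCase, vCase, Term.eval, Term.eval_isTrue, ih]

/-- The three-valued truth value of `⋀ⱼ uⱼ = vⱼ`. -/
def vRowEq (us vs : List Value) : Value :=
  (List.zipWith (vCmp .eq) us vs).foldr vAnd (.bool true)

theorem eval_tRowEq (us vs : List Term) :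
    (tRowEq us vs).eval J = vRowEq (us.map (Term.eval J)) (vs.map (Term.eval J)) := by
  unfold tRowEq vRowEq
  induction us generalizing vs with
  | nil => simp [Term.eval]
  | cons u us ih =>
    cases vs with
    | nil => simp [Term.eval]
    | cons v vs => simp [eval_tAnd, eval_tCmp, ih]

theorem eval_tAny (l : List Term) :
    (tAny l).eval J = (l.map (Term.eval J)).foldl vOr (.bool false) := by
  have key : ∀ (l : List Term) (x : Term),
      (l.foldl tOr x).eval J = (l.map (Term.eval J)).foldl vOr (x.eval J) := by
    intro l
    induction l with
    | nil => intro x; rfl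
    | cons y l ih => intro x; simp [ih, eval_tOr]
  simpa [Term.eval, tAny] using key l (.const (.bool false))

end Eval

/-! ### Three-valued logic -/

theorem vMember_eq (us : List Value) (rows : List (List Value)) :
    vMember us rows = (rows.map (vRowEq us)).foldl vOr (.bool false) := by
  simp [vMember, vRowEq, List.foldl_map]

/-- A truth value of the three-valued logic. -/
def Value.IsTri (x : Value) : Prop := x = .null ∨ ∃ b, x = .bool b

theorem vAnd_isTri (x y : Value) : (vAnd x y).IsTri := by
  unfold vAnd Value.IsTri; split <;> simp

theorem vOr_isTri (x y : Value) : (vOr x y).IsTri := by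
  unfold vOr Value.IsTri; split <;> simp

theorem vAnd_true_left {x : Value} (h : x.IsTri) : vAnd (.bool true) x = x := by
  rcases h with rfl | ⟨b, rfl⟩
  · simp [vAnd]
  · cases b <;> simp [vAnd]

theorem vAnd_false_left (x : Value) : vAnd (.bool false) x = .bool false := by
  simp [vAnd]

theorem vOr_false_right {x : Value} (h : x.IsTri) : vOr x (.bool false) = x := by
  rcases h with rfl | ⟨b, rfl⟩
  · simp [vOr]
  · cases b <;> simp [vOr]

theorem vRowEq_isTri (us vs : List Value) : (vRowEq us vs).IsTri := by
  unfold vRowEq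
  cases List.zipWith (vCmp .eq) us vs with
  | nil => exact Or.inr ⟨true, rfl⟩
  | cons x l => exact vAnd_isTri _ _

theorem foldl_vOr_isTri (l : List Value) {x : Value} (h : x.IsTri) : (l.foldl vOr x).IsTri := by
  induction l generalizing x with
  | nil => exact h
  | cons y l ih => exact ih (vOr_isTri _ _)

theorem foldl_vOr_eq (l : List Value) {x : Value} (h : x.IsTri) (hl : ∀ y ∈ l, y.IsTri) :
    l.foldl vOr x = if x = .bool true ∨ .bool true ∈ l then .bool true
      else if x = .null ∨ .null ∈ l then .null else .bool false := by
  induction l generalizing x with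
  | nil => rcases h with rfl | ⟨_ | _, rfl⟩ <;> simp
  | cons y l ih =>
    rw [List.foldl_cons, ih (vOr_isTri _ _) (fun z hz => hl z (List.mem_cons_of_mem _ hz))]
    rcases h with rfl | ⟨_ | _, rfl⟩ <;> rcases hl y List.mem_cons_self with rfl | ⟨_ | _, rfl⟩ <;>
      simp [vOr]

theorem vMember_perm (us : List Value) {rows rows' : List (List Value)} (h : rows.Perm rows') :
    vMember us rows = vMember us rows' := by
  have tri : ∀ (rows : List (List Value)), ∀ y ∈ rows.map (vRowEq us), y.IsTri := by
    intro rows y hy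
    obtain ⟨r, _, rfl⟩ := List.mem_map.1 hy
    exact vRowEq_isTri _ _
  rw [vMember_eq, vMember_eq, foldl_vOr_eq _ (Or.inr ⟨_, rfl⟩) (tri _),
    foldl_vOr_eq _ (Or.inr ⟨_, rfl⟩) (tri _)]
  simp only [(h.map (vRowEq us)).mem_iff]

/-! ### Aggregates -/

instance : RightCommutative vMin where
  right_comm x y z := by
    rcases x with _ | x | x <;> rcases y with _ | y | y <;> rcases z with _ | z | z <;>
      simp [vMin, Value.num, min_comm, min_left_comm, min_assoc]

instance : RightCommutative vMax where
  right_comm x y z := by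
    rcases x with _ | x | x <;> rcases y with _ | y | y <;> rcases z with _ | z | z <;>
      simp [vMax, Value.num, max_comm, max_left_comm, max_assoc]

theorem vAgg_perm (G : AggOp) {us vs : List Value} (h : us.Perm vs) : vAgg G us = vAgg G vs := by
  have h1 : us.all (fun u => decide (u = .null)) = vs.all (fun u => decide (u = .null)) :=
    h.all_eq
  have h2 : ∀ f : Value → ℤ, (us.map f).foldl (· + ·) 0 = (vs.map f).foldl (· + ·) 0 := by
    intro f; rw [← List.sum_eq_foldl, ← List.sum_eq_foldl]; exact (h.map f).sum_eq
  cases G <;> simp only [vAgg, h1, h2, h.foldl_eq]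

/-- `c ∧ ¬ Del(t)`. -/
def Interp.live (J : Interp) (ct : Formula × TupVar) : Bool := ct.1.eval J && !J.del ct.2

/-- The concrete relation denoted by a conditional list of symbolic tuples. -/
def Interp.grel (J : Interp) (T : GTuples) : Relation :=
  (T.filter J.live).map (fun ct => J.tup ct.2)

theorem Interp.grel_plain (J : Interp) (T : List TupVar) : J.grel (plain T) = J.rel T := by
  simp only [Interp.grel, Interp.rel, plain, List.filter_map, List.map_map]
  congr 1

theorem Interp.grel_cons_pos (J : Interp) {ct : Formula × TupVar} {T : GTuples}
    (h : J.live ct = true) : J.grel (ct :: T) = J.tup ct.2 :: J.grel T := by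
  simp [Interp.grel, h]

theorem Interp.grel_cons_neg (J : Interp) {ct : Formula × TupVar} {T : GTuples}
    (h : J.live ct = false) : J.grel (ct :: T) = J.grel T := by
  simp [Interp.grel, h]

theorem eval_tAgg (J : Interp) (G : AggOp) (u : TupVar → Term) (f : Tuple → Value) (T : GTuples)
    (h : ∀ ct ∈ T, J.live ct = true → (u ct.2).eval J = f (J.tup ct.2)) :
    (tAgg G u T).eval J = vAgg G ((J.grel T).map f) := by
  have live : ∀ ct : Formula × TupVar,
      (Formula.and ct.1 (.not (.del ct.2))).eval J = J.live ct := by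
    intro ct; simp [Interp.live, Formula.eval]
  have hnull : (Formula.all (T.map (fun ct =>
      (Formula.and ct.1 (.not (.del ct.2))).imp (u ct.2).isNull))).eval J =
      ((J.grel T).map f).all (fun u => decide (u = .null)) := by
    rw [Bool.eq_iff_iff, Formula.eval_all]
    simp only [List.mem_map, forall_exists_index, and_imp, forall_apply_eq_imp_iff₂,
      Formula.eval_imp, live, Term.eval_isNull, decide_eq_true_eq, List.all_map, List.all_eq_true,
      Interp.grel, List.mem_filter, Function.comp]
    constructor
    · intro h' ct hct hl; rw [← h ct hct hl]; exact h' ct hct hl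
    · intro h' ct hct hl; rw [h ct hct hl]; exact h' ct hct hl
  have hsum : ∀ (w : Formula × TupVar → Term) (r : Value → ℤ),
      (∀ ct ∈ T, J.live ct = false → ((w ct).eval J).num = 0) →
      (∀ ct ∈ T, J.live ct = true → ((w ct).eval J).num = r (f (J.tup ct.2))) →
      (Term.sum (T.map w)).eval J = .int ((((J.grel T).map f).map r).foldl (· + ·) 0) := by
    intro w r h0 h1
    rw [Term.eval_sum, ← List.sum_eq_foldl]
    congr 1
    clear hnull h
    induction T with
    | nil => simp [Interp.grel]
    | cons ct T ih =>
      have ih' := ih (fun c hc => h0 c (List.mem_cons_of_mem _ hc))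
        (fun c hc => h1 c (List.mem_cons_of_mem _ hc))
      cases hl : J.live ct with
      | true =>
        rw [J.grel_cons_pos hl]
        simp only [List.map_cons, List.sum_cons, ih', h1 ct List.mem_cons_self hl]
      | false =>
        rw [J.grel_cons_neg hl]
        simp only [List.map_cons, List.sum_cons, ih', h0 ct List.mem_cons_self hl, zero_add]
  have hskip : ∀ ct : Formula × TupVar,
      (Formula.or (.not (.and ct.1 (.not (.del ct.2)))) (u ct.2).isNull).eval J =
        (!J.live ct || decide ((u ct.2).eval J = .null)) := by
    intro ct; simp only [Formula.eval, Term.eval_isNull, Interp.live]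
  have hcount := hsum (fun ct => .ite (.or (.not (.and ct.1 (.not (.del ct.2))))
      (u ct.2).isNull) (.int 0) (.int 1)) (fun u => if u = .null then (0 : ℤ) else 1)
    (by intro ct _ hl; simp [Term.eval, hskip, hl, Value.num])
    (by
      intro ct hct hl
      simp only [Term.eval, hskip, hl, h ct hct hl]
      by_cases hf : f (J.tup ct.2) = .null <;> simp [hf, Value.num])
  have hsum' := hsum (fun ct => .ite (.or (.not (.and ct.1 (.not (.del ct.2))))
      (u ct.2).isNull) (.int 0) (u ct.2)) (fun u => if u = .null then (0 : ℤ) else u.num)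
    (by intro ct _ hl; simp [Term.eval, hskip, hl, Value.num])
    (by
      intro ct hct hl
      simp only [Term.eval, hskip, hl, h ct hct hl]
      by_cases hf : f (J.tup ct.2) = .null <;> simp [hf, Value.num])
  have hfold : ∀ (tm : Term → Term → Term) (vm : Value → Value → Value),
      (∀ x y, (tm x y).eval J = vm (x.eval J) (y.eval J)) →
      (∀ x, (∀ b, x ≠ .bool b) → vm x .null = x) → (∀ x y b, vm x y ≠ .bool b) →
      ((T.map (fun ct => Term.ite (.or (.not (.and ct.1 (.not (.del ct.2))))
        (u ct.2).isNull) .nil (u ct.2))).foldl tm .nil).eval J =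
        ((J.grel T).map f).foldl vm .null := by
    intro tm vm htm h0 h1
    have key : ∀ (x : Term), (∀ b, x.eval J ≠ .bool b) →
      ((T.map (fun ct => Term.ite (.or (.not (.and ct.1 (.not (.del ct.2))))
        (u ct.2).isNull) .nil (u ct.2))).foldl tm x).eval J =
        ((J.grel T).map f).foldl vm (x.eval J) := by
      clear hnull hsum hsum' hcount
      induction T with
      | nil => intro x _; simp [Interp.grel]
      | cons ct T ih =>
        intro x hx
        have ih' := ih (fun c hc => h c (List.mem_cons_of_mem _ hc))
        rw [List.map_cons, List.foldl_cons, ih' _ (by rw [htm]; exact h1 _ _), htm]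
        simp only [Term.eval, hskip, Term.eval_nil]
        cases hl : J.live ct with
        | true =>
          rw [J.grel_cons_pos hl, h ct List.mem_cons_self hl]
          simp only [List.map_cons, List.foldl_cons, Bool.not_true, Bool.false_or,
            decide_eq_true_eq]
          split <;> simp_all
        | false =>
          rw [J.grel_cons_neg hl]
          simp [h0 _ hx]
    simpa using key .nil (by simp)
  have hmin := hfold Term.min vMin (fun x y => by simp [Term.eval])
    (by rintro (_ | _ | b) h <;> simp_all [vMin, Value.num])
    (by intro x y b; unfold vMin; split_ifs <;> simp)
  have hmax := hfold Term.max vMax (fun x y => by simp [Term.eval])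
    (by rintro (_ | _ | b) h <;> simp_all [vMax, Value.num])
    (by intro x y b; unfold vMax; split_ifs <;> simp)
  cases G <;> simp only [tAgg, vAgg, Term.eval, eval_tArith, hnull, hcount, hsum', hmin, hmax,
    Term.eval_nil]

/-! ### First attributes -/

/-- Attributes of the conditional list `T` are those of the head of `xs`. -/
def HeadOK (J : Interp) (T : GTuples) (xs : Relation) : Prop :=
  ∀ a, (firstAttr a T).eval J = lookup (xs.headD []) a

theorem headOK_plain (J : Interp) (t : TupVar) : HeadOK J (plain [t]) [J.tup t] := by
  intro a
  simp [plain, firstAttr, Term.eval, Formula.eval]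

theorem headOK_grel (J : Interp) (T : GTuples)
    (h : ∀ ct ∈ T, ct.1.eval J = true → J.del ct.2 = false) : HeadOK J T (J.grel T) := by
  intro a
  induction T with
  | nil => simp [firstAttr, Interp.grel, lookup]
  | cons ct T ih =>
    have ih' := ih (fun c hc => h c (List.mem_cons_of_mem _ hc))
    obtain ⟨c, t⟩ := ct
    have h' := h _ List.mem_cons_self
    simp only at h'
    cases hc : c.eval J with
    | true =>
      rw [J.grel_cons_pos (by simp [Interp.live, hc, h' hc])]
      simp [firstAttr, Term.eval, hc]
    | false =>
      rw [J.grel_cons_neg (by simp [Interp.live, hc])]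
      simpa [firstAttr, Term.eval, hc] using ih'

/-! ### Closed forms of the operations on relations -/

theorem foldl_append_eq {α β : Type} (f : α → List β) (xs : List α) (acc : List β) :
    xs.foldl (fun acc x => acc ++ f x) acc = acc ++ xs.flatMap f := by
  induction xs generalizing acc with
  | nil => simp
  | cons x xs ih => simp [ih]

theorem cross_eq (xs ys : Relation) :
    cross xs ys = xs.flatMap (fun x => ys.map (fun y => x ++ y)) := by
  rw [cross, foldl_append_eq, List.nil_append]

theorem cross_perm {xs xs' ys ys' : Relation} (h : xs.Perm xs') (h' : ys.Perm ys') :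
    (cross xs ys).Perm (cross xs' ys') := by
  rw [cross_eq, cross_eq]
  exact h.flatMap (fun x _ => h'.map _)

theorem bagDiff_eq (xs ys : Relation) : bagDiff xs ys = xs.diff ys := by
  rw [bagDiff, List.diff_eq_foldl]
  congr 1
  funext acc y
  split
  · rfl
  · rw [List.erase_of_not_mem ‹_›]

theorem bagDiff_perm {xs xs' ys ys' : Relation} (h : xs.Perm xs') (h' : ys.Perm ys') :
    (bagDiff xs ys).Perm (bagDiff xs' ys') := by
  rw [bagDiff_eq, bagDiff_eq]
  exact h.diff h'

section Dedup

variable {α : Type} [DecidableEq α]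

theorem dedup_cons (x : α) (xs : List α) :
    dedup (x :: xs) = x :: (dedup xs).filter (fun y => decide (x ≠ y)) := rfl

theorem mem_dedup {x : α} {xs : List α} : x ∈ dedup xs ↔ x ∈ xs := by
  induction xs with
  | nil => simp [dedup]
  | cons y xs ih =>
    simp only [dedup_cons, List.mem_cons, List.mem_filter, ih, decide_eq_true_eq, ne_eq]
    grind

theorem dedup_nodup (xs : List α) : (dedup xs).Nodup := by
  induction xs with
  | nil => simp [dedup]
  | cons y xs ih =>
    rw [dedup_cons, List.nodup_cons]
    exact ⟨by simp, ih.filter _⟩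

theorem dedup_perm {xs ys : List α} (h : xs.Perm ys) : (dedup xs).Perm (dedup ys) :=
  (List.perm_ext_iff_of_nodup (dedup_nodup _) (dedup_nodup _)).2 fun a => by
    rw [mem_dedup, mem_dedup, h.mem_iff]

theorem dedup_concat (xs : List α) (x : α) :
    dedup (xs ++ [x]) = dedup xs ++ if x ∈ xs then [] else [x] := by
  induction xs with
  | nil => simp [dedup]
  | cons y xs ih =>
    rw [List.cons_append, dedup_cons, ih, dedup_cons, List.filter_append, List.cons_append]
    congr 2
    by_cases hx : x ∈ xs
    · simp [hx]
    · by_cases hxy : x = y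
      · simp [hxy]
      · simp [hx, hxy, Ne.symm hxy]

end Dedup

theorem collRel_perm (op : CollOp) {xs xs' ys ys' : Relation} (h : xs.Perm xs')
    (h' : ys.Perm ys') : (collRel op xs ys).Perm (collRel op xs' ys') := by
  cases op
  · exact dedup_perm (h.append h')
  · simp only [collRel, h'.mem_iff]; exact (dedup_perm h).filter _
  · simp only [collRel, h'.mem_iff]; exact (dedup_perm h).filter _
  · exact h.append h'
  · exact bagDiff_perm h (bagDiff_perm h h')
  · exact bagDiff_perm h h'

/-! ### Joins -/

/-- The inner join of the operands, followed by the `NULL` extensions. -/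
def joinList (k : JoinKind) (A₁ A₂ : List AttrName) (f : Tuple → Bool) (xs ys : Relation) :
    Relation :=
  let inner := (cross xs ys).filter f
  let left := (xs.filter (fun x => ys.all (fun y => !f (x ++ y)))).map (fun x => x ++ nullTuple A₂)
  let right := (ys.filter (fun y => xs.all (fun x => !f (x ++ y)))).map (fun y => nullTuple A₁ ++ y)
  match k with
  | .inner => inner
  | .left => inner ++ left
  | .right => inner ++ right
  | .full => inner ++ (right ++ left)

theorem joinList_perm (k : JoinKind) (A₁ A₂ : List AttrName) (f : Tuple → Bool)
    {xs xs' ys ys' : Relation} (h : xs.Perm xs') (h' : ys.Perm ys') :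
    (joinList k A₁ A₂ f xs ys).Perm (joinList k A₁ A₂ f xs' ys') := by
  have hi := (cross_perm h h').filter f
  have hl : ((xs.filter (fun x => ys.all (fun y => !f (x ++ y)))).map
      (fun x => x ++ nullTuple A₂)).Perm ((xs'.filter (fun x => ys'.all (fun y => !f (x ++ y)))).map
      (fun x => x ++ nullTuple A₂)) := by
    simp only [h'.all_eq]; exact (h.filter _).map _
  have hr : ((ys.filter (fun y => xs.all (fun x => !f (x ++ y)))).map
      (fun y => nullTuple A₁ ++ y)).Perm ((ys'.filter (fun y => xs'.all (fun x => !f (x ++ y)))).map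
      (fun y => nullTuple A₁ ++ y)) := by
    simp only [h.all_eq]; exact (h'.filter _).map _
  cases k
  · exact hi
  · exact hi.append hl
  · exact hi.append hr
  · exact hi.append (hr.append hl)

theorem flatMap_or_perm {α β : Type} (g e : α → List β) (c : α → Bool) (xs : List α)
    (hc : ∀ x ∈ xs, c x = true → g x = []) :
    (xs.flatMap (fun x => if c x then e x else g x)).Perm
      (xs.flatMap g ++ (xs.filter c).flatMap e) := by
  induction xs with
  | nil => simp
  | cons x xs ih =>
    have ih' := ih (fun y hy => hc y (List.mem_cons_of_mem _ hy))
    rw [List.flatMap_cons, List.flatMap_cons]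
    cases h : c x with
    | true =>
      rw [hc x List.mem_cons_self h]
      simp only [if_true, List.nil_append, List.filter_cons, h, List.flatMap_cons]
      exact (ih'.append_left _).trans (by
        rw [← List.append_assoc, ← List.append_assoc]
        exact List.perm_append_comm.append_right _)
    | false =>
      simp only [List.filter_cons, h]
      rw [List.append_assoc]
      exact ih'.append_left _

theorem filter_flatMap' {α β : Type} (p : β → Bool) (g : α → List β) (xs : List α) :
    (xs.flatMap g).filter p = xs.flatMap (fun x => (g x).filter p) := by
  induction xs with
  | nil => rfl
  | cons x xs ih => simp [ih]

theorem cross_swap (xs ys : Relation) :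
    (cross xs ys).Perm (ys.flatMap (fun y => cross xs [y])) := by
  simp only [cross_eq]
  induction ys with
  | nil => simp
  | cons y ys ih =>
    rw [List.flatMap_cons]
    refine List.Perm.trans ?_ (ih.append_left _)
    clear ih
    induction xs with
    | nil => simp
    | cons x xs ih =>
      simp only [List.flatMap_cons, List.map_cons, List.map_nil, List.cons_append,
        List.nil_append]
      refine List.Perm.cons _ ?_
      refine (ih.append_left _).trans ?_
      simp only [← List.append_assoc]
      exact List.perm_append_comm.append_right _

theorem length_inner_left (f : Tuple → Bool) (x : Tuple) (ys : Relation) :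
    ((cross [x] ys).filter f).length = 0 ↔ ys.all (fun y => !f (x ++ y)) = true := by
  simp [cross_eq]

theorem length_inner_right (f : Tuple → Bool) (xs : Relation) (y : Tuple) :
    ((cross xs [y]).filter f).length = 0 ↔ xs.all (fun x => !f (x ++ y)) = true := by
  simp [cross_eq]
  grind

theorem joinRel_perm_joinList (k : JoinKind) (A₁ A₂ : List AttrName) (f : Tuple → Bool)
    (xs ys : Relation) :
    (joinRel k A₁ A₂ f xs ys).Perm (joinList k A₁ A₂ f xs ys) := by
  have hl : (xs.foldl (fun acc x => acc ++
      (if ((cross [x] ys).filter f).length = 0 then [x ++ nullTuple A₂]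
        else (cross [x] ys).filter f)) []).Perm ((cross xs ys).filter f ++
      (xs.filter (fun x => ys.all (fun y => !f (x ++ y)))).map (fun x => x ++ nullTuple A₂)) := by
    rw [foldl_append_eq, List.nil_append]
    simp only [length_inner_left]
    refine (flatMap_or_perm (fun x => (cross [x] ys).filter f) (fun x => [x ++ nullTuple A₂])
      (fun x => ys.all (fun y => !f (x ++ y))) xs
      (fun x _ h => List.length_eq_zero_iff.1 ((length_inner_left f x ys).2 h))).trans ?_
    rw [← filter_flatMap', ← List.map_eq_flatMap]
    simp [cross_eq]
  have hr : (ys.foldl (fun acc y => acc ++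
      (if ((cross xs [y]).filter f).length = 0 then [nullTuple A₁ ++ y]
        else (cross xs [y]).filter f)) []).Perm ((cross xs ys).filter f ++
      (ys.filter (fun y => xs.all (fun x => !f (x ++ y)))).map (fun y => nullTuple A₁ ++ y)) := by
    rw [foldl_append_eq, List.nil_append]
    simp only [length_inner_right]
    refine (flatMap_or_perm (fun y => (cross xs [y]).filter f) (fun y => [nullTuple A₁ ++ y])
      (fun y => xs.all (fun x => !f (x ++ y))) ys
      (fun y _ h => List.length_eq_zero_iff.1 ((length_inner_right f xs y).2 h))).trans ?_
    rw [← filter_flatMap', ← List.map_eq_flatMap]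
    exact ((cross_swap xs ys).symm.filter f).append_right _
  cases k
  · exact List.Perm.refl _
  · exact hl
  · exact hr
  · simp only [joinRel, length_inner_right, Bool.decide_eq_true]
    refine (hl.append_right _).trans ?_
    rw [List.append_assoc]
    exact List.perm_append_comm.append_left _

/-! ### Rows: tuples with their deletion status -/

abbrev Row := Tuple × Bool

/-- The tuples of the rows `X 0, …, X (n - 1)` that are not deleted. -/
def lv (n : ℕ) (X : ℕ → Row) : Relation :=
  (List.range n).flatMap (fun i => if (X i).2 then [] else [(X i).1])

@[simp] theorem lv_zero (X : ℕ → Row) : lv 0 X = [] := rfl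

theorem lv_succ (n : ℕ) (X : ℕ → Row) :
    lv (n + 1) X = lv n X ++ if (X n).2 then [] else [(X n).1] := by
  simp [lv, List.range_succ]

theorem lv_congr {n : ℕ} {X Y : ℕ → Row} (h : ∀ i < n, X i = Y i) : lv n X = lv n Y := by
  induction n with
  | zero => rfl
  | succ n ih => rw [lv_succ, lv_succ, ih (fun i hi => h i (by omega)), h n (by omega)]

theorem mem_lv {n : ℕ} {X : ℕ → Row} {x : Tuple} :
    x ∈ lv n X ↔ ∃ i < n, (X i).2 = false ∧ (X i).1 = x := by
  simp only [lv, List.mem_flatMap, List.mem_range]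
  refine exists_congr fun i => and_congr_right fun _ => ?_
  cases (X i).2 <;> simp [eq_comm]

theorem lv_add (n m : ℕ) (X : ℕ → Row) : lv (n + m) X = lv n X ++ lv m (fun i => X (n + i)) := by
  induction m with
  | zero => simp
  | succ m ih => rw [← Nat.add_assoc, lv_succ, lv_succ, ih, List.append_assoc]

theorem lv_map (n : ℕ) (X : ℕ → Row) (f : Tuple → Tuple) :
    lv n (fun i => (f (X i).1, (X i).2)) = (lv n X).map f := by
  induction n with
  | zero => rfl
  | succ n ih => rw [lv_succ, lv_succ, ih, List.map_append]; cases (X n).2 <;> simp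

theorem lv_filter (n : ℕ) (X : ℕ → Row) (f : Tuple → Bool) :
    lv n (fun i => ((X i).1, (X i).2 || !f (X i).1)) = (lv n X).filter f := by
  induction n with
  | zero => rfl
  | succ n ih =>
    rw [lv_succ, lv_succ, ih, List.filter_append]
    cases (X n).2 <;> cases h : f (X n).1 <;> simp [h]

theorem lv_dedup (n : ℕ) (X : ℕ → Row) :
    lv n (fun i => ((X i).1, (X i).2 || decide ((X i).1 ∈ lv i X))) = dedup (lv n X) := by
  induction n with
  | zero => rfl
  | succ n ih =>
    rw [lv_succ, lv_succ, ih]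
    cases (X n).2
    · simp [dedup_concat]
    · simp

/-- The product of rows, row by row. -/
def prodRow (m : ℕ) (X Y : ℕ → Row) (q : ℕ) : Row :=
  ((X (q / m)).1 ++ (Y (q % m)).1, (X (q / m)).2 || (Y (q % m)).2)

theorem prodRow_mul_add {m j : ℕ} (hj : j < m) (X Y : ℕ → Row) (i : ℕ) :
    prodRow m X Y (i * m + j) = ((X i).1 ++ (Y j).1, (X i).2 || (Y j).2) := by
  have h1 : (i * m + j) / m = i := by
    rw [Nat.add_comm, Nat.add_mul_div_right _ _ (by omega), Nat.div_eq_of_lt hj, Nat.zero_add]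
  have h2 : (i * m + j) % m = j := by
    rw [Nat.add_comm, Nat.add_mul_mod_self_right, Nat.mod_eq_of_lt hj]
  simp [prodRow, h1, h2]

theorem lv_prod (n m : ℕ) (X Y : ℕ → Row) :
    lv (n * m) (prodRow m X Y) = cross (lv n X) (lv m Y) := by
  induction n with
  | zero => simp [cross]
  | succ n ih =>
    rw [Nat.succ_mul, lv_add, ih, lv_succ]
    rw [lv_congr (Y := fun j => ((X n).1 ++ (Y j).1, (X n).2 || (Y j).2))
      (fun j hj => prodRow_mul_add hj X Y n)]
    simp only [cross_eq, List.flatMap_append]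
    congr 1
    cases (X n).2
    · simp [lv_map m Y (fun y => (X n).1 ++ y)]
    · simp [lv]

/-! ### Bag difference by greedy matching -/

/-- The greedy matching of a relation between positions: `i` and `j` are paired if they are related
and neither is paired with an earlier partner. -/
def greedy (E : ℕ → ℕ → Bool) (i j : ℕ) : Bool :=
  E i j && ((List.finRange i).all (fun k => !greedy E k.1 j) &&
    (List.finRange j).all (fun k => !greedy E i k.1))
termination_by i + j
decreasing_by
  · have := k.isLt; omega
  · have := k.isLt; omega

theorem greedy_iff (E : ℕ → ℕ → Bool) (i j : ℕ) :
    greedy E i j = true ↔ E i j = true ∧ (∀ k < i, ¬ greedy E k j = true) ∧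
      (∀ k < j, ¬ greedy E i k = true) := by
  rw [greedy]
  simp [List.all_eq_true, Fin.forall_iff]

theorem greedy_left_unique {E : ℕ → ℕ → Bool} {i i' j : ℕ} (h : greedy E i j = true)
    (h' : greedy E i' j = true) : i = i' := by
  rcases lt_trichotomy i i' with hl | hl | hl
  · exact absurd h (((greedy_iff _ _ _).1 h').2.1 i hl)
  · exact hl
  · exact absurd h' (((greedy_iff _ _ _).1 h).2.1 i' hl)

theorem greedy_right_unique {E : ℕ → ℕ → Bool} {i j j' : ℕ} (h : greedy E i j = true)
    (h' : greedy E i j' = true) : j = j' := by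
  rcases lt_trichotomy j j' with hl | hl | hl
  · exact absurd h (((greedy_iff _ _ _).1 h').2.2 j hl)
  · exact hl
  · exact absurd h' (((greedy_iff _ _ _).1 h).2.2 j' hl)

theorem count_lv (n : ℕ) (X : ℕ → Row) (v : Tuple) :
    (lv n X).count v =
      ((Finset.range n).filter (fun i => (X i).2 = false ∧ (X i).1 = v)).card := by
  induction n with
  | zero => simp
  | succ n ih =>
    rw [lv_succ, List.count_append, ih, Finset.range_add_one, Finset.filter_insert]
    cases h : (X n).2
    · by_cases hv : (X n).1 = v <;> simp [hv]
    · simp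

/-- Two rows that are not deleted and hold the same tuple. -/
def rowMatch (X Y : ℕ → Row) (i j : ℕ) : Bool :=
  !(X i).2 && !(Y j).2 && decide ((X i).1 = (Y j).1)

theorem lv_greedy_perm (n m : ℕ) (X Y : ℕ → Row) :
    (lv n (fun i => ((X i).1, (X i).2 ||
      (List.range m).any (fun j => greedy (rowMatch X Y) i j)))).Perm
      (bagDiff (lv n X) (lv m Y)) := by
  classical
  set P := greedy (rowMatch X Y) with hP
  rw [List.perm_iff_count]
  intro v
  rw [bagDiff_eq, List.count_diff, count_lv, count_lv, count_lv]
  set A := (Finset.range n).filter (fun i => (X i).2 = false ∧ (X i).1 = v) with hA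
  set B := (Finset.range m).filter (fun j => (Y j).2 = false ∧ (Y j).1 = v) with hB
  have hm : ∀ i j, P i j = true → (X i).2 = false ∧ (Y j).2 = false ∧ (X i).1 = (Y j).1 := by
    intro i j h
    have := ((greedy_iff _ _ _).1 h).1
    simp only [rowMatch, Bool.and_eq_true, Bool.not_eq_true', decide_eq_true_eq] at this
    exact ⟨this.1.1, this.1.2, this.2⟩
  set A' := A.filter (fun i => ∃ j < m, P i j = true) with hA'
  set B' := B.filter (fun j => ∃ i < n, P i j = true) with hB'
  have hcard : A'.card = B'.card := by
    have ex : ∀ i ∈ A', ∃ j < m, P i j = true := fun i hi => (Finset.mem_filter.1 hi).2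
    refine Finset.card_bij (fun i hi => (ex i hi).choose) ?_ ?_ ?_
    · intro i hi
      obtain ⟨hj, hp⟩ := (ex i hi).choose_spec
      have hiA := Finset.mem_filter.1 (Finset.mem_filter.1 hi).1
      obtain ⟨_, h2, h3⟩ := hm _ _ hp
      refine Finset.mem_filter.2 ⟨Finset.mem_filter.2 ⟨Finset.mem_range.2 hj, h2, ?_⟩,
        i, Finset.mem_range.1 hiA.1, hp⟩
      rw [← h3]; exact hiA.2.2
    · intro i hi i' hi' heq
      have hp := (ex i hi).choose_spec.2
      have hp' := (ex i' hi').choose_spec.2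
      rw [show (ex i hi).choose = _ from heq] at hp
      exact greedy_left_unique hp hp'
    · intro j hj
      obtain ⟨hjB, i, hi, hp⟩ := Finset.mem_filter.1 hj
      have hjB' := Finset.mem_filter.1 hjB
      obtain ⟨h1, _, h3⟩ := hm _ _ hp
      have hiA : i ∈ A' := Finset.mem_filter.2 ⟨Finset.mem_filter.2
        ⟨Finset.mem_range.2 hi, h1, h3.trans hjB'.2.2⟩, j, Finset.mem_range.1 hjB'.1, hp⟩
      exact ⟨i, hiA, greedy_right_unique (ex i hiA).choose_spec.2 hp⟩
  have hmax : A' = A ∨ B' = B := by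
    by_contra hne
    push Not at hne
    obtain ⟨i, hi, hi'⟩ := Finset.exists_of_ssubset
      ((Finset.filter_subset _ _).ssubset_of_ne hne.1)
    obtain ⟨j, hj, hj'⟩ := Finset.exists_of_ssubset
      ((Finset.filter_subset _ _).ssubset_of_ne hne.2)
    have hiA := Finset.mem_filter.1 hi
    have hjB := Finset.mem_filter.1 hj
    have hun : ¬ P i j = true := fun h =>
      hi' (Finset.mem_filter.2 ⟨hi, j, Finset.mem_range.1 hjB.1, h⟩)
    refine hun ((greedy_iff _ _ _).2 ⟨?_, ?_, ?_⟩)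
    · simp [rowMatch, hiA.2.1, hiA.2.2, hjB.2.1, hjB.2.2]
    · intro k hk hp
      exact hj' (Finset.mem_filter.2 ⟨hj, k, hk.trans (Finset.mem_range.1 hiA.1), hp⟩)
    · intro k hk hp
      exact hi' (Finset.mem_filter.2 ⟨hi, k, hk.trans (Finset.mem_range.1 hjB.1), hp⟩)
  have hleft : (Finset.range n).filter (fun i => ((X i).2 ||
      (List.range m).any (fun j => P i j)) = false ∧ (X i).1 = v) = A \ A' := by
    ext i
    simp only [hA, hA', Finset.mem_filter, Finset.mem_range, Finset.mem_sdiff, Bool.or_eq_false_iff,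
      List.any_eq_false, List.mem_range]
    grind
  rw [hleft, Finset.card_sdiff_of_subset (Finset.filter_subset _ _), ← hA']
  rcases hmax with h | h
  · have : B'.card ≤ B.card := Finset.card_le_card (Finset.filter_subset _ _)
    rw [h] at hcard ⊢
    omega
  · rw [h] at hcard
    omega

/-! ### Grouping -/

/-- The row `k` is the first one with its keys. -/
def lead (κ : Tuple → List Value) (X : ℕ → Row) (k : ℕ) : Bool :=
  !(X k).2 && decide (κ (X k).1 ∉ (lv k X).map κ)

/-- The row `i` belongs to the group of the row `k`. -/
def inGroup (κ : Tuple → List Value) (X : ℕ → Row) (i k : ℕ) : Bool :=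
  !(X i).2 && lead κ X k && decide (k ≤ i) && decide (κ (X i).1 = κ (X k).1)

theorem inGroup_self (κ : Tuple → List Value) (X : ℕ → Row) (k : ℕ) :
    inGroup κ X k k = lead κ X k := by
  simp only [inGroup, lead]
  cases (X k).2 <;> simp

theorem inGroup_of_lt {κ : Tuple → List Value} {X : ℕ → Row} {i j : ℕ} (h : j < i) :
    inGroup κ X i j = true ↔
      (X i).2 = false ∧ inGroup κ X j j = true ∧ κ (X i).1 = κ (X j).1 := by
  rw [inGroup_self]
  simp [inGroup, h.le]
  tauto

theorem inGroup_of_gt {κ : Tuple → List Value} {X : ℕ → Row} {i j : ℕ} (h : i < j) :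
    inGroup κ X i j = false := by
  simp [inGroup, h]

theorem sum_range_indicator (n k : ℕ) (c : ℕ → Bool) (hk : k < n) (h : ∀ j < n, c j = true ↔ j = k) :
    ((List.range n).map (fun j => if c j then (1 : ℤ) else 0)).sum = 1 := by
  have : (List.range n).map (fun j => if c j then (1 : ℤ) else 0) =
      (List.range n).map (fun j => if j = k then (1 : ℤ) else 0) := by
    apply List.map_congr_left
    intro j hj
    simp only [h j (List.mem_range.1 hj)]
  rw [this]
  clear this h
  induction n with
  | zero => omega
  | succ n ih =>
    rw [List.range_succ, List.map_append, List.sum_append]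
    by_cases hn : k = n
    · subst hn
      have : (List.range k).map (fun j => if j = k then (1 : ℤ) else 0) =
          (List.range k).map (fun _ => (0 : ℤ)) := by
        apply List.map_congr_left
        intro j hj
        simp [(List.mem_range.1 hj).ne]
      rw [this]
      simp
    · rw [ih (by omega)]
      simp [Ne.symm hn]

theorem sum_inGroup (κ : Tuple → List Value) (X : ℕ → Row) (i : ℕ) :
    ((List.range (i + 1)).map (fun j => if inGroup κ X i j then (1 : ℤ) else 0)).sum =
      if (X i).2 then 0 else 1 := by
  cases hd : (X i).2 with
  | true => simp [inGroup, hd]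
  | false =>
    have hex : ∃ j, (X j).2 = false ∧ κ (X j).1 = κ (X i).1 := ⟨i, hd, rfl⟩
    classical
    obtain ⟨hk1, hk2⟩ := Nat.find_spec hex
    have hmin := fun j (hj : j < Nat.find hex) => Nat.find_min hex hj
    have hle : Nat.find hex ≤ i := Nat.find_min' hex ⟨hd, rfl⟩
    set k := Nat.find hex
    rw [sum_range_indicator (i + 1) k _ (by omega)]
    · simp
    · intro j hj
      simp only [inGroup, hd, lead, Bool.and_eq_true, decide_eq_true_eq, List.mem_map, mem_lv,
        Bool.not_eq_true', Bool.not_false, true_and]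
      constructor
      · rintro ⟨⟨⟨hj1, hj2⟩, -⟩, hj3⟩
        rcases lt_trichotomy j k with h | h | h
        · exact absurd ⟨hj1, hj3.symm⟩ (hmin j h)
        · exact h
        · exact absurd ⟨_, ⟨k, h, hk1, rfl⟩, hk2.trans hj3⟩ hj2
      · rintro rfl
        refine ⟨⟨⟨hk1, ?_⟩, hle⟩, hk2.symm⟩
        rintro ⟨_, ⟨l, hl, hl1, rfl⟩, hl2⟩
        exact hmin l hl ⟨hl1, hl2.trans hk2⟩

theorem lv_group {κ : Tuple → List Value} {X : ℕ → Row} {k : ℕ} (hk : lead κ X k = true) (n : ℕ) :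
    lv n (fun i => ((X i).1, !(inGroup κ X i k && !(X i).2))) =
      (lv n X).filter (fun z => decide (κ z = κ (X k).1)) := by
  rw [← lv_filter]
  apply lv_congr
  intro i _
  congr 1
  simp only [inGroup, hk]
  cases hd : (X i).2
  · by_cases he : κ (X i).1 = κ (X k).1
    · simp only [lead, Bool.and_eq_true, decide_eq_true_eq, List.mem_map, mem_lv] at hk
      by_cases hl : k ≤ i
      · simp [he, hl]
      · exact absurd ⟨_, ⟨i, by omega, hd, rfl⟩, he⟩ hk.2
    · simp [he]
  · simp

theorem lv_groups (κ : Tuple → List Value) (X : ℕ → Row) (n : ℕ) (φ : Relation → Bool)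
    (h : Relation → Tuple) :
    lv n (fun k => (h ((lv n X).filter (fun z => decide (κ z = κ (X k).1))),
      !(lead κ X k && φ ((lv n X).filter (fun z => decide (κ z = κ (X k).1)))))) =
      ((groups κ (lv n X)).filter φ).map h := by
  suffices key : ∀ xs : Relation,
      lv n (fun k => (h (xs.filter (fun z => decide (κ z = κ (X k).1))),
        !(lead κ X k && φ (xs.filter (fun z => decide (κ z = κ (X k).1)))))) =
      (((dedup ((lv n X).map κ)).map (fun y => xs.filter (fun z => decide (κ z = y)))).filter
        φ).map h from key _
  intro xs
  induction n with
  | zero => simp [dedup]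
  | succ n ih =>
    rw [lv_succ, ih, lv_succ, List.map_append]
    cases hd : (X n).2 with
    | true => simp [lead, hd]
    | false =>
      simp only [lead, hd, Bool.not_false, Bool.true_and, Bool.false_eq_true, if_false,
        List.map_cons, List.map_nil, dedup_concat, List.map_append, List.filter_append]
      congr 1
      by_cases hm : κ (X n).1 ∈ (lv n X).map κ
      · simp [hm]
      · simp only [hm, not_false_eq_true, decide_true, Bool.true_and, if_false, List.map_cons,
          List.map_nil, List.filter_cons, List.filter_nil]
        split <;> simp_all

/-! ### Sorting -/

/-- Sort keys as elements of a linear order. -/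
def Value.rank : Value → WithBot ℤ
  | .null => ⊥
  | x => (x.num : WithBot ℤ)

theorem keyLess_eq (x y : Value) : keyLess x y = decide (x.rank < y.rank) := by
  rw [Bool.eq_iff_iff, decide_eq_true_iff]
  rcases x with _ | x | x <;> rcases y with _ | y | y <;>
    simp only [keyLess, Value.rank, decide_eq_true_iff, WithBot.coe_lt_coe, WithBot.bot_lt_coe,
      not_lt_bot, Bool.false_eq_true]

def ranks (ks : List Value) : List (WithBot ℤ) := ks.map Value.rank

theorem sortFold_eq (k₁ k₂ : List Value) (h : k₁.length = k₂.length) :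
    ((k₁.zip k₂).foldr (fun uv acc =>
      if keyLess uv.1 uv.2 then true else if keyLess uv.2 uv.1 then false else acc) true) =
      decide (ranks k₁ ≤ ranks k₂) := by
  induction k₁ generalizing k₂ with
  | nil =>
    cases k₂ with
    | nil => simp [ranks]
    | cons y ys => simp at h
  | cons x xs ih =>
    cases k₂ with
    | nil => simp at h
    | cons y ys =>
      rw [List.zip_cons_cons, List.foldr_cons, ih ys (by simpa using h)]
      simp only [keyLess_eq, ranks, List.map_cons, decide_eq_true_eq]
      rcases lt_trichotomy x.rank y.rank with hl | hl | hl
      · have : x.rank :: xs.map Value.rank ≤ y.rank :: ys.map Value.rank :=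
          le_of_lt (List.cons_lt_cons_iff.2 (Or.inl hl))
        simp [hl, this]
      · rw [hl]
        simp only [lt_irrefl, if_false]
        congr 1
        rw [← not_lt, ← not_lt, List.cons_lt_cons_iff]
        simp
      · have : ¬ x.rank :: xs.map Value.rank ≤ y.rank :: ys.map Value.rank :=
          not_le_of_gt (List.cons_lt_cons_iff.2 (Or.inl hl))
        simp [hl, hl.not_gt, this]

/-- Keys in the order of the sorted result. -/
def keyLE (asc : Bool) (k₁ k₂ : List Value) : Prop :=
  if asc then ranks k₁ ≤ ranks k₂ else ranks k₂ ≤ ranks k₁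

theorem keyLE_refl (asc : Bool) (k : List Value) : keyLE asc k k := by
  cases asc <;> simp [keyLE]

theorem keyLE_trans {asc : Bool} {k₁ k₂ k₃ : List Value} (h : keyLE asc k₁ k₂)
    (h' : keyLE asc k₂ k₃) : keyLE asc k₁ k₃ := by
  cases asc <;> simp only [keyLE, if_true, Bool.false_eq_true, if_false] at *
  · exact h'.trans h
  · exact h.trans h'

theorem keyLE_of_sortCmp {asc : Bool} {k₁ k₂ : List Value} (hl : k₁.length = k₂.length) :
    (sortCmp asc k₁ k₂ = true → keyLE asc k₂ k₁) ∧
      (sortCmp asc k₁ k₂ = false → keyLE asc k₁ k₂) := by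
  rw [sortCmp, sortFold_eq _ _ hl]
  cases asc
  · simp only [keyLE, Bool.false_eq_true, if_false, bne_eq_false_iff_eq]
    constructor
    · intro h; simpa using h
    · intro h
      have : ¬ ranks k₁ ≤ ranks k₂ := by simpa using h.symm
      exact le_of_not_ge this
  · simp only [keyLE, if_true]
    constructor
    · intro h
      have : ¬ ranks k₁ ≤ ranks k₂ := by simpa using h
      exact le_of_not_ge this
    · intro h
      simpa using h

section SelectionSort

variable {key : Tuple → List Value} {l : ℕ}

theorem foldl_min_spec (hkey : ∀ x, (key x).length = l) (asc : Bool) (xs : Relation) (x₀ : Tuple) :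
    xs.foldl (fun x y => if sortCmp asc (key x) (key y) then y else x) x₀ ∈ x₀ :: xs ∧
      ∀ y ∈ x₀ :: xs, keyLE asc
        (key (xs.foldl (fun x y => if sortCmp asc (key x) (key y) then y else x) x₀)) (key y) := by
  induction xs generalizing x₀ with
  | nil => simp [keyLE_refl]
  | cons x xs ih =>
    rw [List.foldl_cons]
    obtain ⟨h1, h2⟩ := ih (if sortCmp asc (key x₀) (key x) then x else x₀)
    have hc := keyLE_of_sortCmp (asc := asc) ((hkey x₀).trans (hkey x).symm)
    constructor
    · split_ifs at h1 ⊢ <;> simp only [List.mem_cons] at h1 ⊢ <;> tauto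
    · have hfirst := h2 _ List.mem_cons_self
      intro y hy
      rcases List.mem_cons.1 hy with rfl | hy
      · refine keyLE_trans hfirst ?_
        split_ifs with h
        · exact hc.1 h
        · exact keyLE_refl _ _
      · rcases List.mem_cons.1 hy with rfl | hy
        · refine keyLE_trans hfirst ?_
          split_ifs with h
          · exact keyLE_refl _ _
          · exact hc.2 (by simpa using h)
        · exact h2 _ (List.mem_cons_of_mem _ hy)

theorem minTuple_spec (hkey : ∀ x, (key x).length = l) (asc : Bool) {xs : Relation}
    (h : xs ≠ []) : minTuple key asc xs ∈ xs ∧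
      ∀ y ∈ xs, keyLE asc (key (minTuple key asc xs)) (key y) := by
  obtain ⟨x, xs, rfl⟩ := List.exists_cons_of_ne_nil h
  have := foldl_min_spec hkey asc (x :: xs) x
  refine ⟨?_, fun y hy => this.2 y (List.mem_cons_of_mem _ hy)⟩
  have h1 := this.1
  simp only [List.mem_cons] at h1 ⊢
  unfold minTuple
  simp only [List.headD_cons]
  tauto

theorem sortRel_spec (hkey : ∀ x, (key x).length = l) (asc : Bool) (xs : Relation) :
    (sortRel key asc xs).Perm xs ∧
      (sortRel key asc xs).Pairwise (fun x y => keyLE asc (key x) (key y)) := by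
  have step : ∀ (us : List Tuple) (acc : Relation),
      acc.length + us.length = xs.length →
      (acc ++ xs.diff acc).Perm xs →
      acc.Pairwise (fun x y => keyLE asc (key x) (key y)) →
      (∀ x ∈ acc, ∀ y ∈ xs.diff acc, keyLE asc (key x) (key y)) →
      (us.foldl (fun acc _ => acc ++ [minTuple key asc (bagDiff xs acc)]) acc).Perm xs ∧
        (us.foldl (fun acc _ => acc ++ [minTuple key asc (bagDiff xs acc)]) acc).Pairwise
          (fun x y => keyLE asc (key x) (key y)) := by
    intro us
    induction us with
    | nil =>
      intro acc hlen hp hs _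
      have : xs.diff acc = [] := by
        have := hp.length_eq
        rw [List.length_append] at this
        exact List.length_eq_zero_iff.1 (by simp at hlen; omega)
      rw [this, List.append_nil] at hp
      exact ⟨hp, hs⟩
    | cons u us ih =>
      intro acc hlen hp hs hle
      have hne : xs.diff acc ≠ [] := by
        intro h
        have := hp.length_eq
        rw [h, List.append_nil] at this
        simp at hlen
        omega
      rw [List.foldl_cons]
      rw [bagDiff_eq]
      obtain ⟨hm, hmin⟩ := minTuple_spec hkey asc hne
      set m := minTuple key asc (xs.diff acc)
      have hd : xs.diff (acc ++ [m]) = (xs.diff acc).erase m := by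
        rw [List.diff_append, List.diff_cons, List.diff_nil]
      apply ih
      · simp at hlen ⊢; omega
      · rw [hd, List.append_assoc]
        exact ((List.perm_cons_erase hm).symm.append_left acc).trans hp
      · rw [List.pairwise_append]
        refine ⟨hs, List.pairwise_singleton _ _, ?_⟩
        intro x hx y hy
        rw [List.mem_singleton.1 hy]
        exact hle x hx m hm
      · intro x hx y hy
        rw [hd] at hy
        have hy' := List.mem_of_mem_erase hy
        rcases List.mem_append.1 hx with hx | hx
        · exact hle x hx y hy'
        · rw [List.mem_singleton.1 hx]; exact hmin y hy'
  exact step xs [] (by simp) (by simp) (by simp) (by simp)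

end SelectionSort

theorem exists_perm_of_perm_map {α β : Type} {f : α → β} {s : List β} {l : List α}
    (h : s.Perm (l.map f)) : ∃ w : List α, w.Perm l ∧ s = w.map f := by
  have h' : List.Forall₂ (fun a b => a = f b) (l.map f) l := by
    rw [List.forall₂_map_left_iff]
    exact List.forall₂_same.2 (fun _ _ => rfl)
  obtain ⟨w, hw, hp⟩ := List.perm_comp_forall₂ h h'
  refine ⟨w, hp, ?_⟩
  clear h h' hp
  induction hw with
  | nil => rfl
  | cons h _ ih => rw [List.map_cons, ← h, ← ih]

/-! ### Dependence of the value of an expression on the list of tuples -/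

section Congr

variable {S : SchemaEnv} {D : Database} {xs ys : Relation}

mutual

theorem Attr.denot_congr {Ks : List Expr} (h : xs.Perm ys)
    (hK : ∀ K ∈ Ks, K.denot S D xs = K.denot S D ys) :
    ∀ A : Attr, A.Det Ks → A.denot S D xs = A.denot S D ys
  | .cast φ, hA => by
    simp only [Attr.Det] at hA
    simp only [Attr.denot, Pred.denot_congr h hK φ hA]
  | .expr E, hA => by
    simp only [Attr.Det] at hA
    simp only [Attr.denot, Expr.denot_congr h hK E hA]
  | .agg G E, _ => by
    simp only [Attr.denot]
    exact vAgg_perm G (h.map _)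
  | .arith op A₁ A₂, hA => by
    simp only [Attr.Det] at hA
    simp only [Attr.denot, Attr.denot_congr h hK A₁ hA.1, Attr.denot_congr h hK A₂ hA.2]

theorem Pred.denot_congr {Ks : List Expr} (h : xs.Perm ys)
    (hK : ∀ K ∈ Ks, K.denot S D xs = K.denot S D ys) :
    ∀ φ : Pred, φ.Det Ks → φ.denot S D xs = φ.denot S D ys
  | .lit _, _ => by simp only [Pred.denot]
  | .null, _ => by simp only [Pred.denot]
  | .cmp op A₁ A₂, hA => by
    simp only [Pred.Det] at hA
    simp only [Pred.denot, Attr.denot_congr h hK A₁ hA.1, Attr.denot_congr h hK A₂ hA.2]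
  | .isNull E, hA => by
    simp only [Pred.Det] at hA
    simp only [Pred.denot, Expr.denot_congr h hK E hA]
  | .inVals Es rows, hA => by
    simp only [Pred.Det] at hA
    simp only [Pred.denot, Expr.denotList_congr h hK Es hA]
  | .inQuery Es Q, hA => by
    simp only [Pred.Det] at hA
    simp only [Pred.denot, Expr.denotList_congr h hK Es hA]
  | .and φ₁ φ₂, hA => by
    simp only [Pred.Det] at hA
    simp only [Pred.denot, Pred.denot_congr h hK φ₁ hA.1, Pred.denot_congr h hK φ₂ hA.2]
  | .or φ₁ φ₂, hA => by
    simp only [Pred.Det] at hA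
    simp only [Pred.denot, Pred.denot_congr h hK φ₁ hA.1, Pred.denot_congr h hK φ₂ hA.2]
  | .not φ, hA => by
    simp only [Pred.Det] at hA
    simp only [Pred.denot, Pred.denot_congr h hK φ hA]

theorem Pred.denotList_congr {Ks : List Expr} (h : xs.Perm ys)
    (hK : ∀ K ∈ Ks, K.denot S D xs = K.denot S D ys) :
    ∀ φs : List Pred, Pred.DetList Ks φs → Pred.denotList φs S D xs = Pred.denotList φs S D ys
  | [], _ => by simp only [Pred.denotList]
  | φ :: φs, hA => by
    simp only [Pred.DetList] at hA
    simp only [Pred.denotList, Pred.denot_congr h hK φ hA.1, Pred.denotList_congr h hK φs hA.2]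

theorem Expr.denot_congr {Ks : List Expr} (h : xs.Perm ys)
    (hK : ∀ K ∈ Ks, K.denot S D xs = K.denot S D ys) :
    ∀ E : Expr, E.Det Ks → E.denot S D xs = E.denot S D ys
  | .attr a, hA => by
    simp only [Expr.Det] at hA
    exact hK _ hA
  | .val v, _ => by simp only [Expr.denot]
  | .arith op E₁ E₂, hA => by
    simp only [Expr.Det] at hA
    rcases hA with hA | hA
    · exact hK _ hA
    · simp only [Expr.denot, Expr.denot_congr h hK E₁ hA.1, Expr.denot_congr h hK E₂ hA.2]
  | .ite φ E₁ E₂, hA => by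
    simp only [Expr.Det] at hA
    rcases hA with hA | hA
    · exact hK _ hA
    · simp only [Expr.denot, Pred.denot_congr h hK φ hA.1, Expr.denot_congr h hK E₁ hA.2.1,
        Expr.denot_congr h hK E₂ hA.2.2]
  | .case φs Es E, hA => by
    simp only [Expr.Det] at hA
    rcases hA with hA | hA
    · exact hK _ hA
    · simp only [Expr.denot, Pred.denotList_congr h hK φs hA.1,
        Expr.denotList_congr h hK Es hA.2.1, Expr.denot_congr h hK E hA.2.2]

theorem Expr.denotList_congr {Ks : List Expr} (h : xs.Perm ys)
    (hK : ∀ K ∈ Ks, K.denot S D xs = K.denot S D ys) :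
    ∀ Es : List Expr, Expr.DetList Ks Es → Expr.denotList Es S D xs = Expr.denotList Es S D ys
  | [], _ => by simp only [Expr.denotList]
  | E :: Es, hA => by
    simp only [Expr.DetList] at hA
    simp only [Expr.denotList, Expr.denot_congr h hK E hA.1, Expr.denotList_congr h hK Es hA.2]

end

theorem Item.denotList_congr {Ks : List Expr} (h : xs.Perm ys)
    (hK : ∀ K ∈ Ks, K.denot S D xs = K.denot S D ys) (L : List Item)
    (hL : ∀ e ∈ L, e.attr.Det Ks) : Item.denotList L S D xs = Item.denotList L S D ys := by
  induction L with
  | nil => simp only [Item.denotList]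
  | cons e L ih =>
    simp only [Item.denotList, ih (fun e he => hL e (List.mem_cons_of_mem _ he))]
    have := Attr.denot_congr h hK _ (hL e List.mem_cons_self)
    cases e <;> simp only [Item.denot, Item.attr] at this ⊢ <;> rw [this]

mutual

theorem Attr.denot_head (h : xs.headD [] = ys.headD []) :
    ∀ A : Attr, A.hasAgg = false → A.denot S D xs = A.denot S D ys
  | .cast φ, hA => by
    simp only [Attr.hasAgg] at hA
    simp only [Attr.denot, Pred.denot_head h φ hA]
  | .expr E, hA => by
    simp only [Attr.hasAgg] at hA
    simp only [Attr.denot, Expr.denot_head h E hA]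
  | .agg G E, hA => by
    simp [Attr.hasAgg] at hA
  | .arith op A₁ A₂, hA => by
    simp only [Attr.hasAgg, Bool.or_eq_false_iff] at hA
    simp only [Attr.denot, Attr.denot_head h A₁ hA.1, Attr.denot_head h A₂ hA.2]

theorem Pred.denot_head (h : xs.headD [] = ys.headD []) :
    ∀ φ : Pred, φ.hasAgg = false → φ.denot S D xs = φ.denot S D ys
  | .lit _, _ => by simp only [Pred.denot]
  | .null, _ => by simp only [Pred.denot]
  | .cmp op A₁ A₂, hA => by
    simp only [Pred.hasAgg, Bool.or_eq_false_iff] at hA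
    simp only [Pred.denot, Attr.denot_head h A₁ hA.1, Attr.denot_head h A₂ hA.2]
  | .isNull E, hA => by
    simp only [Pred.hasAgg] at hA
    simp only [Pred.denot, Expr.denot_head h E hA]
  | .inVals Es rows, hA => by
    simp only [Pred.hasAgg] at hA
    simp only [Pred.denot, Expr.denotList_head h Es hA]
  | .inQuery Es Q, hA => by
    simp only [Pred.hasAgg] at hA
    simp only [Pred.denot, Expr.denotList_head h Es hA]
  | .and φ₁ φ₂, hA => by
    simp only [Pred.hasAgg, Bool.or_eq_false_iff] at hA
    simp only [Pred.denot, Pred.denot_head h φ₁ hA.1, Pred.denot_head h φ₂ hA.2]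
  | .or φ₁ φ₂, hA => by
    simp only [Pred.hasAgg, Bool.or_eq_false_iff] at hA
    simp only [Pred.denot, Pred.denot_head h φ₁ hA.1, Pred.denot_head h φ₂ hA.2]
  | .not φ, hA => by
    simp only [Pred.hasAgg] at hA
    simp only [Pred.denot, Pred.denot_head h φ hA]

theorem Pred.denotList_head (h : xs.headD [] = ys.headD []) :
    ∀ φs : List Pred, Pred.hasAggList φs = false →
      Pred.denotList φs S D xs = Pred.denotList φs S D ys
  | [], _ => by simp only [Pred.denotList]
  | φ :: φs, hA => by
    simp only [Pred.hasAggList, Bool.or_eq_false_iff] at hA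
    simp only [Pred.denotList, Pred.denot_head h φ hA.1, Pred.denotList_head h φs hA.2]

theorem Expr.denot_head (h : xs.headD [] = ys.headD []) :
    ∀ E : Expr, E.hasAgg = false → E.denot S D xs = E.denot S D ys
  | .attr a, _ => by simp only [Expr.denot, h]
  | .val v, _ => by simp only [Expr.denot]
  | .arith op E₁ E₂, hA => by
    simp only [Expr.hasAgg, Bool.or_eq_false_iff] at hA
    simp only [Expr.denot, Expr.denot_head h E₁ hA.1, Expr.denot_head h E₂ hA.2]
  | .ite φ E₁ E₂, hA => by
    simp only [Expr.hasAgg, Bool.or_eq_false_iff] at hA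
    simp only [Expr.denot, Pred.denot_head h φ hA.1.1, Expr.denot_head h E₁ hA.1.2,
      Expr.denot_head h E₂ hA.2]
  | .case φs Es E, hA => by
    simp only [Expr.hasAgg, Bool.or_eq_false_iff] at hA
    simp only [Expr.denot, Pred.denotList_head h φs hA.1.1, Expr.denotList_head h Es hA.1.2,
      Expr.denot_head h E hA.2]

theorem Expr.denotList_head (h : xs.headD [] = ys.headD []) :
    ∀ Es : List Expr, Expr.hasAggList Es = false →
      Expr.denotList Es S D xs = Expr.denotList Es S D ys
  | [], _ => by simp only [Expr.denotList]
  | E :: Es, hA => by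
    simp only [Expr.hasAggList, Bool.or_eq_false_iff] at hA
    simp only [Expr.denotList, Expr.denot_head h E hA.1, Expr.denotList_head h Es hA.2]

end

theorem Expr.hasAgg_of_mem {Es : List Expr} (h : Expr.hasAggList Es = false) :
    ∀ E ∈ Es, E.hasAgg = false := by
  induction Es with
  | nil => simp
  | cons E Es ih =>
    simp only [Expr.hasAggList, Bool.or_eq_false_iff] at h
    intro E' hE'
    rcases List.mem_cons.1 hE' with rfl | hE'
    · exact h.1
    · exact ih h.2 E' hE'

theorem Expr.denotList_eq_map (Es : List Expr) (S : SchemaEnv) (D : Database) (xs : Relation) :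
    Expr.denotList Es S D xs = Es.map (fun E => E.denot S D xs) := by
  induction Es with
  | nil => simp only [Expr.denotList, List.map_nil]
  | cons E Es ih => simp only [Expr.denotList, ih, List.map_cons]

theorem Item.denotList_eq_map (L : List Item) (S : SchemaEnv) (D : Database) (xs : Relation) :
    Item.denotList L S D xs = L.map (fun e => (e.name, e.attr.denot S D xs)) := by
  induction L with
  | nil => simp only [Item.denotList, List.map_nil]
  | cons e L ih =>
    simp only [Item.denotList, ih, List.map_cons]
    cases e <;> simp only [Item.denot, Item.name, Item.attr]

theorem groupBy_perm {Es : List Expr} {L : List Item} {φ : Pred} (h : xs.Perm ys)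
    (hEs : Expr.hasAggList Es = false) (hL : ∀ e ∈ L, e.attr.Det Es) (hφ : φ.Det Es) :
    (((groups (fun z => Expr.denotList Es S D [z]) xs).filter
        (fun xs => decide (φ.denot S D xs = .bool true))).map
          (fun xs => Item.denotList L S D xs)).Perm
      (((groups (fun z => Expr.denotList Es S D [z]) ys).filter
        (fun xs => decide (φ.denot S D xs = .bool true))).map
          (fun xs => Item.denotList L S D xs)) := by
  set κ : Tuple → List Value := fun z => Expr.denotList Es S D [z] with hκ
  have hd := dedup_perm (h.map κ)
  simp only [groups, List.filter_map, List.map_map]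
  have key : ∀ y ∈ dedup (xs.map κ), ∀ K ∈ Es,
      K.denot S D (xs.filter (fun z => decide (κ z = y))) =
        K.denot S D (ys.filter (fun z => decide (κ z = y))) := by
    intro y hy K hK
    have hval : ∀ zs : Relation, zs.Perm xs → ∃ z, κ z = y ∧
        K.denot S D (zs.filter (fun z => decide (κ z = y))) = K.denot S D [z] := by
      intro zs hzs
      obtain ⟨x, hx, hxy⟩ := List.mem_map.1 (mem_dedup.1 hy)
      have hne : zs.filter (fun z => decide (κ z = y)) ≠ [] :=
        List.ne_nil_of_mem (List.mem_filter.2 ⟨hzs.mem_iff.2 hx, by simp [hxy]⟩)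
      obtain ⟨z, zs', hz⟩ := List.exists_cons_of_ne_nil hne
      have hz' : z ∈ zs.filter (fun z => decide (κ z = y)) := by rw [hz]; exact List.mem_cons_self
      refine ⟨z, by simpa using (List.mem_filter.1 hz').2, ?_⟩
      exact Expr.denot_head (by simp [hz]) K (Expr.hasAgg_of_mem hEs K hK)
    obtain ⟨z, hz, hz'⟩ := hval xs (List.Perm.refl _)
    obtain ⟨w, hw, hw'⟩ := hval ys h.symm
    rw [hz', hw']
    have hzw : κ z = κ w := hz.trans hw.symm
    simp only [hκ, Expr.denotList_eq_map] at hzw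
    exact List.map_inj_left.1 hzw K hK
  have hf : (dedup (xs.map κ)).filter
      ((fun xs => decide (φ.denot S D xs = .bool true)) ∘
        fun y => xs.filter (fun z => decide (κ z = y))) =
      (dedup (xs.map κ)).filter ((fun xs => decide (φ.denot S D xs = .bool true)) ∘
        fun y => ys.filter (fun z => decide (κ z = y))) := by
    apply List.filter_congr
    intro y hy
    simp only [Function.comp, Pred.denot_congr (h.filter _) (key y hy) φ hφ]
  rw [hf]
  refine List.Perm.trans (List.Perm.of_eq ?_) ((hd.filter _).map _)
  apply List.map_congr_left
  intro y hy
  exact Item.denotList_congr (h.filter _) (key y (List.mem_of_mem_filter hy)) L hL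

end Congr

/-! ### Attributes of intermediate results -/

theorem update_rel {α β : Type} (P : α → β → Prop) (Rs : List RelName) :
    ∀ {as : List α} {bs : List β} {m : RelName → Option α} {m' : RelName → Option β},
      List.Forall₂ P as bs →
      (∀ R a, m R = some a → ∃ b, m' R = some b ∧ P a b) →
      ∀ R a, update m Rs as R = some a → ∃ b, update m' Rs bs R = some b ∧ P a b := by
  induction Rs with
  | nil => intro as bs m m' _ h; simpa [update] using h
  | cons R₀ Rs ih =>
    intro as bs m m' hab h
    cases hab with
    | nil => simpa [update] using h
    | cons h₀ hab =>
      refine ih hab ?_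
      intro R a
      by_cases hR : R = R₀
      · subst hR
        simp only [Function.update_self, Option.some.injEq]
        rintro rfl
        exact ⟨_, rfl, h₀⟩
      · simp only [Function.update_of_ne hR]
        exact h R a

/-- The relations of `D` have the attributes declared in `S`. -/
def NamesOK (S : SchemaEnv) (D : Database) : Prop :=
  ∀ R A, S R = some A → ∃ rows, D R = some rows ∧ ∀ x ∈ rows, x.map Prod.fst = A

theorem joinRel_names {k : JoinKind} {A₁ A₂ : List AttrName} {f : Tuple → Bool}
    {xs ys : Relation} (h₁ : ∀ x ∈ xs, x.map Prod.fst = A₁) (h₂ : ∀ y ∈ ys, y.map Prod.fst = A₂) :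
    ∀ z ∈ joinRel k A₁ A₂ f xs ys, z.map Prod.fst = A₁ ++ A₂ := by
  intro z hz
  rw [(joinRel_perm_joinList k A₁ A₂ f xs ys).mem_iff] at hz
  have hn : ∀ A : List AttrName, (nullTuple A).map Prod.fst = A := by
    intro A; simp [nullTuple, Function.comp_def]
  have hi : z ∈ (cross xs ys).filter f → z.map Prod.fst = A₁ ++ A₂ := by
    intro hz
    have := List.mem_of_mem_filter hz
    rw [cross_eq] at this
    simp only [List.mem_flatMap, List.mem_map] at this
    obtain ⟨x, hx, y, hy, rfl⟩ := this
    rw [List.map_append, h₁ x hx, h₂ y hy]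
  have hl : z ∈ (xs.filter (fun x => ys.all (fun y => !f (x ++ y)))).map
      (fun x => x ++ nullTuple A₂) → z.map Prod.fst = A₁ ++ A₂ := by
    intro hz
    obtain ⟨x, hx, rfl⟩ := List.mem_map.1 hz
    rw [List.map_append, h₁ x (List.mem_of_mem_filter hx), hn]
  have hr : z ∈ (ys.filter (fun y => xs.all (fun x => !f (x ++ y)))).map
      (fun y => nullTuple A₁ ++ y) → z.map Prod.fst = A₁ ++ A₂ := by
    intro hz
    obtain ⟨y, hy, rfl⟩ := List.mem_map.1 hz
    rw [List.map_append, h₂ y (List.mem_of_mem_filter hy), hn]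
  cases k <;> simp only [joinList, List.mem_append] at hz
  · exact hi hz
  · exact hz.elim hi hl
  · exact hz.elim hi hr
  · exact hz.elim hi (fun hz => hz.elim hr hl)

theorem collRel_subset {op : CollOp} {xs ys : Relation} {z : Tuple} (h : z ∈ collRel op xs ys) :
    z ∈ xs ∨ z ∈ ys := by
  cases op <;> simp only [collRel, mem_dedup, List.mem_append, List.mem_filter, bagDiff_eq] at h
  · exact h
  · exact Or.inl h.1
  · exact Or.inl h.1
  · exact h
  · exact Or.inl ((List.diff_subset _ _) h)
  · exact Or.inl ((List.diff_subset _ _) h)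

theorem Query.attrs_nodup : ∀ (Q : Query) (S : SchemaEnv), Q.WF S → (Q.attrs S).Nodup
  | .rel R, S, h => by
    simp only [Query.WF] at h
    obtain ⟨A, hA, hn⟩ := h
    simpa [Query.attrs, hA] using hn
  | .proj L Q, S, h => by
    simp only [Query.WF] at h
    simpa only [Query.attrs] using h.2.2.1
  | .select φ Q, S, h => by
    simp only [Query.WF] at h
    simpa only [Query.attrs] using Query.attrs_nodup Q S h.1
  | .rename R Q, S, h => by
    simp only [Query.WF] at h
    simpa only [Query.attrs] using h.2
  | .coll op Q₁ Q₂, S, h => by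
    simp only [Query.WF] at h
    simpa only [Query.attrs] using Query.attrs_nodup Q₁ S h.1
  | .distinct Q, S, h => by
    simp only [Query.WF] at h
    simpa only [Query.attrs] using Query.attrs_nodup Q S h
  | .prod Q₁ Q₂, S, h => by
    simp only [Query.WF] at h
    simpa only [Query.attrs] using h.2.2
  | .join k φ Q₁ Q₂, S, h => by
    simp only [Query.WF] at h
    simpa only [Query.attrs] using h.2.2.2
  | .groupBy Q Es L φ, S, h => by
    simp only [Query.WF] at h
    simpa only [Query.attrs] using h.2.2.2.2.1
  | .withQ Qs Rs Q, S, h => by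
    simp only [Query.WF] at h
    simpa only [Query.attrs] using Query.attrs_nodup Q _ h.2.2

mutual

theorem Query.denot_names : ∀ (Q : Query) (S : SchemaEnv) (D : Database), Q.WF S → NamesOK S D →
    ∀ x ∈ Q.denot S D, x.map Prod.fst = Q.attrs S
  | .rel R, S, D, h, hD => by
    simp only [Query.WF] at h
    obtain ⟨A, hA, _⟩ := h
    obtain ⟨rows, hr, hn⟩ := hD R A hA
    simpa [Query.denot, Query.attrs, hA, hr] using hn
  | .proj L Q, S, D, h, hD => by
    intro x hx
    simp only [Query.denot] at hx
    have : ∃ xs, x = Item.denotList L S D xs := by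
      split at hx
      · exact ⟨_, List.mem_singleton.1 hx⟩
      · obtain ⟨y, _, rfl⟩ := List.mem_map.1 hx; exact ⟨_, rfl⟩
    obtain ⟨xs, rfl⟩ := this
    simp [Query.attrs, Item.denotList_eq_map, Function.comp_def]
  | .select φ Q, S, D, h, hD => by
    simp only [Query.WF] at h
    intro x hx
    simp only [Query.denot] at hx
    simpa only [Query.attrs] using Query.denot_names Q S D h.1 hD x (List.mem_of_mem_filter hx)
  | .rename R Q, S, D, h, hD => by
    simp only [Query.WF] at h
    intro x hx
    simp only [Query.denot] at hx
    obtain ⟨y, hy, rfl⟩ := List.mem_map.1 hx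
    rw [Query.attrs, ← Query.denot_names Q S D h.1 hD y hy]
    simp [Function.comp_def]
  | .coll op Q₁ Q₂, S, D, h, hD => by
    simp only [Query.WF] at h
    intro x hx
    simp only [Query.denot] at hx
    simp only [Query.attrs]
    rcases collRel_subset hx with hx | hx
    · exact Query.denot_names Q₁ S D h.1 hD x hx
    · rw [h.2.2]; exact Query.denot_names Q₂ S D h.2.1 hD x hx
  | .distinct Q, S, D, h, hD => by
    simp only [Query.WF] at h
    intro x hx
    simp only [Query.denot, mem_dedup] at hx
    simpa only [Query.attrs] using Query.denot_names Q S D h hD x hx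
  | .prod Q₁ Q₂, S, D, h, hD => by
    simp only [Query.WF] at h
    intro x hx
    simp only [Query.denot, cross_eq, List.mem_flatMap, List.mem_map] at hx
    obtain ⟨y, hy, z, hz, rfl⟩ := hx
    rw [List.map_append, Query.denot_names Q₁ S D h.1 hD y hy,
      Query.denot_names Q₂ S D h.2.1 hD z hz, Query.attrs]
  | .join k φ Q₁ Q₂, S, D, h, hD => by
    simp only [Query.WF] at h
    intro x hx
    simp only [Query.denot] at hx
    simp only [Query.attrs]
    exact joinRel_names (Query.denot_names Q₁ S D h.1 hD) (Query.denot_names Q₂ S D h.2.1 hD) x hx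
  | .groupBy Q Es L φ, S, D, h, hD => by
    intro x hx
    simp only [Query.denot] at hx
    obtain ⟨xs, _, rfl⟩ := List.mem_map.1 hx
    simp [Query.attrs, Item.denotList_eq_map, Function.comp_def]
  | .withQ Qs Rs Q, S, D, h, hD => by
    simp only [Query.WF] at h
    simp only [Query.denot, Query.attrs]
    exact Query.denot_names Q _ _ h.2.2
      (update_rel _ Rs (Query.denotList_names Qs S D h.1 hD) hD)

theorem Query.denotList_names : ∀ (Qs : List Query) (S : SchemaEnv) (D : Database),
    Query.WFList Qs S → NamesOK S D →
    List.Forall₂ (fun (A : List AttrName) (rows : Relation) => ∀ x ∈ rows, x.map Prod.fst = A)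
      (Query.attrsList Qs S) (Query.denotList Qs S D)
  | [], S, D, h, hD => by
    simp only [Query.attrsList, Query.denotList]
    exact List.Forall₂.nil
  | Q :: Qs, S, D, h, hD => by
    simp only [Query.WFList] at h
    simp only [Query.attrsList, Query.denotList]
    exact List.Forall₂.cons (Query.denot_names Q S D h.1 hD)
      (Query.denotList_names Qs S D h.2 hD)

end

/-! ### Symbols generated below a position -/

def Sym.path : Sym → Option Path
  | .tup (.base _) => none
  | .tup (.fresh p _ _) => some p
  | .grp p => some p
  | .paired p _ => some p
  | .find p => some p

/-- The symbols generated at the position `p`. -/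
def level (p : Path) : Set Sym := {s | s.path = some p}

/-- The symbols generated at or below the position `p`. -/
def zone (p : Path) : Set Sym := {s | ∃ q, s.path = some q ∧ p <:+ q}

/-- The symbols generated strictly below the position `p`. -/
def below (p : Path) : Set Sym := zone p \ level p

theorem level_subset_zone (p : Path) : level p ⊆ zone p :=
  fun _ hs => ⟨p, hs, List.suffix_rfl⟩

theorem zone_cons_subset_below (i : ℕ) (p : Path) : zone (i :: p) ⊆ below p := by
  rintro s ⟨q, hs, hq⟩
  refine ⟨⟨q, hs, (List.suffix_cons i p).trans hq⟩, fun h => ?_⟩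
  have : q = p := by
    have h' : s.path = some p := h
    rw [hs] at h'
    exact Option.some.inj h'
  subst this
  have := hq.length_le
  simp at this

theorem zone_cons_subset (i : ℕ) (p : Path) : zone (i :: p) ⊆ zone p :=
  (zone_cons_subset_below i p).trans Set.sdiff_subset

theorem zone_cons_disjoint {i j : ℕ} (h : i ≠ j) (p : Path) :
    Disjoint (zone (i :: p)) (zone (j :: p)) := by
  rw [Set.disjoint_left]
  rintro s ⟨q, hs, hq⟩ ⟨q', hs', hq'⟩
  rw [hs] at hs'
  obtain rfl := Option.some.inj hs'
  have := List.suffix_of_suffix_length_le hq hq' (by simp)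
  have := this.eq_of_length (by simp)
  exact h (List.cons.inj this).1

/-! ### Agreement of interpretations -/

theorem Interp.AgreeOn.trans {K J I : Interp} {s : Sym} (h : K.AgreeOn J s) (h' : J.AgreeOn I s) :
    K.AgreeOn I s := by
  cases s <;> simp only [Interp.AgreeOn] at h h' ⊢
  · exact ⟨h.1.trans h'.1, h.2.trans h'.2⟩
  all_goals exact h.trans h'

theorem Interp.AgreeOn.refl (I : Interp) (s : Sym) : I.AgreeOn I s := by
  cases s <;> simp [Interp.AgreeOn]

/-- Agreement on a set of symbols. -/
def Interp.EqOn (J I : Interp) (W : Set Sym) : Prop := ∀ s ∈ W, J.AgreeOn I s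

theorem Interp.EqOn.mono {J I : Interp} {W W' : Set Sym} (h : J.EqOn I W') (hW : W ⊆ W') :
    J.EqOn I W := fun s hs => h s (hW hs)

theorem Interp.EqOn.trans {K J I : Interp} {W : Set Sym} (h : K.EqOn J W) (h' : J.EqOn I W) :
    K.EqOn I W := fun s hs => (h s hs).trans (h' s hs)

theorem Interp.EqOn.refl (I : Interp) (W : Set Sym) : I.EqOn I W := fun s _ => .refl I s

/-- `I` can be changed on `Z` so that `G` holds, and continues to hold as long as the symbols from
`V` and `Z` keep their meanings. -/
def Solvable (V Z : Set Sym) (I : Interp) (G : Interp → Prop) : Prop :=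
  ∃ I' : Interp, I'.EqOn I Zᶜ ∧ ∀ J : Interp, J.EqOn I' (V ∪ Z) → G J

namespace Solvable

variable {V V' Z Z' Z₁ Z₂ : Set Sym} {I : Interp} {G G' G₁ G₂ : Interp → Prop}

theorem mono (h : Solvable V Z I G) (hV : V ⊆ V') (hZ : Z ⊆ Z') (hG : ∀ J, G J → G' J) :
    Solvable V' Z' I G' := by
  obtain ⟨I', h1, h2⟩ := h
  exact ⟨I', h1.mono (Set.compl_subset_compl.2 hZ),
    fun J hJ => hG J (h2 J (hJ.mono (Set.union_subset_union hV hZ)))⟩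

theorem of_forall (h : ∀ J, G J) : Solvable V Z I G := ⟨I, .refl I _, fun J _ => h J⟩

theorem bind (h₁ : Solvable V Z₁ I G₁) (hd : Disjoint (V ∪ Z₁) Z₂)
    (h₂ : ∀ I₁ : Interp, I₁.EqOn I Z₁ᶜ → (∀ J : Interp, J.EqOn I₁ (V ∪ Z₁) → G₁ J) →
      Solvable (V ∪ Z₁) Z₂ I₁ G₂) :
    Solvable V (Z₁ ∪ Z₂) I (fun J => G₁ J ∧ G₂ J) := by
  obtain ⟨I₁, h1, h2⟩ := h₁
  obtain ⟨I₂, h3, h4⟩ := h₂ I₁ h1 h2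
  refine ⟨I₂, ?_, fun J hJ => ⟨h2 J ?_, h4 J ?_⟩⟩
  · rw [Set.compl_union]
    exact (h3.mono Set.inter_subset_right).trans (h1.mono Set.inter_subset_left)
  · exact (hJ.mono (by rw [← Set.union_assoc]; exact Set.subset_union_left)).trans
      (h3.mono hd.subset_compl_right)
  · rwa [Set.union_assoc]

/-- Independent requirements at two positions below the same one. -/
theorem and_zone {p : Path} {j : ℕ} (hV : Disjoint V (zone p)) (hZ : Disjoint Z₁ (zone (j :: p)))
    (h₁ : Solvable V Z₁ I G₁)
    (h₂ : ∀ I₁ : Interp, I₁.EqOn I Z₁ᶜ → Solvable V (zone (j :: p)) I₁ G₂) :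
    Solvable V (Z₁ ∪ zone (j :: p)) I (fun J => G₁ J ∧ G₂ J) :=
  h₁.bind (Set.disjoint_union_left.2 ⟨hV.mono_right (zone_cons_subset j p), hZ⟩)
    (fun I₁ hI₁ _ => (h₂ I₁ hI₁).mono Set.subset_union_left subset_rfl (fun _ h => h))

end Solvable

/-! ### Rows of symbolic tuples -/

def Interp.row (J : Interp) (t : TupVar) : Row := (J.tup t, J.del t)

/-- The row of the `i`-th tuple of `T`. -/
def Interp.rowAt (J : Interp) (T : List TupVar) (i : ℕ) : Row := (T[i]?.map J.row).getD ([], true)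

theorem Interp.rowAt_of_getElem? {J : Interp} {T : List TupVar} {i : ℕ} {t : TupVar}
    (h : T[i]? = some t) : J.rowAt T i = (J.tup t, J.del t) := by
  simp [Interp.rowAt, h, Interp.row]

theorem Interp.rowAt_congr {J I : Interp} {W : Set Sym} (h : J.EqOn I W) {T : List TupVar}
    (hT : ∀ t ∈ T, Sym.tup t ∈ W) : J.rowAt T = I.rowAt T := by
  funext i
  unfold Interp.rowAt
  cases ht : T[i]? with
  | none => rfl
  | some t =>
    have := h _ (hT t (List.mem_of_getElem? ht))
    simp only [Interp.AgreeOn] at this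
    simp [Interp.row, this.1, this.2]

theorem Interp.rel_congr {J I : Interp} {W : Set Sym} (h : J.EqOn I W) {T : List TupVar}
    (hT : ∀ t ∈ T, Sym.tup t ∈ W) : J.rel T = I.rel T := by
  have h' : ∀ t ∈ T, J.tup t = I.tup t ∧ J.del t = I.del t := fun t ht => h _ (hT t ht)
  unfold Interp.rel
  rw [List.filter_congr (fun t ht => by rw [(h' t ht).2])]
  exact List.map_congr_left (fun t ht => (h' t (List.mem_of_mem_filter ht)).1)

theorem Interp.rel_append (J : Interp) (T₁ T₂ : List TupVar) :
    J.rel (T₁ ++ T₂) = J.rel T₁ ++ J.rel T₂ := by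
  simp [Interp.rel]

theorem Interp.rel_take (J : Interp) (T : List TupVar) {n : ℕ} (hn : n ≤ T.length) :
    J.rel (T.take n) = lv n (J.rowAt T) := by
  induction n with
  | zero => simp [Interp.rel]
  | succ n ih =>
    rw [lv_succ, ← ih (by omega), List.take_succ_eq_append_getElem (by omega), J.rel_append,
      Interp.rowAt_of_getElem? (List.getElem?_eq_getElem (by omega))]
    congr 1
    cases h : J.del T[n] <;> simp [Interp.rel, h]

theorem Interp.rel_eq_lv (J : Interp) (T : List TupVar) :
    J.rel T = lv T.length (J.rowAt T) := by
  rw [← J.rel_take T le_rfl, List.take_length]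

@[simp] theorem length_freshTuples (p : Path) (k n : ℕ) : (freshTuples p k n).length = n := by
  simp [freshTuples]

theorem getElem?_freshTuples {p : Path} {k n i : ℕ} (h : i < n) :
    (freshTuples p k n)[i]? = some (.fresh p k i) := by
  simp [freshTuples, h]

theorem Interp.rowAt_fresh {J : Interp} {p : Path} {k n i : ℕ} (h : i < n) :
    J.rowAt (freshTuples p k n) i = J.row (.fresh p k i) :=
  J.rowAt_of_getElem? (getElem?_freshTuples h)

theorem Interp.rel_fresh (J : Interp) (p : Path) (k n : ℕ) :
    J.rel (freshTuples p k n) = lv n (fun i => J.row (.fresh p k i)) := by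
  rw [J.rel_eq_lv, length_freshTuples]
  exact lv_congr (fun i hi => J.rowAt_fresh hi)

theorem mem_rel {J : Interp} {T : List TupVar} {x : Tuple} :
    x ∈ J.rel T ↔ ∃ t ∈ T, J.del t = false ∧ J.tup t = x := by
  simp only [Interp.rel, List.mem_map, List.mem_filter, Bool.not_eq_true']
  grind

/-- The meanings of the symbols generated at a position. -/
structure Level where
  row : ℕ → ℕ → Row
  grp : ℕ → ℕ → Bool := fun _ _ => false
  paired : ℕ → ℕ → ℕ → Bool := fun _ _ _ => false
  find : ℕ → ℕ := fun i => i

/-- The symbols generated at `p` have the meanings `L`. -/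
structure Interp.HasLevel (J : Interp) (p : Path) (L : Level) : Prop where
  row : ∀ k i, J.row (.fresh p k i) = L.row k i
  grp : J.grp p = L.grp
  paired : ∀ k, J.paired p k = L.paired k
  find : J.find p = L.find

theorem exists_hasLevel (I : Interp) (p : Path) (L : Level) :
    ∃ I' : Interp, I'.EqOn I (level p)ᶜ ∧ I'.HasLevel p L := by
  refine ⟨{ dom := I.dom
            tup := fun t => match t with
              | .base n => I.tup (.base n)
              | .fresh q k i => if q = p then (L.row k i).1 else I.tup (.fresh q k i)
            del := fun t => match t with
              | .base n => I.del (.base n)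
              | .fresh q k i => if q = p then (L.row k i).2 else I.del (.fresh q k i)
            grp := fun q => if q = p then L.grp else I.grp q
            paired := fun q k => if q = p then L.paired k else I.paired q k
            find := fun q => if q = p then L.find else I.find q }, ?_, ?_⟩
  · intro s hs
    have hs' : s.path ≠ some p := hs
    rcases s with (n | ⟨q, k, i⟩) | q | ⟨q, k⟩ | q <;>
      simp only [Interp.AgreeOn, Sym.path, ne_eq, Option.some.injEq] at hs' ⊢ <;> simp [hs']
  · constructor <;> simp [Interp.row]

theorem hasLevel_congr {J I : Interp} {p : Path} {L : Level} (h : J.EqOn I (level p))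
    (hI : I.HasLevel p L) : J.HasLevel p L := by
  constructor
  · intro k i
    rw [← hI.row]
    have := h (.tup (.fresh p k i)) rfl
    simp only [Interp.AgreeOn] at this
    simp [Interp.row, this.1, this.2]
  · rw [← hI.grp]; exact h (.grp p) rfl
  · intro k
    rw [← hI.paired]; exact h (.paired p k) rfl
  · rw [← hI.find]; exact h (.find p) rfl

/-- An operator at the position `p` that computes the meanings of its symbols from the rows of its
operands. -/
theorem Solvable.node {V : Set Sym} {I : Interp} {p : Path} {G₁ G : Interp → Prop}
    (hV : Disjoint V (zone p)) (h : Solvable V (below p) I G₁) (T₁ T₂ : List TupVar)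
    (hT₁ : ∀ t ∈ T₁, Sym.tup t ∈ V ∪ below p) (hT₂ : ∀ t ∈ T₂, Sym.tup t ∈ V ∪ below p)
    (L : (ℕ → Row) → (ℕ → Row) → Level)
    (hG : ∀ J, G₁ J → J.HasLevel p (L (J.rowAt T₁) (J.rowAt T₂)) → G J) :
    Solvable V (zone p) I G := by
  have hz : below p ∪ level p = zone p := Set.sdiff_union_of_subset (level_subset_zone p)
  have hd : Disjoint (V ∪ below p) (level p) :=
    Set.disjoint_union_left.2 ⟨hV.mono_right (level_subset_zone p), Set.disjoint_sdiff_left⟩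
  rw [← hz]
  refine (h.bind (G₂ := fun J => J.HasLevel p (L (J.rowAt T₁) (J.rowAt T₂))) hd ?_).mono
    subset_rfl subset_rfl (fun J hJ => hG J hJ.1 hJ.2)
  intro I₁ _ _
  obtain ⟨I₂, h1, h2⟩ := exists_hasLevel I₁ p (L (I₁.rowAt T₁) (I₁.rowAt T₂))
  refine ⟨I₂, h1, fun J hJ => ?_⟩
  have hW : J.EqOn I₁ (V ∪ below p) :=
    (hJ.mono Set.subset_union_left).trans (h1.mono hd.subset_compl_right)
  beta_reduce
  rw [Interp.rowAt_congr hW hT₁, Interp.rowAt_congr hW hT₂]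
  exact hasLevel_congr (hJ.mono Set.subset_union_right) h2

/-! ### Positions of symbolic tuples -/

theorem freshTuples_subset_zone (p : Path) (k n : ℕ) :
    ∀ t ∈ freshTuples p k n, Sym.tup t ∈ zone p := by
  intro t ht
  simp only [freshTuples, List.mem_map] at ht
  obtain ⟨i, _, rfl⟩ := ht
  exact level_subset_zone p rfl

theorem update_forall {α : Type} {P : α → Prop} (Rs : List RelName) {as : List α}
    {m : RelName → Option α} (h : ∀ a ∈ as, P a) (hm : ∀ R a, m R = some a → P a) :
    ∀ R a, update m Rs as R = some a → P a := by
  have h₂ : List.Forall₂ (fun a b => a = b ∧ P b) as as := List.forall₂_same.2 fun a ha => ⟨rfl, h a ha⟩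
  intro R a hR
  obtain ⟨b, _, rfl, hb⟩ := update_rel _ Rs h₂ (fun R a ha => ⟨a, ha, rfl, hm R a ha⟩) R a hR
  exact hb

mutual

theorem Query.symTuples_mem : ∀ (Q : Query) (Γ : SymDB) (p : Path) (V : Set Sym),
    (∀ R T, Γ R = some T → ∀ t ∈ T, Sym.tup t ∈ V) →
    ∀ t ∈ Q.symTuples Γ p, Sym.tup t ∈ V ∪ zone p
  | .rel R, Γ, p, V, h => by
    intro t ht
    simp only [Query.symTuples] at ht
    cases hR : Γ R with
    | none => simp [hR] at ht
    | some T => exact Or.inl (h R T hR t (by simpa [hR] using ht))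
  | .proj L Q, Γ, p, V, h => by
    intro t ht
    simp only [Query.symTuples] at ht
    split at ht <;> exact Or.inr (freshTuples_subset_zone _ _ _ t ht)
  | .select φ Q, Γ, p, V, h => by
    intro t ht
    simp only [Query.symTuples] at ht
    exact Or.inr (freshTuples_subset_zone _ _ _ t ht)
  | .rename R Q, Γ, p, V, h => by
    intro t ht
    simp only [Query.symTuples] at ht
    exact Or.inr (freshTuples_subset_zone _ _ _ t ht)
  | .coll op Q₁ Q₂, Γ, p, V, h => by
    intro t ht
    simp only [Query.symTuples] at ht
    cases op <;> exact Or.inr (freshTuples_subset_zone _ _ _ t ht)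
  | .distinct Q, Γ, p, V, h => by
    intro t ht
    simp only [Query.symTuples] at ht
    exact Or.inr (freshTuples_subset_zone _ _ _ t ht)
  | .prod Q₁ Q₂, Γ, p, V, h => by
    intro t ht
    simp only [Query.symTuples] at ht
    exact Or.inr (freshTuples_subset_zone _ _ _ t ht)
  | .join k φ Q₁ Q₂, Γ, p, V, h => by
    intro t ht
    simp only [Query.symTuples] at ht
    cases k <;> simp only [List.mem_append] at ht
    · exact Or.inr (freshTuples_subset_zone _ _ _ t ht)
    · rcases ht with ht | ht <;> exact Or.inr (freshTuples_subset_zone _ _ _ t ht)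
    · rcases ht with ht | ht <;> exact Or.inr (freshTuples_subset_zone _ _ _ t ht)
    · rcases ht with ht | ht | ht <;> exact Or.inr (freshTuples_subset_zone _ _ _ t ht)
  | .groupBy Q Es L φ, Γ, p, V, h => by
    intro t ht
    simp only [Query.symTuples] at ht
    exact Or.inr (freshTuples_subset_zone _ _ _ t ht)
  | .withQ Qs Rs Q, Γ, p, V, h => by
    intro t ht
    simp only [Query.symTuples] at ht
    have := Query.symTuples_mem Q _ (1 :: p) (V ∪ zone (0 :: p))
      (update_forall Rs (Query.symTuplesList_mem Qs Γ (0 :: p) V h)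
        (fun R T hR t ht => Or.inl (h R T hR t ht))) t ht
    rcases this with (h' | h') | h'
    · exact Or.inl h'
    · exact Or.inr (zone_cons_subset _ _ h')
    · exact Or.inr (zone_cons_subset _ _ h')

theorem Query.symTuplesList_mem : ∀ (Qs : List Query) (Γ : SymDB) (p : Path) (V : Set Sym),
    (∀ R T, Γ R = some T → ∀ t ∈ T, Sym.tup t ∈ V) →
    ∀ T ∈ Query.symTuplesList Qs Γ p, ∀ t ∈ T, Sym.tup t ∈ V ∪ zone p
  | [], Γ, p, V, h => by
    intro T hT
    simp [Query.symTuplesList] at hT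
  | Q :: Qs, Γ, p, V, h => by
    intro T hT t ht
    simp only [Query.symTuplesList, List.mem_cons] at hT
    rcases hT with rfl | hT
    · exact (Query.symTuples_mem Q Γ _ V h t ht).imp id (fun h' => zone_cons_subset _ _ h')
    · exact (Query.symTuplesList_mem Qs Γ _ V h T hT t ht).imp id
        (fun h' => zone_cons_subset _ _ h')

end

/-! ### Lookup -/

theorem lookup_of_mem {x : Tuple} (hx : (x.map Prod.fst).Nodup) {a : AttrName} {v : Value}
    (h : (a, v) ∈ x) : lookup x a = v := by
  induction x with
  | nil => simp at h
  | cons bw x ih =>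
    obtain ⟨b, w⟩ := bw
    simp only [List.map_cons, List.nodup_cons, List.mem_map, not_exists, not_and] at hx
    rcases List.mem_cons.1 h with h | h
    · simp only [Prod.mk.injEq] at h
      simp [lookup, h.1, h.2]
    · have : a ≠ b := fun hab => hx.1 _ h hab
      simp [lookup, this, ih hx.2 h]

theorem lookup_append_left {x y : Tuple} {a : AttrName} (h : a ∈ x.map Prod.fst) :
    lookup (x ++ y) a = lookup x a := by
  induction x with
  | nil => simp at h
  | cons bw x ih =>
    obtain ⟨b, w⟩ := bw
    by_cases hab : a = b
    · simp [lookup, hab]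
    · simp only [List.map_cons, List.mem_cons, hab, false_or] at h
      simp [lookup, hab, ih h]

theorem lookup_append_right {x y : Tuple} {a : AttrName} (h : a ∉ x.map Prod.fst) :
    lookup (x ++ y) a = lookup y a := by
  induction x with
  | nil => rfl
  | cons bw x ih =>
    obtain ⟨b, w⟩ := bw
    simp only [List.map_cons, List.mem_cons, not_or] at h
    simp [lookup, h.1, ih h.2]

theorem lookup_nullTuple (A : List AttrName) (a : AttrName) : lookup (nullTuple A) a = .null := by
  induction A with
  | nil => rfl
  | cons b A ih => simpa [nullTuple, lookup] using fun _ => ih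

theorem map_fst_nullTuple (A : List AttrName) : (nullTuple A).map Prod.fst = A := by
  simp [nullTuple, Function.comp_def]

theorem map_lookup {x : Tuple} (hx : (x.map Prod.fst).Nodup) :
    (x.map Prod.fst).map (lookup x) = x.map Prod.snd := by
  rw [List.map_map]
  exact List.map_congr_left fun av hav => lookup_of_mem hx hav

/-- The tuple with attributes `A` and the values of `x`. -/
def restrict (A : List AttrName) (x : Tuple) : Tuple := A.map (fun a => (a, lookup x a))

theorem map_fst_restrict (A : List AttrName) (x : Tuple) : (restrict A x).map Prod.fst = A := by
  simp [restrict, Function.comp_def]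

theorem restrict_self {A : List AttrName} (hA : A.Nodup) {x : Tuple} (hx : x.map Prod.fst = A) :
    restrict A x = x := by
  subst hx
  rw [restrict, List.map_map]
  conv_rhs => rw [← List.map_id x]
  exact List.map_congr_left fun av hav => by simp [lookup_of_mem hA hav]

theorem lookup_restrict {A : List AttrName} {x : Tuple} {a : AttrName} (ha : a ∈ A) :
    lookup (restrict A x) a = lookup x a := by
  unfold restrict
  induction A with
  | nil => simp at ha
  | cons b A ih =>
    by_cases hab : a = b
    · simp [lookup, hab]
    · simp only [List.mem_cons, hab, false_or] at ha
      simp [lookup, hab, ih ha]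

theorem eq_of_lookup {A : List AttrName} (hA : A.Nodup) {x y : Tuple} (hx : x.map Prod.fst = A)
    (hy : y.map Prod.fst = A) : (∀ a ∈ A, lookup x a = lookup y a) ↔ x = y := by
  refine ⟨fun h => ?_, fun h a _ => by rw [h]⟩
  rw [← restrict_self hA hx, ← restrict_self hA hy]
  exact List.map_congr_left fun a ha => by rw [h a ha]

/-! ### Truth of the encodings of the operators -/

section Operators

variable {J : Interp}

theorem forall_zipWith_fresh {α : Type} {l : List α} {p : Path} {k n : ℕ} (hn : l.length = n)
    (f : α → TupVar → Formula) (P : Formula → Prop) :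
    (∀ A ∈ List.zipWith f l (freshTuples p k n), P A) ↔
      ∀ i a, l[i]? = some a → P (f a (.fresh p k i)) := by
  subst hn
  constructor
  · intro h i a ha
    have hi := (List.getElem?_eq_some_iff.1 ha).1
    exact h _ (List.mem_of_getElem? (i := i) (by
      simp [List.getElem?_zipWith, ha, getElem?_freshTuples hi]))
  · intro h A hA
    obtain ⟨i, hi⟩ := List.mem_iff_getElem?.1 hA
    obtain ⟨a, t, ha, ht, rfl⟩ := List.getElem?_zipWith_eq_some.1 hi
    have hi := (List.getElem?_eq_some_iff.1 ha).1
    rw [getElem?_freshTuples hi] at ht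
    obtain rfl := Option.some.inj ht
    exact h i a ha

theorem zipWith_fresh_left {l : List TupVar} {p : Path} {k n : ℕ}
    (f : TupVar → TupVar → Formula) :
    List.zipWith f (freshTuples p k n) l = List.zipWith (fun a b => f b a) l (freshTuples p k n) := by
  rw [List.zipWith_comm]

theorem forall_zipIdx_map {α : Type} {l : List α} (f : α × ℕ → Formula) (P : Formula → Prop) :
    (∀ A ∈ l.zipIdx.map f, P A) ↔ ∀ i a, l[i]? = some a → P (f (a, i)) := by
  constructor
  · intro h i a ha
    exact h _ (List.mem_map.2 ⟨(a, i), List.mem_zipIdx_iff_getElem?.2 ha, rfl⟩)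
  · intro h A hA
    obtain ⟨⟨a, i⟩, hai, rfl⟩ := List.mem_map.1 hA
    exact h i a (List.mem_zipIdx_iff_getElem?.1 hai)

theorem Formula.eval_eq_true (x y : Term) :
    (Formula.eq x y).eval J = true ↔ x.eval J = y.eval J := by
  simp only [Formula.eval]
  exact decide_eq_true_iff

theorem eval_sameOn (A : List AttrName) (t' t : TupVar) :
    (sameOn A t' t).eval J = true ↔ ∀ a ∈ A, lookup (J.tup t') a = lookup (J.tup t) a := by
  simp [sameOn, Formula.eval_eq_true, Term.eval]

theorem eval_nullOn (A : List AttrName) (t : TupVar) :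
    (nullOn A t).eval J = true ↔ ∀ a ∈ A, lookup (J.tup t) a = .null := by
  simp [nullOn, Term.isNull, Formula.eval_eq_true, Term.eval]

theorem eval_attrs_eq {x : Tuple} (hx : (x.map Prod.fst).Nodup) {us : List Term} {t' : TupVar}
    (ht : J.tup t' = x) (hus : us.map (Term.eval J) = x.map Prod.snd) {names : List AttrName}
    (hn : x.map Prod.fst = names) :
    (Formula.all (List.zipWith (fun a u => .eq (.attr a t') u) names us)).eval J = true := by
  subst hn
  rw [Formula.eval_all]
  intro A hA
  obtain ⟨i, hi⟩ := List.mem_iff_getElem?.1 hA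
  obtain ⟨a, u, ha, hu, rfl⟩ := List.getElem?_zipWith_eq_some.1 hi
  have h1 : (us.map (Term.eval J))[i]? = some (u.eval J) := by simp [hu]
  rw [hus, List.getElem?_map, Option.map_eq_some_iff] at h1
  rw [List.getElem?_map, Option.map_eq_some_iff] at ha
  obtain ⟨av, hav, h1⟩ := h1
  obtain ⟨av', hav', rfl⟩ := ha
  rw [hav, Option.some.injEq] at hav'
  subst hav'
  simp only [Formula.eval, Term.eval, decide_eq_true_eq, ht]
  rw [← h1]
  exact lookup_of_mem hx (List.mem_of_getElem? hav)

theorem eval_copy_of_row {A : List AttrName} {t' t : TupVar} (h : J.row t' = J.row t) :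
    (copy A A t' t).eval J = true := by
  simp only [Interp.row, Prod.mk.injEq] at h
  have : List.zipWith (fun a' a => Formula.eq (.attr a' t') (.attr a t)) A A =
      A.map (fun a => Formula.eq (.attr a t') (.attr a t)) := by
    rw [List.zipWith_self]
  rw [copy, this, Formula.eval_and_true, Formula.eval_all]
  simp [Formula.eval, Term.eval, h.1, h.2]

/-- Membership in a list of symbolic tuples with attributes `A`. -/
theorem eval_memTuples {A : List AttrName} (hA : A.Nodup) {t : TupVar}
    (ht : (J.tup t).map Prod.fst = A) {T : List TupVar} (hT : ∀ x ∈ J.rel T, x.map Prod.fst = A) :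
    (memTuples A t T).eval J = true ↔ J.tup t ∈ J.rel T := by
  simp only [memTuples, Formula.eval_any, List.mem_map, exists_exists_and_eq_and,
    Formula.eval_and_true, Formula.eval_not_true, eval_sameOn, mem_rel]
  refine exists_congr fun s => and_congr_right fun hs => ?_
  simp only [Formula.eval, Bool.not_eq_true]
  refine and_congr_right fun hd => ?_
  rw [eval_of_names hs hd, eq_comm]
where
  eval_of_names {s : TupVar} (hs : s ∈ T) (hd : J.del s = false) :
      (∀ a ∈ A, lookup (J.tup t) a = lookup (J.tup s) a) ↔ J.tup t = J.tup s :=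
    eq_of_lookup hA ht (hT _ (mem_rel.2 ⟨s, hs, hd, rfl⟩))

theorem names_of_getElem? {A : List AttrName} {T : List TupVar}
    (hT : ∀ x ∈ J.rel T, x.map Prod.fst = A) {i : ℕ} {t : TupVar} (hi : T[i]? = some t)
    (hd : J.del t = false) : (J.tup t).map Prod.fst = A :=
  hT _ (mem_rel.2 ⟨t, List.mem_of_getElem? hi, hd, rfl⟩)

section Pointwise

variable {p : Path} {k n : ℕ} {T : List TupVar}

theorem eval_projF {names : List AttrName} (hn : names.Nodup) {u : TupVar → List Term}
    {h : Tuple → Tuple} (hh : ∀ x, (h x).map Prod.fst = names)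
    (hu : ∀ t ∈ T, (u t).map (Term.eval J) = (h (J.tup t)).map Prod.snd)
    (hrow : ∀ i, J.row (.fresh p k i) = (h (J.rowAt T i).1, (J.rowAt T i).2)) :
    (projF names u T (freshTuples p k T.length)).eval J = true := by
  rw [projF, Formula.eval_all, forall_zipWith_fresh rfl]
  intro i t ht
  have hr := hrow i
  rw [Interp.rowAt_of_getElem? ht, Interp.row, Prod.mk.injEq] at hr
  rw [Formula.eval_and_true, Formula.eval_iff]
  refine ⟨eval_attrs_eq (by rw [hh]; exact hn) hr.1 (hu t (List.mem_of_getElem? ht)) (hh _), ?_⟩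
  simp [Formula.eval, hr.2]

theorem eval_aggF {names : List AttrName} (hn : names.Nodup) {us : List Term} {x : Tuple}
    (hx : x.map Prod.fst = names) (hus : us.map (Term.eval J) = x.map Prod.snd) {t' : TupVar}
    (hrow : J.row t' = (x, false)) : (aggF names us t').eval J = true := by
  rw [Interp.row, Prod.mk.injEq] at hrow
  rw [aggF, Formula.eval_and_true]
  refine ⟨eval_attrs_eq (by rw [hx]; exact hn) hrow.1 hus hx, ?_⟩
  simp [Formula.eval, hrow.2]

/-- The row of a selected tuple. -/
def filterRow (f : Tuple → Bool) (r : Row) : Row := (r.1, r.2 || !f r.1)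

theorem eval_filterF {A : List AttrName} {φ : TupVar → Term} {f : Tuple → Bool}
    (hn : T.length = n)
    (hφ : ∀ t ∈ T, J.del t = false → ((φ t).eval J = .bool true ↔ f (J.tup t) = true))
    (hrow : ∀ i, i < n → J.row (.fresh p k i) = filterRow f (J.rowAt T i)) :
    (filterF A φ T (freshTuples p k n)).eval J = true := by
  rw [filterF, Formula.eval_all, forall_zipWith_fresh hn]
  intro i t ht
  have hr := hrow i (hn ▸ (List.getElem?_eq_some_iff.1 ht).1)
  rw [Interp.rowAt_of_getElem? ht] at hr
  have hφ' := hφ t (List.mem_of_getElem? ht)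
  simp only [Formula.eval_and_true, Formula.eval_imp, Formula.eval_or_true, Formula.eval_not_true,
    Term.eval_isTrue, decide_eq_true_eq]
  cases hd : J.del t with
  | true =>
    simp [filterRow, Interp.row, hd] at hr
    simp [Formula.eval, hd, hr]
  | false =>
    rw [hφ' hd]
    cases hf : f (J.tup t) with
    | true =>
      refine ⟨fun _ => eval_copy_of_row ?_, ?_⟩
      · rw [hr]; simp [filterRow, hf, hd, Interp.row]
      · simp [Formula.eval, hd]
    | false =>
      simp [filterRow, Interp.row, hd, hf] at hr
      simp [Formula.eval, hd, hr]

theorem eval_copyAll {A : List AttrName} (hn : T.length = n)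
    (hrow : ∀ i, J.row (.fresh p k i) = J.rowAt T i) :
    (copyAll A A (freshTuples p k n) T).eval J = true := by
  rw [copyAll, zipWith_fresh_left, Formula.eval_all, forall_zipWith_fresh hn]
  intro i t ht
  apply eval_copy_of_row
  rw [hrow, Interp.rowAt_of_getElem? ht, Interp.row]

/-- The tuple `x` with attributes `A`, renamed. -/
def renameTuple (A : List AttrName) (r : AttrName → AttrName) (x : Tuple) : Tuple :=
  (restrict A x).map (fun nv => (r nv.1, nv.2))

theorem eval_copyAll_rename {A : List AttrName} {r : AttrName → AttrName} (hA : (A.map r).Nodup)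
    (hrow : ∀ i, J.row (.fresh p k i) =
      (renameTuple A r (J.rowAt T i).1, (J.rowAt T i).2)) :
    (copyAll (A.map r) A (freshTuples p k T.length) T).eval J = true := by
  rw [copyAll, zipWith_fresh_left, Formula.eval_all, forall_zipWith_fresh rfl]
  intro i t ht
  have hr := hrow i
  rw [Interp.rowAt_of_getElem? ht, Interp.row, Prod.mk.injEq] at hr
  rw [copy, Formula.eval_and_true, Formula.eval_iff]
  have hfst : (renameTuple A r (J.tup t)).map Prod.fst = A.map r := by
    simp [renameTuple, restrict, Function.comp_def]
  constructor
  · have := eval_attrs_eq (J := J) (x := renameTuple A r (J.tup t)) (t' := .fresh p k i)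
      (us := A.map (fun a => Term.attr a t)) (by rw [hfst]; exact hA) hr.1
      (by simp [renameTuple, restrict, Function.comp_def, Term.eval]) hfst
    rw [List.zipWith_map_right] at this
    exact this
  · simp [Formula.eval, hr.2]

theorem lv_rename {A : List AttrName} (hA : A.Nodup) {X : ℕ → Row}
    (hX : ∀ x ∈ lv n X, x.map Prod.fst = A) (r : AttrName → AttrName) :
    lv n (fun i => (renameTuple A r (X i).1, (X i).2)) =
      (lv n X).map (fun x => x.map (fun nv => (r nv.1, nv.2))) := by
  rw [lv_map n X (renameTuple A r)]
  apply List.map_congr_left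
  intro x hx
  rw [renameTuple, restrict_self hA (hX x hx)]

/-- The row at a position of a de-duplicated list. -/
def dedupRow (X : ℕ → Row) (i : ℕ) : Row := ((X i).1, (X i).2 || decide ((X i).1 ∈ lv i X))

theorem eval_dedupF {A : List AttrName} (hA : A.Nodup) (hn : T.length = n)
    (hT : ∀ x ∈ J.rel T, x.map Prod.fst = A)
    (hrow : ∀ i, J.row (.fresh p k i) = dedupRow (J.rowAt T) i) :
    (dedupF A T (freshTuples p k n)).eval J = true := by
  rw [dedupF, Formula.eval_all, forall_zipWith_fresh (by simpa using hn)]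
  rintro i ⟨t, j⟩ ht
  rw [List.getElem?_zipIdx, Option.map_eq_some_iff] at ht
  obtain ⟨t', ht, heq⟩ := ht
  simp only [Prod.mk.injEq, Nat.zero_add] at heq
  obtain ⟨rfl, rfl⟩ := heq
  have hr := hrow i
  have hi := (List.getElem?_eq_some_iff.1 ht).1
  rw [dedupRow, Interp.rowAt_of_getElem? ht, ← J.rel_take T hi.le] at hr
  simp only [Formula.eval_and_true, Formula.eval_imp, Formula.eval_not_true]
  cases hd : J.del t' with
  | true =>
    simp only [hd, Bool.true_or, Interp.row, Prod.mk.injEq] at hr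
    refine ⟨fun _ => by simp [Formula.eval, hr.2], fun _ => eval_copy_of_row ?_⟩
    simp [Interp.row, hr.1, hr.2, hd]
  | false =>
    rw [eval_memTuples hA (names_of_getElem? hT ht hd) (fun x hx => hT x (by
      obtain ⟨s, hs, h⟩ := mem_rel.1 hx
      exact mem_rel.2 ⟨s, List.mem_of_mem_take hs, h⟩))]
    simp only [hd, Bool.false_or, Interp.row, Prod.mk.injEq] at hr
    refine ⟨fun h => by simp [Formula.eval, hr.2, h], fun h => eval_copy_of_row ?_⟩
    simp [Interp.row, hr.1, hr.2, h, hd]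

theorem eval_interF {A : List AttrName} (hA : A.Nodup) (hn : T.length = n) {T₂ : List TupVar}
    (hT : ∀ x ∈ J.rel T, x.map Prod.fst = A) (hT₂ : ∀ x ∈ J.rel T₂, x.map Prod.fst = A)
    (hrow : ∀ i, i < n → J.row (.fresh p k i) =
      filterRow (fun x => decide (x ∈ J.rel T₂)) (J.rowAt T i)) :
    (interF A T T₂ (freshTuples p k n)).eval J = true := by
  rw [interF, Formula.eval_all, forall_zipWith_fresh hn]
  intro i t ht
  have hr := hrow i (hn ▸ (List.getElem?_eq_some_iff.1 ht).1)
  rw [filterRow, Interp.rowAt_of_getElem? ht] at hr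
  simp only [Formula.eval_and_true, Formula.eval_imp, Formula.eval_not_true]
  cases hd : J.del t with
  | true =>
    simp only [hd, Bool.true_or, Interp.row, Prod.mk.injEq] at hr
    refine ⟨fun _ => eval_copy_of_row ?_, fun _ => by simp [Formula.eval, hr.2]⟩
    simp [Interp.row, hr.1, hr.2, hd]
  | false =>
    rw [eval_memTuples hA (names_of_getElem? hT ht hd) hT₂]
    simp only [hd, Bool.false_or, Interp.row, Prod.mk.injEq] at hr
    refine ⟨fun h => eval_copy_of_row ?_, fun h => by simp [Formula.eval, hr.2, h]⟩
    simp [Interp.row, hr.1, hr.2, h, hd]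

theorem eval_diffF {A : List AttrName} (hA : A.Nodup) (hn : T.length = n) {T₂ : List TupVar}
    (hT : ∀ x ∈ J.rel T, x.map Prod.fst = A) (hT₂ : ∀ x ∈ J.rel T₂, x.map Prod.fst = A)
    (hrow : ∀ i, i < n → J.row (.fresh p k i) =
      filterRow (fun x => decide (x ∉ J.rel T₂)) (J.rowAt T i)) :
    (diffF A T T₂ (freshTuples p k n)).eval J = true := by
  rw [diffF, Formula.eval_all, forall_zipWith_fresh hn]
  intro i t ht
  have hr := hrow i (hn ▸ (List.getElem?_eq_some_iff.1 ht).1)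
  rw [filterRow, Interp.rowAt_of_getElem? ht] at hr
  simp only [Formula.eval_and_true, Formula.eval_imp, Formula.eval_not_true]
  cases hd : J.del t with
  | true =>
    simp only [hd, Bool.true_or, Interp.row, Prod.mk.injEq] at hr
    refine ⟨fun _ => eval_copy_of_row ?_, fun _ => by simp [Formula.eval, hr.2]⟩
    simp [Interp.row, hr.1, hr.2, hd]
  | false =>
    rw [eval_memTuples hA (names_of_getElem? hT ht hd) hT₂]
    simp only [hd, Bool.false_or, Interp.row, Prod.mk.injEq] at hr
    refine ⟨fun h => eval_copy_of_row ?_, fun h => by simp [Formula.eval, hr.2, h]⟩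
    simp [Interp.row, hr.1, hr.2, h, hd]

/-- The row at a position of a bag difference. -/
def diffRow (m : ℕ) (X Y : ℕ → Row) (i : ℕ) : Row :=
  ((X i).1, (X i).2 || (List.range m).any (fun j => greedy (rowMatch X Y) i j))

theorem eval_diffAllF {A : List AttrName} (hA : A.Nodup) (hn : T.length = n) {T₂ : List TupVar}
    (hT : ∀ x ∈ J.rel T, x.map Prod.fst = A) (hT₂ : ∀ x ∈ J.rel T₂, x.map Prod.fst = A) {k' : ℕ}
    (hrow : ∀ i, J.row (.fresh p k i) = diffRow T₂.length (J.rowAt T) (J.rowAt T₂) i)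
    (hpair : J.paired p k' = greedy (rowMatch (J.rowAt T) (J.rowAt T₂))) :
    (diffAllF A T T₂ (freshTuples p k n) p k').eval J = true := by
  rw [diffAllF, Formula.eval_and_true, Formula.eval_all, Formula.eval_all]
  constructor
  · simp only [List.mem_flatMap, forall_exists_index, and_imp, Prod.forall]
    intro F t i ht hF
    rw [List.mem_zipIdx_iff_getElem?] at ht
    refine (forall_zipIdx_map (l := T₂) _ (fun F => F.eval J = true)).2 ?_ F hF
    intro j s hs
    simp only [Formula.eval_iff, Formula.eval_and_true, Formula.eval_not_true, Formula.eval_all,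
      List.mem_map, List.mem_range, forall_exists_index, and_imp, forall_apply_eq_imp_iff₂]
    have hE : rowMatch (J.rowAt T) (J.rowAt T₂) i j = true ↔
        (¬ J.del t = true ∧ ¬ J.del s = true) ∧ (sameOn A t s).eval J = true := by
      rw [eval_sameOn]
      simp only [rowMatch, Interp.rowAt_of_getElem? ht, Interp.rowAt_of_getElem? hs,
        Bool.and_eq_true, Bool.not_eq_true', decide_eq_true_eq, Bool.not_eq_true]
      refine and_congr_right fun h => ?_
      rw [eq_of_lookup hA (names_of_getElem? hT ht h.1) (names_of_getElem? hT₂ hs h.2)]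
    simp only [Formula.eval, hpair]
    rw [greedy_iff, hE]
  · rw [forall_zipWith_fresh (by simpa using hn)]
    rintro i ⟨t, j⟩ ht
    rw [List.getElem?_zipIdx, Option.map_eq_some_iff] at ht
    obtain ⟨t', ht, heq⟩ := ht
    simp only [Prod.mk.injEq, Nat.zero_add] at heq
    obtain ⟨rfl, rfl⟩ := heq
    have hr := hrow i
    rw [diffRow, Interp.rowAt_of_getElem? ht, Interp.row, Prod.mk.injEq] at hr
    simp only [Formula.eval_and_true, Formula.eval_imp, Formula.eval_not_true, Formula.eval_all,
      Formula.eval_any, Formula.eval_or_true, List.mem_map, List.mem_range, forall_exists_index,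
      and_imp, forall_apply_eq_imp_iff₂, exists_exists_and_eq_and]
    simp only [Formula.eval, hpair]
    rw [hr.2]
    constructor
    · intro hd h
      apply eval_copy_of_row
      simp only [Bool.not_eq_true] at hd
      rw [Interp.row, Interp.row, hr.1, hr.2, hd]
      simp only [Bool.false_or, Prod.mk.injEq, true_and, List.any_eq_false, List.mem_range]
      exact h
    · intro h
      simpa using h

end Pointwise

end Operators

theorem lv_congr_live {n : ℕ} {X Y : ℕ → Row}
    (h : ∀ i < n, (X i).2 = (Y i).2 ∧ ((X i).2 = false → (X i).1 = (Y i).1)) :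
    lv n X = lv n Y := by
  induction n with
  | zero => rfl
  | succ n ih =>
    rw [lv_succ, lv_succ, ih (fun i hi => h i (by omega))]
    obtain ⟨h1, h2⟩ := h n (by omega)
    rw [← h1]
    cases hd : (X n).2
    · simp [h2 hd]
    · simp

section Operators

variable {J : Interp} {p : Path}

/-! ### Products and joins -/

section Joins

variable {T₁ T₂ : List TupVar} {A₁ A₂ : List AttrName}

theorem eval_prodF (hA : (A₁ ++ A₂).Nodup) (hT₁ : ∀ x ∈ J.rel T₁, x.map Prod.fst = A₁)
    {k : ℕ} (hrow : ∀ q, J.row (.fresh p k q) = prodRow T₂.length (J.rowAt T₁) (J.rowAt T₂) q) :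
    (prodF A₁ A₂ T₁ T₂ (fun i j => .fresh p k (i * T₂.length + j))).eval J = true := by
  rw [prodF, Formula.eval_all]
  simp only [List.mem_flatMap, forall_exists_index, and_imp, Prod.forall]
  intro F t i ht hF
  rw [List.mem_zipIdx_iff_getElem?] at ht
  refine (forall_zipIdx_map (l := T₂) _ (fun F => F.eval J = true)).2 ?_ F hF
  intro j s hs
  have hr := hrow (i * T₂.length + j)
  rw [prodRow_mul_add (List.getElem?_eq_some_iff.1 hs).1, Interp.rowAt_of_getElem? ht,
    Interp.rowAt_of_getElem? hs, Interp.row, Prod.mk.injEq] at hr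
  simp only [Formula.eval_and_true, Formula.eval_imp, Formula.eval_or_true, Formula.eval_not_true,
    eval_sameOn]
  simp only [Formula.eval, Bool.not_eq_true, hr.1, hr.2]
  refine ⟨?_, ?_⟩
  · rintro ⟨hd, he⟩
    have h1 := names_of_getElem? hT₁ ht hd
    refine ⟨⟨fun a ha => lookup_append_left (by rwa [h1]), fun a ha => lookup_append_right ?_⟩,
      by simp [hd, he]⟩
    rw [h1]
    exact fun h => (List.nodup_append.1 hA).2.2 a h a ha rfl
  · rintro (hd | hd) <;> simp [hd]

/-- The rows generated by a join. -/
def joinRow (A₁ A₂ : List AttrName) (f : Tuple → Bool) (n m : ℕ) (X Y : ℕ → Row) : ℕ → ℕ → Row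
  | 0, q => prodRow m X Y q
  | 1, q => filterRow f (prodRow m X Y q)
  | 2, i => (restrict A₁ (X i).1 ++ nullTuple A₂,
      (X i).2 || !(List.range m).all (fun j => (filterRow f (prodRow m X Y (i * m + j))).2))
  | _, j => (nullTuple A₁ ++ restrict A₂ (Y j).1,
      (Y j).2 || !(List.range n).all (fun i => (filterRow f (prodRow m X Y (i * m + j))).2))

theorem lookup_nullTuple_append (A : List AttrName) {y : Tuple} {a : AttrName}
    (ha : a ∈ A) : lookup (nullTuple A ++ y) a = .null := by
  rw [lookup_append_left (by rwa [map_fst_nullTuple]), lookup_nullTuple]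

theorem eval_leftF (hA : (A₁ ++ A₂).Nodup) {f : Tuple → Bool}
    (hrow : ∀ k q, J.row (.fresh p k q) =
      joinRow A₁ A₂ f T₁.length T₂.length (J.rowAt T₁) (J.rowAt T₂) k q) :
    (leftF A₁ A₂ T₁ T₂.length (fun i j => .fresh p 1 (i * T₂.length + j)) (.fresh p 2)).eval J =
      true := by
  rw [leftF, Formula.eval_all]
  rw [forall_zipIdx_map (l := T₁) _ (fun F => F.eval J = true)]
  intro i t ht
  have hr := hrow 2 i
  simp only [joinRow, Interp.row, Prod.mk.injEq, Interp.rowAt_of_getElem? ht] at hr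
  have hd : ∀ q, J.del (.fresh p 1 q) =
      (filterRow f (prodRow T₂.length (J.rowAt T₁) (J.rowAt T₂) q)).2 :=
    fun q => congrArg Prod.snd (hrow 1 q)
  simp only [Formula.eval_and_true, Formula.eval_iff, Formula.eval_not_true, eval_sameOn,
    eval_nullOn, Formula.eval_all, List.mem_map, List.mem_range, forall_exists_index, and_imp,
    forall_apply_eq_imp_iff₂]
  simp only [Formula.eval, hr.1, hr.2, hd]
  refine ⟨⟨fun a ha => ?_, fun a ha => ?_⟩, ?_⟩
  · rw [lookup_append_left (by rwa [map_fst_restrict]), lookup_restrict ha]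
  · rw [lookup_append_right, lookup_nullTuple]
    rw [map_fst_restrict]
    exact fun h => (List.nodup_append.1 hA).2.2 a h a ha rfl
  · simp

theorem eval_rightF (hA : (A₁ ++ A₂).Nodup) {f : Tuple → Bool}
    (hrow : ∀ k q, J.row (.fresh p k q) =
      joinRow A₁ A₂ f T₁.length T₂.length (J.rowAt T₁) (J.rowAt T₂) k q) :
    (rightF A₁ A₂ T₂ T₁.length (fun i j => .fresh p 1 (i * T₂.length + j)) (.fresh p 3)).eval J =
      true := by
  rw [rightF, Formula.eval_all]
  rw [forall_zipIdx_map (l := T₂) _ (fun F => F.eval J = true)]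
  intro j t ht
  have hr := hrow 3 j
  simp only [joinRow, Interp.row, Prod.mk.injEq, Interp.rowAt_of_getElem? ht] at hr
  have hd : ∀ q, J.del (.fresh p 1 q) =
      (filterRow f (prodRow T₂.length (J.rowAt T₁) (J.rowAt T₂) q)).2 :=
    fun q => congrArg Prod.snd (hrow 1 q)
  simp only [Formula.eval_and_true, Formula.eval_iff, Formula.eval_not_true, eval_sameOn,
    eval_nullOn, Formula.eval_all, List.mem_map, List.mem_range, forall_exists_index, and_imp,
    forall_apply_eq_imp_iff₂]
  simp only [Formula.eval, hr.1, hr.2, hd]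
  refine ⟨⟨fun a ha => lookup_nullTuple_append _ ha, fun a ha => ?_⟩, ?_⟩
  · rw [lookup_append_right, lookup_restrict ha]
    rw [map_fst_nullTuple]
    exact fun h => (List.nodup_append.1 hA).2.2 a h a ha rfl
  · simp

theorem lv_leftExt (hA : A₁.Nodup) {f : Tuple → Bool} {n m : ℕ} {X Y : ℕ → Row}
    (hX : ∀ x ∈ lv n X, x.map Prod.fst = A₁) :
    lv n (joinRow A₁ A₂ f n m X Y 2) =
      ((lv n X).filter (fun x => (lv m Y).all (fun y => !f (x ++ y)))).map
        (fun x => x ++ nullTuple A₂) := by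
  rw [← lv_filter, ← lv_map n _ (fun x => x ++ nullTuple A₂)]
  apply lv_congr_live
  intro i hi
  cases hd : (X i).2 with
  | true => simp [joinRow, hd]
  | false =>
    have hall : (List.range m).all (fun j => (filterRow f (prodRow m X Y (i * m + j))).2) =
        (lv m Y).all (fun y => !f ((X i).1 ++ y)) := by
      rw [Bool.eq_iff_iff, List.all_eq_true, List.all_eq_true]
      constructor
      · intro h y hy
        obtain ⟨j, hj, he, rfl⟩ := mem_lv.1 hy
        simpa [filterRow, prodRow_mul_add hj, hd, he] using h j (List.mem_range.2 hj)
      · intro h j hj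
        have hj := List.mem_range.1 hj
        rw [filterRow, prodRow_mul_add hj]
        cases he : (Y j).2 with
        | true => simp
        | false => simpa [hd] using h _ (mem_lv.2 ⟨j, hj, he, rfl⟩)
    refine ⟨?_, fun _ => ?_⟩
    · simp only [joinRow, hall, hd]
    · simp only [joinRow, restrict_self hA (hX _ (mem_lv.2 ⟨i, hi, hd, rfl⟩))]

theorem lv_rightExt (hA : A₂.Nodup) {f : Tuple → Bool} {n m : ℕ} {X Y : ℕ → Row}
    (hY : ∀ y ∈ lv m Y, y.map Prod.fst = A₂) :
    lv m (joinRow A₁ A₂ f n m X Y 3) =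
      ((lv m Y).filter (fun y => (lv n X).all (fun x => !f (x ++ y)))).map
        (fun y => nullTuple A₁ ++ y) := by
  rw [← lv_filter, ← lv_map m _ (fun y => nullTuple A₁ ++ y)]
  apply lv_congr_live
  intro j hj
  cases hd : (Y j).2 with
  | true => simp [joinRow, hd]
  | false =>
    have hall : (List.range n).all (fun i => (filterRow f (prodRow m X Y (i * m + j))).2) =
        (lv n X).all (fun x => !f (x ++ (Y j).1)) := by
      rw [Bool.eq_iff_iff, List.all_eq_true, List.all_eq_true]
      constructor
      · intro h y hy
        obtain ⟨i, hi, he, rfl⟩ := mem_lv.1 hy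
        simpa [filterRow, prodRow_mul_add hj, hd, he] using h i (List.mem_range.2 hi)
      · intro h i hi
        have hi := List.mem_range.1 hi
        rw [filterRow, prodRow_mul_add hj]
        cases he : (X i).2 with
        | true => simp
        | false => simpa [hd] using h _ (mem_lv.2 ⟨i, hi, he, rfl⟩)
    refine ⟨?_, fun _ => ?_⟩
    · simp only [joinRow, hall, hd]
    · simp only [joinRow, restrict_self hA (hY _ (mem_lv.2 ⟨j, hj, hd, rfl⟩))]

theorem eval_joinF (kind : JoinKind) (hA : (A₁ ++ A₂).Nodup)
    (hT₁ : ∀ x ∈ J.rel T₁, x.map Prod.fst = A₁)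
    {φ : TupVar → Term} {f : Tuple → Bool}
    (hφ : ∀ t, J.del t = false → ((φ t).eval J = .bool true ↔ f (J.tup t) = true))
    (hrow : ∀ k q, J.row (.fresh p k q) =
      joinRow A₁ A₂ f T₁.length T₂.length (J.rowAt T₁) (J.rowAt T₂) k q) :
    (joinF kind A₁ A₂ φ T₁ T₂ p).eval J = true := by
  have hi : (Formula.and (prodF A₁ A₂ T₁ T₂ (fun i j => .fresh p 0 (i * T₂.length + j)))
      (filterF (A₁ ++ A₂) φ (freshTuples p 0 (T₁.length * T₂.length))
        (freshTuples p 1 (T₁.length * T₂.length)))).eval J = true := by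
    rw [Formula.eval_and_true]
    refine ⟨eval_prodF hA hT₁ (hrow 0), eval_filterF (f := f) (by simp)
      (fun t _ => hφ t) (fun q hq => ?_)⟩
    rw [Interp.rowAt_fresh hq, hrow, hrow]
    rfl
  have hl := eval_leftF hA hrow
  have hr := eval_rightF hA hrow
  cases kind <;> simp only [joinF, Formula.eval_and_true]
  · exact (Formula.eval_and_true _ _ _).1 hi
  · exact ⟨(Formula.eval_and_true _ _ _).1 hi, hl⟩
  · exact ⟨(Formula.eval_and_true _ _ _).1 hi, hr⟩
  · exact ⟨⟨(Formula.eval_and_true _ _ _).1 hi, hl⟩, hr⟩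

theorem rel_join (hA : (A₁ ++ A₂).Nodup)
    (hT₁ : ∀ x ∈ J.rel T₁, x.map Prod.fst = A₁) (hT₂ : ∀ x ∈ J.rel T₂, x.map Prod.fst = A₂)
    {f : Tuple → Bool}
    (hrow : ∀ k q, J.row (.fresh p k q) =
      joinRow A₁ A₂ f T₁.length T₂.length (J.rowAt T₁) (J.rowAt T₂) k q) :
    J.rel (freshTuples p 1 (T₁.length * T₂.length)) = (cross (J.rel T₁) (J.rel T₂)).filter f ∧
    J.rel (freshTuples p 2 T₁.length) =
      ((J.rel T₁).filter (fun x => (J.rel T₂).all (fun y => !f (x ++ y)))).map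
        (fun x => x ++ nullTuple A₂) ∧
    J.rel (freshTuples p 3 T₂.length) =
      ((J.rel T₂).filter (fun y => (J.rel T₁).all (fun x => !f (x ++ y)))).map
        (fun y => nullTuple A₁ ++ y) := by
  have hn := List.nodup_append.1 hA
  rw [J.rel_fresh, J.rel_fresh, J.rel_fresh]
  simp only [hrow]
  simp only [J.rel_eq_lv T₁, J.rel_eq_lv T₂] at hT₁ hT₂ ⊢
  refine ⟨?_, lv_leftExt hn.1 hT₁, lv_rightExt hn.2.1 hT₂⟩
  rw [← lv_prod, ← lv_filter]
  rfl

end Joins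

/-! ### Grouping -/

section Groups

variable {T : List TupVar}

theorem Interp.grel_zipIdx (J : Interp) (T : List TupVar) (c : ℕ → Formula) :
    J.grel (T.zipIdx.map (fun ti => (c ti.2, ti.1))) =
      lv T.length (fun i => ((J.rowAt T i).1, !((c i).eval J && !(J.rowAt T i).2))) := by
  have key : ∀ n ≤ T.length, J.grel ((T.zipIdx.take n).map (fun ti => (c ti.2, ti.1))) =
      lv n (fun i => ((J.rowAt T i).1, !((c i).eval J && !(J.rowAt T i).2))) := by
    intro n
    induction n with
    | zero => intro _; simp [Interp.grel]
    | succ n ih =>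
      intro hn
      rw [lv_succ, ← ih (by omega), List.take_succ_eq_append_getElem (by simpa using hn),
        Interp.rowAt_of_getElem? (List.getElem?_eq_getElem (by omega)), List.map_append]
      simp only [Interp.grel, List.filter_append, List.map_append]
      congr 1
      simp only [List.getElem_zipIdx, Nat.zero_add, List.map_cons, List.map_nil]
      cases hl : J.live (c n, T[n]) <;>
        (have hl' : ((c n).eval J && !J.del T[n]) = _ := hl) <;> simp [hl, hl']
  have := key T.length le_rfl
  rwa [List.take_of_length_le (by simp)] at this

theorem grel_groupMembers {κ : Tuple → List Value}
    (hg : J.grp p = inGroup κ (J.rowAt T)) {k : ℕ} (hk : lead κ (J.rowAt T) k = true) :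
    J.grel (groupMembers p T k) =
      (J.rel T).filter (fun z => decide (κ z = κ (J.rowAt T k).1)) := by
  rw [groupMembers, J.grel_zipIdx T (fun i => .grp p i k), J.rel_eq_lv, ← lv_group hk]
  simp only [Formula.eval, hg]

theorem headOK_groupMembers {κ : Tuple → List Value}
    (hg : J.grp p = inGroup κ (J.rowAt T)) (k : ℕ) :
    HeadOK J (groupMembers p T k) (J.grel (groupMembers p T k)) := by
  apply headOK_grel
  rintro ⟨c, t⟩ hct hc
  simp only [groupMembers, List.mem_map, Prod.mk.injEq, Prod.exists] at hct
  obtain ⟨t', i, hti, rfl, rfl⟩ := hct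
  have hi := List.mem_zipIdx_iff_getElem?.1 hti
  simp only [Formula.eval, hg, inGroup, Bool.and_eq_true, Bool.not_eq_true',
    J.rowAt_of_getElem? hi] at hc
  exact hc.1.1.1

theorem eval_groupF {names : List AttrName} (hn : names.Nodup) {κ : Tuple → List Value} {l : ℕ}
    (hκ : ∀ x, (κ x).length = l) {keys : TupVar → List Term}
    (hkeys : ∀ t ∈ T, J.del t = false → (keys t).map (Term.eval J) = κ (J.tup t))
    {h : Relation → Tuple} (hh : ∀ xs, (h xs).map Prod.fst = names) {L : GTuples → List Term}
    (hL : ∀ G, HeadOK J G (J.grel G) → (L G).map (Term.eval J) = (h (J.grel G)).map Prod.snd)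
    {f : Relation → Bool} {φ : GTuples → Term}
    (hφ : ∀ G, HeadOK J G (J.grel G) → ((φ G).eval J = .bool true ↔ f (J.grel G) = true))
    (hg : J.grp p = inGroup κ (J.rowAt T))
    (hrow : ∀ k, J.row (.fresh p 0 k) =
      (h ((J.rel T).filter (fun z => decide (κ z = κ (J.rowAt T k).1))),
        !(lead κ (J.rowAt T) k &&
          f ((J.rel T).filter (fun z => decide (κ z = κ (J.rowAt T k).1)))))) :
    (groupF names keys L φ T (freshTuples p 0 T.length) p).eval J = true := by
  rw [groupF, Formula.eval_and_true, Formula.eval_all, Formula.eval_all]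
  constructor
  · rw [forall_zipIdx_map (l := T) _ (fun F => F.eval J = true)]
    intro i t ht
    rw [Formula.eval_and_true, Formula.eval_and_true, Formula.eval_all, Formula.eval_all]
    refine ⟨?_, ?_, ?_⟩
    · have hs := sum_inGroup κ (J.rowAt T) i
      rw [J.rowAt_of_getElem? ht] at hs
      rw [Formula.eval_eq_true, Term.eval_sum, List.map_map]
      have : (fun x => (Term.eval J x).num) ∘
          (fun j => Term.ite (.grp p i j) (.int 1) (.int 0)) =
          fun j => if inGroup κ (J.rowAt T) i j then (1 : ℤ) else 0 := by
        funext j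
        simp only [Function.comp, Term.eval, Formula.eval, hg]
        split <;> simp [Value.num]
      rw [this, hs]
      simp only [Term.eval, Formula.eval]
      split <;> rename_i hd <;> simp [hd]
    · intro F hF
      obtain ⟨⟨s, j⟩, hsj, rfl⟩ := List.mem_map.1 hF
      have hj : T[j]? = some s := List.mem_zipIdx_iff_getElem?.1 (List.mem_of_mem_take hsj)
      have hji : j < i := by
        obtain ⟨m, hm⟩ := List.mem_iff_getElem?.1 hsj
        rw [List.getElem?_take] at hm
        split at hm
        · rw [List.getElem?_zipIdx, Option.map_eq_some_iff] at hm
          obtain ⟨_, _, hm⟩ := hm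
          simp only [Prod.mk.injEq] at hm
          omega
        · simp at hm
      simp only [Formula.eval_iff, Formula.eval_and_true, Formula.eval_not_true, Formula.eval_all]
      simp only [Formula.eval, hg]
      rw [inGroup_of_lt hji, J.rowAt_of_getElem? ht, J.rowAt_of_getElem? hj]
      simp only [Bool.not_eq_true]
      refine and_congr_right fun hd => and_congr_right fun hjj => ?_
      have he : J.del s = false := by
        rw [inGroup_self] at hjj
        simp only [lead, Bool.and_eq_true, Bool.not_eq_true', J.rowAt_of_getElem? hj] at hjj
        exact hjj.1
      rw [← hkeys t (List.mem_of_getElem? ht) hd, ← hkeys s (List.mem_of_getElem? hj) he]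
      have hlen : (keys t).length = (keys s).length := by
        have h1 := congrArg List.length (hkeys t (List.mem_of_getElem? ht) hd)
        have h2 := congrArg List.length (hkeys s (List.mem_of_getElem? hj) he)
        rw [List.length_map, hκ] at h1 h2
        rw [h1, h2]
      generalize keys t = us, keys s = vs at hlen
      clear hF hsj
      induction us generalizing vs with
      | nil => cases vs with
        | nil => simp
        | cons v vs => simp at hlen
      | cons u us ih => cases vs with
        | nil => simp at hlen
        | cons v vs =>
          have ih' := ih vs (by simpa using hlen)
          rw [List.map_cons, List.map_cons, List.cons.injEq]
          simp only [List.zipWith_cons_cons, List.mem_cons, forall_eq_or_imp, Formula.eval_eq_true]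
          exact and_congr_right fun _ => ih'
    · intro F hF
      obtain ⟨⟨s, j⟩, hsj, rfl⟩ := List.mem_map.1 hF
      have hij : i < j := by
        obtain ⟨m, hm⟩ := List.mem_iff_getElem?.1 hsj
        rw [List.getElem?_drop, List.getElem?_zipIdx, Option.map_eq_some_iff] at hm
        obtain ⟨_, _, hm⟩ := hm
        simp only [Prod.mk.injEq] at hm
        omega
      simp [Formula.eval, hg, inGroup_of_gt hij]
  · rw [forall_zipIdx_map (l := freshTuples p 0 T.length) _ (fun F => F.eval J = true)]
    intro k t' ht'
    have hk : k < T.length := by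
      have := (List.getElem?_eq_some_iff.1 ht').1
      simpa using this
    rw [getElem?_freshTuples hk, Option.some.injEq] at ht'
    subst ht'
    have hr := hrow k
    simp only [Interp.row, Prod.mk.injEq] at hr
    simp only [Formula.eval_and_true, Formula.eval_imp, Formula.eval_or_true,
      Formula.eval_not_true, Term.isTrue, Formula.eval_eq_true]
    have hgk : (Formula.grp p k k).eval J = lead κ (J.rowAt T) k := by
      rw [← inGroup_self]; simp only [Formula.eval, hg]
    rw [hgk]
    have hlive : lead κ (J.rowAt T) k = true →
        ((φ (groupMembers p T k)).eval J = .bool true ↔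
          f ((J.rel T).filter (fun z => decide (κ z = κ (J.rowAt T k).1))) = true) := by
      intro hl
      have := hφ _ (headOK_groupMembers hg k)
      rwa [grel_groupMembers hg hl] at this
    have hconst : (Term.const (.bool true)).eval J = .bool true := by simp [Term.eval]
    rw [hconst]
    constructor
    · rintro ⟨hl, hf⟩
      rw [hlive hl] at hf
      refine ⟨by simp [Formula.eval, hr.2, hl, hf], ?_⟩
      refine eval_attrs_eq (by rw [hh]; exact hn) hr.1 ?_ (hh _)
      have := hL _ (headOK_groupMembers hg k)
      rwa [grel_groupMembers hg hl] at this
    · intro hor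
      simp only [Formula.eval, hr.2]
      cases hl : lead κ (J.rowAt T) k with
      | false => simp
      | true =>
        rw [hlive hl, hl] at hor
        simpa using hor

end Groups

end Operators

/-! ### Moving the deleted rows to the end -/

/-- The positions of the rows, the deleted ones at the end. -/
def moveList (n : ℕ) (X : ℕ → Row) : List ℕ :=
  (List.range n).filter (fun i => !(X i).2) ++ (List.range n).filter (fun i => (X i).2)

def moveRow (n : ℕ) (X : ℕ → Row) (i : ℕ) : Row := X ((moveList n X).getD i 0)

/-- The number of rows that are not deleted. -/
def liveCount (n : ℕ) (X : ℕ → Row) : ℕ := ((List.range n).filter (fun i => !(X i).2)).length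

theorem getElem?_filter_range {c : ℕ → Bool} {n k : ℕ} (hk : k < n) (hc : c k = true) :
    ((List.range n).filter c)[((List.range k).filter c).length]? = some k := by
  obtain ⟨m, rfl⟩ : ∃ m, n = k + (m + 1) := ⟨n - k - 1, by omega⟩
  rw [List.range_add, List.filter_append, List.getElem?_append_right le_rfl, Nat.sub_self,
    List.range_succ_eq_map, List.map_cons, Nat.add_zero, List.filter_cons_of_pos hc]
  rfl

theorem getElem?_moveList {n k : ℕ} (hk : k < n) (X : ℕ → Row) :
    (moveList n X)[if (X k).2 then
        liveCount n X + ((List.range k).filter (fun i => (X i).2)).length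
      else ((List.range k).filter (fun i => !(X i).2)).length]? = some k := by
  cases hd : (X k).2 with
  | true =>
    rw [if_pos rfl, moveList, liveCount, List.getElem?_append_right (Nat.le_add_right _ _),
      Nat.add_sub_cancel_left]
    exact getElem?_filter_range (c := fun i => (X i).2) hk hd
  | false =>
    have h := getElem?_filter_range (c := fun i => !(X i).2) hk (by simp [hd])
    rw [if_neg (by simp), moveList, List.getElem?_append_left (List.getElem?_eq_some_iff.1 h).1]
    exact h

theorem length_moveList (n : ℕ) (X : ℕ → Row) : (moveList n X).length = n := by
  have := List.length_eq_length_filter_add (l := List.range n) (fun i => (X i).2)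
  simp only [List.length_range] at this
  simp only [moveList, List.length_append]
  omega

theorem liveCount_le (n : ℕ) (X : ℕ → Row) : liveCount n X ≤ n := by
  have := List.length_filter_le (fun i => !(X i).2) (List.range n)
  simpa [liveCount] using this

theorem moveRow_del_iff {n i : ℕ} (hi : i < n) (X : ℕ → Row) :
    (moveRow n X i).2 = false ↔ i < liveCount n X := by
  have hlen := length_moveList n X
  have hget : (moveList n X)[i]? = some ((moveList n X).getD i 0) := by
    rw [List.getD_eq_getElem _ _ (by omega), List.getElem?_eq_getElem]
  unfold moveRow
  generalize (moveList n X).getD i 0 = j at hget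
  rw [moveList] at hget
  by_cases h : i < liveCount n X
  · rw [List.getElem?_append_left h] at hget
    have := (List.mem_filter.1 (List.mem_of_getElem? hget)).2
    simpa [h] using this
  · rw [List.getElem?_append_right (Nat.le_of_not_lt h)] at hget
    have := (List.mem_filter.1 (List.mem_of_getElem? hget)).2
    simpa [h] using this

theorem map_moveRow (n : ℕ) (X : ℕ → Row) :
    (List.range (liveCount n X)).map (fun i => (moveRow n X i).1) = lv n X := by
  have h1 : lv n X = ((List.range n).filter (fun i => !(X i).2)).map (fun i => (X i).1) := by
    induction n with
    | zero => rfl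
    | succ n ih =>
      rw [lv_succ, ih, List.range_succ, List.filter_append, List.map_append]
      cases hd : (X n).2 <;> simp [hd]
  rw [h1]
  apply List.ext_getElem?
  intro i
  rw [List.getElem?_map, List.getElem?_map]
  by_cases hi : i < liveCount n X
  · rw [List.getElem?_range hi, List.getElem?_eq_getElem (show i < _ from hi)]
    simp only [Option.map_some, moveRow, moveList]
    rw [List.getD_eq_getElem _ _ (by rw [List.length_append]; exact Nat.lt_add_right _ hi),
      List.getElem_append_left hi]
    rfl
  · rw [List.getElem?_eq_none (by simpa using hi),
      List.getElem?_eq_none (show _ ≤ i from Nat.le_of_not_lt hi)]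
    rfl

/-- The requirements on the function `find` that sorts the moved rows into the list `s`. -/
structure IsFind (n : ℕ) (X : ℕ → Row) (s : Relation) (find : ℕ → ℕ) : Prop where
  perm : ((List.range n).map find).Perm (List.range n)
  del : ∀ i < n, (moveRow n X (find i)).2 = (moveRow n X i).2
  eq : lv n (fun i => moveRow n X (find i)) = s

theorem exists_isFind (n : ℕ) (X : ℕ → Row) {s : Relation} (hs : s.Perm (lv n X)) :
    ∃ find, IsFind n X s find := by
  rw [← map_moveRow] at hs
  obtain ⟨w, hw, hsw⟩ := exists_perm_of_perm_map hs
  set l := liveCount n X with hl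
  have hln : l ≤ n := liveCount_le n X
  have hwl : w.length = l := by simpa using hw.length_eq
  set F := w ++ (List.range (n - l)).map (l + ·) with hF
  have hFlen : F.length = n := by simp [hF, hwl]; omega
  have hFp : F.Perm (List.range n) := by
    have : List.range n = List.range l ++ (List.range (n - l)).map (l + ·) := by
      rw [← List.range_add]; congr 1; omega
    rw [this]
    exact hw.append_right _
  have hmap : (List.range n).map (fun i => F.getD i 0) = F := by
    apply List.ext_getElem (by simp [hFlen])
    intro i h1 h2
    simp [List.getElem?_eq_getElem h2]
  have hlt : ∀ i < n, F.getD i 0 < n := by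
    intro i hi
    have : F.getD i 0 ∈ F := by
      rw [List.getD_eq_getElem _ _ (by omega)]; exact List.getElem_mem _
    exact List.mem_range.1 (hFp.mem_iff.1 this)
  have hdel : ∀ i < n, F.getD i 0 < l ↔ i < l := by
    intro i hi
    rw [List.getD_eq_getElem _ _ (by omega)]
    by_cases hil : i < l
    · have : F[i]'(by omega) ∈ w := by
        simp only [hF]
        rw [List.getElem_append_left (by omega)]
        exact List.getElem_mem _
      simpa [hil] using hw.mem_iff.1 this
    · simp only [hF]
      rw [List.getElem_append_right (by omega)]
      simp [hil]
  refine ⟨fun i => F.getD i 0, ?_, ?_, ?_⟩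
  · rw [hmap]; exact hFp
  · intro i hi
    have h1 := moveRow_del_iff (hlt i hi) X
    have h2 := moveRow_del_iff hi X
    rw [← hl] at h1 h2
    rw [hdel i hi, ← h2] at h1
    rw [Bool.eq_iff_iff]
    rw [← not_iff_not]
    simpa using h1
  · have h1 : lv n (fun i => moveRow n X (F.getD i 0)) =
        F.flatMap (fun j => if (moveRow n X j).2 then [] else [(moveRow n X j).1]) := by
      conv_rhs => rw [← hmap]
      rw [lv, List.flatMap_map]
    rw [h1, hF, List.flatMap_append, hsw]
    have h2 : w.flatMap (fun j => if (moveRow n X j).2 then [] else [(moveRow n X j).1]) =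
        w.map (fun j => (moveRow n X j).1) := by
      rw [List.map_eq_flatMap, List.flatMap_def, List.flatMap_def]
      congr 1
      apply List.map_congr_left
      intro j hj
      have hjl := List.mem_range.1 (hw.mem_iff.1 hj)
      rw [(moveRow_del_iff (by omega) X).2 hjl]
      simp
    have h3 : ((List.range (n - l)).map (l + ·)).flatMap
        (fun j => if (moveRow n X j).2 then [] else [(moveRow n X j).1]) = [] := by
      rw [List.flatMap_eq_nil_iff]
      intro j hj
      obtain ⟨i, hi, rfl⟩ := List.mem_map.1 hj
      have hi := List.mem_range.1 hi
      have := (moveRow_del_iff (n := n) (i := l + i) (by omega) X).not.2 (by omega)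
      simp only [Bool.not_eq_false] at this
      simp [this]
    rw [h2, h3, List.append_nil]

theorem pairwise_lv {R : Tuple → Tuple → Prop} {n : ℕ} {Z : ℕ → Row}
    (h : (lv n Z).Pairwise R) {i j : ℕ} (hij : i < j) (hj : j < n) (hi' : (Z i).2 = false)
    (hj' : (Z j).2 = false) : R (Z i).1 (Z j).1 := by
  induction n with
  | zero => omega
  | succ n ih =>
    rw [lv_succ, List.pairwise_append] at h
    by_cases hjn : j = n
    · subst hjn
      exact h.2.2 _ (mem_lv.2 ⟨i, hij, hi', rfl⟩) _ (by simp [hj'])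
    · exact ih h.1 (by omega)

/-! ### Truth of the encoding of `OrderBy` -/

section OrderBy

variable {J : Interp} {p : Path} {A : List AttrName} {T : List TupVar}

theorem sum_map_indicator (c : ℕ → Bool) (l : List ℕ) :
    (l.map (fun i => if c i then (1 : ℤ) else 0)).sum = ((l.filter c).length : ℤ) := by
  induction l with
  | nil => rfl
  | cons a l ih =>
    rw [List.map_cons, List.sum_cons, ih]
    cases h : c a
    · simp [h]
    · simp [h, add_comm]

theorem sum_take_rowAt (J : Interp) (T : List TupVar) (g : Bool → ℤ) {k : ℕ} (hk : k ≤ T.length) :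
    ((T.take k).map (fun s => g (J.del s))).sum =
      ((List.range k).map (fun i => g (J.rowAt T i).2)).sum := by
  induction k with
  | zero => rfl
  | succ k ih =>
    rw [List.take_succ_eq_append_getElem (by omega), List.range_succ, List.map_append,
      List.map_append, List.sum_append, List.sum_append, ih (by omega), List.map_singleton,
      List.map_singleton, J.rowAt_of_getElem? (List.getElem?_eq_getElem (by omega))]

theorem Term.eval_ite (c : Formula) (x y : Term) :
    (Term.ite c x y).eval J = if c.eval J = true then x.eval J else y.eval J := by
  simp only [Term.eval]

theorem Formula.eval_del (t : TupVar) : (Formula.del t).eval J = J.del t := by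
  simp only [Formula.eval]

theorem eval_posTerm {k : ℕ} {t : TupVar} (ht : T[k]? = some t) :
    (posTerm T k t).eval J = .int ((if (J.rowAt T k).2 then
        liveCount T.length (J.rowAt T) +
          ((List.range k).filter (fun i => (J.rowAt T i).2)).length
      else ((List.range k).filter (fun i => !(J.rowAt T i).2)).length : ℕ) : ℤ) := by
  have hk := (List.getElem?_eq_some_iff.1 ht).1
  have hdels : ∀ m ≤ T.length, (Term.sum ((T.take m).map
      (fun s => Term.ite (.del s) (.int 1) (.int 0)))).eval J =
      .int (((List.range m).filter (fun i => (J.rowAt T i).2)).length : ℤ) := by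
    intro m hm
    rw [Term.eval_sum, List.map_map, ← sum_map_indicator]
    have := sum_take_rowAt J T (fun b => if b then 1 else 0) hm
    rw [← this]
    congr 2
    apply List.map_congr_left
    intro s _
    by_cases hd : J.del s = true <;>
      simp [Term.eval_ite, Formula.eval_del, hd, Value.num]
  have hlives : ∀ m ≤ T.length, (Term.sum ((T.take m).map
      (fun s => Term.ite (.del s) (.int 0) (.int 1)))).eval J =
      .int (((List.range m).filter (fun i => !(J.rowAt T i).2)).length : ℤ) := by
    intro m hm
    rw [Term.eval_sum, List.map_map, ← sum_map_indicator]
    have := sum_take_rowAt J T (fun b => if !b then 1 else 0) hm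
    rw [← this]
    congr 2
    apply List.map_congr_left
    intro s _
    by_cases hd : J.del s = true <;>
      simp [Term.eval_ite, Formula.eval_del, hd, Value.num]
  have hall := hlives T.length le_rfl
  rw [List.take_length] at hall
  have hadd : ∀ x y : Term, (Term.arith .add x y).eval J =
      .int ((x.eval J).num + (y.eval J).num) := fun x y => by simp only [Term.eval, ArithOp.eval]
  simp only [posTerm, Term.eval_ite, Formula.eval_del, hadd, hall, hdels k hk.le, hlives k hk.le]
  rw [J.rowAt_of_getElem? ht]
  by_cases hd : J.del t = true <;> simp [hd, Value.num, liveCount]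

theorem eval_moveDelToEndF {k₀ : ℕ}
    (hrow : ∀ i, J.row (.fresh p k₀ i) = moveRow T.length (J.rowAt T) i) :
    (moveDelToEndF A T (freshTuples p k₀ T.length)).eval J = true := by
  rw [moveDelToEndF, Formula.eval_all]
  simp only [List.mem_flatMap, forall_exists_index, and_imp, Prod.forall]
  intro F t k ht hF
  rw [List.mem_zipIdx_iff_getElem?] at ht
  refine (forall_zipIdx_map (l := freshTuples p k₀ T.length) _ (fun F => F.eval J = true)).2 ?_ F hF
  intro i t' ht'
  have hi := (List.getElem?_eq_some_iff.1 ht').1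
  rw [length_freshTuples] at hi
  rw [getElem?_freshTuples hi, Option.some.injEq] at ht'
  subst ht'
  rw [Formula.eval_imp, Formula.eval_eq_true, eval_posTerm ht]
  intro h
  have hk := (List.getElem?_eq_some_iff.1 ht).1
  have hpos := getElem?_moveList hk (J.rowAt T)
  simp only [Term.eval_int, Value.int.injEq, Nat.cast_inj] at h
  rw [h] at hpos
  apply eval_copy_of_row
  rw [hrow, moveRow, List.getD_eq_getElem?_getD, hpos, Option.getD_some, J.rowAt_of_getElem? ht,
    Interp.row]

theorem rank_lt_iff (x y : Value) : x.rank < y.rank ↔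
    x = .null ∧ y ≠ .null ∨ (x ≠ .null ∧ y ≠ .null) ∧ x.num < y.num := by
  rcases x with _ | x | x <;> rcases y with _ | y | y <;>
    simp only [Value.rank, WithBot.coe_lt_coe, WithBot.bot_lt_coe, not_lt_bot, ne_eq,
      not_true_eq_false, and_false, false_and, or_false, and_true, not_false_eq_true, true_and,
      reduceCtorEq, false_or, lt_self_iff_false]

theorem eval_keyLt (x y : Term) :
    (keyLt x y).eval J = true ↔ (x.eval J).rank < (y.eval J).rank := by
  rw [rank_lt_iff]
  simp only [keyLt, Formula.eval_or_true, Formula.eval_and_true, Formula.eval_not_true,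
    Term.isNull, Formula.eval_eq_true, Term.eval_nil]
  simp only [Formula.eval, CmpOp.eval, decide_eq_true_eq]

theorem eval_lexLt (us vs : List Term) (h : us.length = vs.length) :
    (lexLt us vs).eval J = true ↔
      ranks (us.map (Term.eval J)) < ranks (vs.map (Term.eval J)) := by
  induction us generalizing vs with
  | nil =>
    cases vs with
    | nil => simp [lexLt, Formula.eval, ranks]
    | cons v vs => simp at h
  | cons u us ih =>
    cases vs with
    | nil => simp at h
    | cons v vs =>
      have ih' := ih vs (by simpa using h)
      rw [lexLt, Formula.eval_or_true, Formula.eval_and_true, Formula.eval_not_true, eval_keyLt,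
        eval_keyLt, ih']
      simp only [ranks, List.map_cons, List.cons_lt_cons_iff]
      constructor
      · rintro (h | ⟨h, h'⟩)
        · exact Or.inl h
        · rcases lt_trichotomy (u.eval J).rank (v.eval J).rank with h1 | h1 | h1
          · exact Or.inl h1
          · exact Or.inr ⟨h1, h'⟩
          · exact absurd h1 h
      · rintro (h | ⟨h, h'⟩)
        · exact Or.inl h
        · exact Or.inr ⟨by rw [h]; exact lt_irrefl _, h'⟩

theorem eval_findF {n : ℕ} {X : ℕ → Row} {s : Relation} {κ : Tuple → List Value} {l : ℕ}
    (hκ : ∀ x, (κ x).length = l) {asc : Bool}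
    (hs : s.Pairwise (fun x y => keyLE asc (κ x) (κ y))) (hfind : IsFind n X s (J.find p))
    {keys : TupVar → List Term}
    (hkeys : ∀ t, J.del t = false → (keys t).map (Term.eval J) = κ (J.tup t))
    {k₀ k₁ : ℕ} (hrow₀ : ∀ i, J.row (.fresh p k₀ i) = moveRow n X i)
    (hrow₁ : ∀ i, J.row (.fresh p k₁ i) = moveRow n X (J.find p i)) :
    (findF A keys asc (freshTuples p k₀ n) (freshTuples p k₁ n) p).eval J = true := by
  simp only [findF, Formula.eval_and_true, Formula.eval_all, length_freshTuples]
  refine ⟨?_, ?_, ?_⟩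
  · simp only [List.mem_map, List.mem_range, forall_exists_index, and_imp,
      forall_apply_eq_imp_iff₂]
    intro k hk
    rw [Formula.eval_eq_true, Term.eval_sum, List.map_map, Term.eval_int]
    congr 1
    have h1 : (List.range n).map ((fun x => (Term.eval J x).num) ∘
        fun i => Term.ite (.findEq p i k) (.int 1) (.int 0)) =
        (List.range n).map (fun i => if decide (J.find p i = k) then (1 : ℤ) else 0) := by
      apply List.map_congr_left
      intro i _
      simp only [Function.comp, Term.eval, Formula.eval]
      split <;> simp_all [Value.num]
    have h2 : ((List.range n).map (J.find p)).count k = 1 := by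
      rw [hfind.perm.count_eq]
      exact List.count_eq_one_of_mem List.nodup_range (List.mem_range.2 hk)
    rw [h1, sum_map_indicator, ← List.countP_eq_length_filter]
    rw [List.count, List.countP_map] at h2
    have h3 : List.countP (fun i => decide (J.find p i = k)) (List.range n) =
        List.countP ((fun x => x == k) ∘ J.find p) (List.range n) := by
      congr 1
    rw [h3, h2]
    rfl
  · simp only [List.mem_flatMap, forall_exists_index, and_imp, Prod.forall]
    intro F t'' t' i hti hF
    rw [List.mem_zipIdx_iff_getElem?, List.getElem?_zip_eq_some] at hti
    have hi := (List.getElem?_eq_some_iff.1 hti.1).1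
    rw [length_freshTuples] at hi
    rw [getElem?_freshTuples hi, getElem?_freshTuples hi, Option.some.injEq, Option.some.injEq]
      at hti
    simp only at hti hi
    obtain ⟨rfl, rfl⟩ := hti
    refine (forall_zipIdx_map (l := freshTuples p k₀ n) _ (fun F => F.eval J = true)).2 ?_ F hF
    intro k t ht
    have hk := (List.getElem?_eq_some_iff.1 ht).1
    rw [length_freshTuples] at hk
    rw [getElem?_freshTuples hk, Option.some.injEq] at ht
    subst ht
    rw [Formula.eval_imp, Formula.eval_and_true, Formula.eval_iff]
    intro hik
    simp only [Formula.eval, decide_eq_true_eq] at hik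
    have hd := hfind.del i hi
    have h1 := congrArg Prod.snd (hrow₀ i)
    have h2 := congrArg Prod.snd (hrow₀ k)
    simp only [Interp.row] at h1 h2
    refine ⟨?_, eval_copy_of_row ?_⟩
    · simp only [Formula.eval]
      rw [h1, h2, ← hd, hik]
    · rw [hrow₁, hrow₀, hik]
  · simp only [List.mem_flatMap, forall_exists_index, and_imp, Prod.forall]
    intro F t i hti hF
    rw [List.mem_zipIdx_iff_getElem?] at hti
    have hi := (List.getElem?_eq_some_iff.1 hti).1
    rw [length_freshTuples] at hi
    rw [getElem?_freshTuples hi, Option.some.injEq] at hti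
    simp only at hti hi
    subst hti
    obtain ⟨t', ht', rfl⟩ := List.mem_map.1 hF
    obtain ⟨m, hm⟩ := List.mem_iff_getElem?.1 ht'
    rw [List.getElem?_drop] at hm
    have hj := (List.getElem?_eq_some_iff.1 hm).1
    rw [length_freshTuples] at hj
    rw [getElem?_freshTuples hj, Option.some.injEq] at hm
    subst hm
    set j := i + 1 + m with hjdef
    rw [Formula.eval_imp, Formula.eval_and_true, Formula.eval_not_true, Formula.eval_not_true,
      Formula.eval_not_true]
    simp only [Formula.eval, Bool.not_eq_true]
    rintro ⟨hdi, hdj⟩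
    rw [← Bool.not_eq_true]
    have hri := hrow₁ i
    have hrj := hrow₁ j
    rw [← hfind.eq] at hs
    have hR := pairwise_lv hs (show i < j by omega) hj
      (by rw [← hri]; exact hdi) (by rw [← hrj]; exact hdj)
    rw [← hri, ← hrj] at hR
    have hki := hkeys _ hdi
    have hkj := hkeys _ hdj
    have hlen : (keys (.fresh p k₁ i)).length = (keys (.fresh p k₁ j)).length := by
      have h1 := congrArg List.length hki
      have h2 := congrArg List.length hkj
      rw [List.length_map, hκ] at h1 h2
      rw [h1, h2]
    simp only [Interp.row] at hR
    cases asc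
    · simp only [Bool.false_eq_true, if_false]
      rw [eval_lexLt _ _ hlen, hki, hkj]
      simpa [keyLE] using hR
    · simp only [if_true]
      rw [eval_lexLt _ _ hlen.symm, hki, hkj]
      simpa [keyLE] using hR

end OrderBy

/-! ### Requirements at several positions -/

namespace Solvable

variable {V Z : Set Sym} {I : Interp} {p : Path} {G₁ G₂ G₃ G₄ : Interp → Prop}

theorem and_child {j : ℕ} (hV : Disjoint V (zone p)) (hZp : Z ⊆ zone p)
    (hZ : Disjoint Z (zone (j :: p))) (h₁ : Solvable V Z I G₁)
    (h₂ : ∀ I₁ : Interp, I₁.EqOn I V → Solvable V (zone (j :: p)) I₁ G₂) :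
    Solvable V (Z ∪ zone (j :: p)) I (fun J => G₁ J ∧ G₂ J) :=
  h₁.and_zone hV hZ fun I₁ hI₁ =>
    h₂ I₁ (hI₁.mono ((hV.mono_right hZp).subset_compl_right))

theorem below_of_zone {i : ℕ} (h : Solvable V (zone (i :: p)) I G₁) :
    Solvable V (below p) I G₁ :=
  h.mono subset_rfl (zone_cons_subset_below i p) (fun _ h => h)

theorem two {i j : ℕ} (hij : i ≠ j) (hV : Disjoint V (zone p))
    (h₁ : Solvable V (zone (i :: p)) I G₁)
    (h₂ : ∀ I₁ : Interp, I₁.EqOn I V → Solvable V (zone (j :: p)) I₁ G₂) :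
    Solvable V (below p) I (fun J => G₁ J ∧ G₂ J) :=
  (h₁.and_child hV (zone_cons_subset i p) (zone_cons_disjoint hij p) h₂).mono subset_rfl
    (Set.union_subset (zone_cons_subset_below i p) (zone_cons_subset_below j p)) (fun _ h => h)

theorem three (hV : Disjoint V (zone p))
    (h₁ : Solvable V (zone (0 :: p)) I G₁)
    (h₂ : ∀ I₁ : Interp, I₁.EqOn I V → Solvable V (zone (1 :: p)) I₁ G₂)
    (h₃ : ∀ I₁ : Interp, I₁.EqOn I V → Solvable V (zone (2 :: p)) I₁ G₃) :
    Solvable V (below p) I (fun J => (G₁ J ∧ G₂ J) ∧ G₃ J) := by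
  have hs := fun i => zone_cons_subset i p
  have hb := fun i => zone_cons_subset_below i p
  refine ((h₁.and_child hV (hs 0) (zone_cons_disjoint (by decide) p) h₂).and_child hV
    (Set.union_subset (hs 0) (hs 1)) ?_ h₃).mono subset_rfl
    (Set.union_subset (Set.union_subset (hb 0) (hb 1)) (hb 2)) (fun _ h => h)
  exact Set.disjoint_union_left.2
    ⟨zone_cons_disjoint (by decide) p, zone_cons_disjoint (by decide) p⟩

theorem four (hV : Disjoint V (zone p))
    (h₁ : Solvable V (zone (0 :: p)) I G₁)
    (h₂ : ∀ I₁ : Interp, I₁.EqOn I V → Solvable V (zone (1 :: p)) I₁ G₂)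
    (h₃ : ∀ I₁ : Interp, I₁.EqOn I V → Solvable V (zone (2 :: p)) I₁ G₃)
    (h₄ : ∀ I₁ : Interp, I₁.EqOn I V → Solvable V (zone (3 :: p)) I₁ G₄) :
    Solvable V (below p) I (fun J => ((G₁ J ∧ G₂ J) ∧ G₃ J) ∧ G₄ J) := by
  have hs := fun i => zone_cons_subset i p
  have hb := fun i => zone_cons_subset_below i p
  refine (((h₁.and_child hV (hs 0) (zone_cons_disjoint (by decide) p) h₂).and_child hV
    (Set.union_subset (hs 0) (hs 1)) ?_ h₃).and_child hV
    (Set.union_subset (Set.union_subset (hs 0) (hs 1)) (hs 2)) ?_ h₄).mono subset_rfl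
    (Set.union_subset (Set.union_subset (Set.union_subset (hb 0) (hb 1)) (hb 2)) (hb 3))
    (fun _ h => h)
  · exact Set.disjoint_union_left.2
      ⟨zone_cons_disjoint (by decide) p, zone_cons_disjoint (by decide) p⟩
  · exact Set.disjoint_union_left.2 ⟨Set.disjoint_union_left.2
      ⟨zone_cons_disjoint (by decide) p, zone_cons_disjoint (by decide) p⟩,
      zone_cons_disjoint (by decide) p⟩

theorem zone_of_below (h : Solvable V (below p) I G₁) (hG : ∀ J, G₁ J → G₂ J) :
    Solvable V (zone p) I G₂ :=
  h.mono subset_rfl Set.sdiff_subset hG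

end Solvable

/-! ### Collection operators -/

theorem Interp.rowAt_of_le {J : Interp} {T : List TupVar} {i : ℕ} (h : T.length ≤ i) :
    J.rowAt T i = ([], true) := by
  simp [Interp.rowAt, List.getElem?_eq_none h]

theorem Interp.rowAt_fresh_eq {J : Interp} {p : Path} {k n : ℕ} {X : ℕ → Row}
    (h : ∀ i < n, J.row (.fresh p k i) = X i) (h' : ∀ i, n ≤ i → X i = ([], true)) :
    J.rowAt (freshTuples p k n) = X := by
  funext i
  by_cases hi : i < n
  · rw [J.rowAt_fresh hi, h i hi]
  · rw [J.rowAt_of_le (by simpa using hi), h' i (Nat.le_of_not_lt hi)]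

/-- The symbolic tuples of a collection operator. -/
def collTuples (op : CollOp) (n m : ℕ) (p : Path) : List TupVar :=
  match op with
  | .unionAll => freshTuples p 0 (n + m)
  | .union => freshTuples p 1 (n + m)
  | .diffAll => freshTuples p 0 n
  | .inter | .diff | .interAll => freshTuples p 1 n

theorem Solvable.coll (op : CollOp) {V : Set Sym} {I : Interp} {p : Path} {G : Interp → Prop}
    {A : List AttrName} (hA : A.Nodup) (hV : Disjoint V (zone p))
    (h : Solvable V (below p) I G) {T₁ T₂ : List TupVar}
    (hT₁ : ∀ t ∈ T₁, Sym.tup t ∈ V ∪ below p) (hT₂ : ∀ t ∈ T₂, Sym.tup t ∈ V ∪ below p)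
    (hN : ∀ J, G J → (∀ x ∈ J.rel T₁, x.map Prod.fst = A) ∧ ∀ x ∈ J.rel T₂, x.map Prod.fst = A) :
    Solvable V (zone p) I (fun J => G J ∧ (collF op A T₁ T₂ p).eval J = true ∧
      (J.rel (collTuples op T₁.length T₂.length p)).Perm
        (collRel op (J.rel T₁) (J.rel T₂))) := by
  have hT : ∀ t ∈ T₁ ++ T₂, Sym.tup t ∈ V ∪ below p := fun t ht =>
    (List.mem_append.1 ht).elim (hT₁ t) (hT₂ t)
  have hlen : (T₁ ++ T₂).length = T₁.length + T₂.length := List.length_append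
  cases op with
  | unionAll =>
    refine h.node hV (T₁ ++ T₂) [] hT (by simp) (fun X _ => { row := fun _ i => X i }) ?_
    intro J hJ hL
    refine ⟨hJ, eval_copyAll hlen (hL.row 0), ?_⟩
    simp only [collTuples, collRel, J.rel_fresh, hL.row, ← J.rel_append, J.rel_eq_lv (T₁ ++ T₂),
      hlen, List.Perm.refl]
  | union =>
    refine h.node hV (T₁ ++ T₂) [] hT (by simp) (fun X _ =>
      { row := fun k i => if k = 0 then X i else dedupRow X i }) ?_
    intro J hJ hL
    have hX : J.rowAt (freshTuples p 0 (T₁.length + T₂.length)) = J.rowAt (T₁ ++ T₂) :=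
      Interp.rowAt_fresh_eq (fun i _ => hL.row 0 i)
        (fun i hi => Interp.rowAt_of_le (by rw [hlen]; exact hi))
    have hrel : J.rel (freshTuples p 0 (T₁.length + T₂.length)) = J.rel T₁ ++ J.rel T₂ := by
      rw [J.rel_eq_lv, hX, length_freshTuples, ← J.rel_append, J.rel_eq_lv (T₁ ++ T₂), hlen]
    refine ⟨hJ, ?_, ?_⟩
    · simp only [collF, Formula.eval_and_true]
      refine ⟨eval_copyAll hlen (hL.row 0), eval_dedupF hA (by simp) ?_ ?_⟩
      · rw [hrel]
        intro x hx
        exact (List.mem_append.1 hx).elim ((hN J hJ).1 x) ((hN J hJ).2 x)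
      · rw [hX]; exact hL.row 1
    · simp only [collTuples, collRel, J.rel_fresh, hL.row]
      rw [← J.rel_append, J.rel_eq_lv (T₁ ++ T₂), hlen, ← lv_dedup]
      exact List.Perm.refl _
  | inter =>
    refine h.node hV T₁ T₂ hT₁ hT₂ (fun X Y =>
      { row := fun k i => if k = 0 then dedupRow X i
          else filterRow (fun x => decide (x ∈ lv T₂.length Y)) (dedupRow X i) }) ?_
    intro J hJ hL
    have hrel : J.rel (freshTuples p 0 T₁.length) = dedup (J.rel T₁) := by
      simp only [J.rel_fresh, hL.row]
      rw [J.rel_eq_lv T₁, ← lv_dedup]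
      rfl
    refine ⟨hJ, ?_, ?_⟩
    · simp only [collF, Formula.eval_and_true]
      refine ⟨eval_dedupF hA rfl (hN J hJ).1 (hL.row 0),
        eval_interF hA (by simp) ?_ (hN J hJ).2 ?_⟩
      · rw [hrel]; intro x hx; exact (hN J hJ).1 x (mem_dedup.1 hx)
      · intro i hi
        rw [J.rowAt_fresh hi, hL.row, hL.row, J.rel_eq_lv T₂]
        rfl
    · simp only [collTuples, collRel, J.rel_fresh, hL.row]
      rw [J.rel_eq_lv T₁, J.rel_eq_lv T₂, ← lv_dedup, ← lv_filter]
      exact List.Perm.refl _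
  | diff =>
    refine h.node hV T₁ T₂ hT₁ hT₂ (fun X Y =>
      { row := fun k i => if k = 0 then dedupRow X i
          else filterRow (fun x => decide (x ∉ lv T₂.length Y)) (dedupRow X i) }) ?_
    intro J hJ hL
    have hrel : J.rel (freshTuples p 0 T₁.length) = dedup (J.rel T₁) := by
      simp only [J.rel_fresh, hL.row]
      rw [J.rel_eq_lv T₁, ← lv_dedup]
      rfl
    refine ⟨hJ, ?_, ?_⟩
    · simp only [collF, Formula.eval_and_true]
      refine ⟨eval_dedupF hA rfl (hN J hJ).1 (hL.row 0),
        eval_diffF hA (by simp) ?_ (hN J hJ).2 ?_⟩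
      · rw [hrel]; intro x hx; exact (hN J hJ).1 x (mem_dedup.1 hx)
      · intro i hi
        rw [J.rowAt_fresh hi, hL.row, hL.row, J.rel_eq_lv T₂]
        rfl
    · simp only [collTuples, collRel, J.rel_fresh, hL.row]
      rw [J.rel_eq_lv T₁, J.rel_eq_lv T₂, ← lv_dedup, ← lv_filter]
      exact List.Perm.refl _
  | diffAll =>
    refine h.node hV T₁ T₂ hT₁ hT₂ (fun X Y => { row := fun _ i => diffRow T₂.length X Y i
                                                 paired := fun _ => greedy (rowMatch X Y) }) ?_
    intro J hJ hL
    refine ⟨hJ, eval_diffAllF hA rfl (hN J hJ).1 (hN J hJ).2 (hL.row 0) (hL.paired 0), ?_⟩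
    simp only [collTuples, collRel, J.rel_fresh, hL.row]
    rw [J.rel_eq_lv T₁, J.rel_eq_lv T₂]
    exact lv_greedy_perm _ _ _ _
  | interAll =>
    let D : (ℕ → Row) → (ℕ → Row) → ℕ → Row := fun X Y i =>
      if i < T₁.length then diffRow T₂.length X Y i else ([], true)
    refine h.node hV T₁ T₂ hT₁ hT₂ (fun X Y =>
      { row := fun k i => if k = 0 then diffRow T₂.length X Y i
          else diffRow T₁.length X (D X Y) i
        paired := fun k => if k = 0 then greedy (rowMatch X Y)
          else greedy (rowMatch X (D X Y)) }) ?_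
    intro J hJ hL
    have hX : J.rowAt (freshTuples p 0 T₁.length) = D (J.rowAt T₁) (J.rowAt T₂) :=
      Interp.rowAt_fresh_eq (fun i hi => by rw [hL.row]; simp only [D, hi, if_true])
        (fun i hi => by simp only [D, Nat.not_lt.2 hi, if_false])
    have hrel : (J.rel (freshTuples p 0 T₁.length)).Perm (bagDiff (J.rel T₁) (J.rel T₂)) := by
      simp only [J.rel_fresh, hL.row]
      rw [J.rel_eq_lv T₁, J.rel_eq_lv T₂]
      exact lv_greedy_perm _ _ _ _
    refine ⟨hJ, ?_, ?_⟩
    · simp only [collF, Formula.eval_and_true]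
      refine ⟨eval_diffAllF hA rfl (hN J hJ).1 (hN J hJ).2 (hL.row 0) (hL.paired 0),
        eval_diffAllF hA rfl (hN J hJ).1 ?_ ?_ ?_⟩
      · intro x hx
        rw [hrel.mem_iff, bagDiff_eq] at hx
        exact (hN J hJ).1 x (List.diff_subset _ _ hx)
      · rw [hX, length_freshTuples]; exact hL.row 1
      · rw [hX]; exact hL.paired 1
    · refine List.Perm.trans ?_ (bagDiff_perm (List.Perm.refl _) hrel)
      rw [J.rel_eq_lv T₁, J.rel_eq_lv (freshTuples p 0 T₁.length), hX, length_freshTuples]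
      simp only [collTuples, J.rel_fresh, hL.row]
      exact lv_greedy_perm _ _ _ _

/-! ### Environments and correctness of encodings -/

/-- The symbolic database `Γ`, whose tuples are in `V`, denotes `D` under `I`. -/
structure Env (S : SchemaEnv) (Γ : SymDB) (D : Database) (V : Set Sym) (I : Interp) : Prop where
  names : NamesOK S D
  sym : ∀ R A, S R = some A → ∃ T, Γ R = some T
  rel : ∀ R T, Γ R = some T → ∃ rows, D R = some rows ∧ (I.rel T).Perm rows
  mem : ∀ R T, Γ R = some T → ∀ t ∈ T, Sym.tup t ∈ V

theorem Env.congr {S : SchemaEnv} {Γ : SymDB} {D : Database} {V : Set Sym} {I J : Interp}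
    (h : Env S Γ D V I) (hJ : J.EqOn I V) : Env S Γ D V J :=
  ⟨h.names, h.sym, fun R T hT => by rw [Interp.rel_congr hJ (h.mem R T hT)]; exact h.rel R T hT,
    h.mem⟩

/-- The evaluation on the conditional list `G` is the evaluation on `xs`, as far as first tuples and
aggregates are concerned. -/
def Fits (J : Interp) (G : GTuples) (xs : Relation) (det : Prop) (agg : Bool) : Prop :=
  (HeadOK J G xs ∨ det) ∧ ((J.grel G).Perm xs ∨ agg = false)

theorem Fits.imp {J : Interp} {G : GTuples} {xs : Relation} {det det' : Prop} {agg agg' : Bool}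
    (h : Fits J G xs det agg) (hd : det → det') (ha : agg = false → agg' = false) :
    Fits J G xs det' agg' := ⟨h.1.imp id hd, h.2.imp id ha⟩

theorem fits_live {J : Interp} {t : TupVar} (ht : J.del t = false) (det : Prop) (agg : Bool) :
    Fits J (plain [t]) [J.tup t] det agg := by
  refine ⟨Or.inl (headOK_plain J t), Or.inl ?_⟩
  rw [J.grel_plain]
  simp [Interp.rel, ht]

theorem fits_noAgg (J : Interp) (t : TupVar) (det : Prop) : Fits J (plain [t]) [J.tup t] det false :=
  ⟨Or.inl (headOK_plain J t), Or.inr rfl⟩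

theorem fits_group {J : Interp} {G : GTuples} (h : HeadOK J G (J.grel G)) (det : Prop) (agg : Bool) :
    Fits J G (J.grel G) det agg := ⟨Or.inl h, Or.inl (List.Perm.refl _)⟩

section Good

variable (S : SchemaEnv) (Γ : SymDB) (D : Database) (p : Path) (J : Interp)

def Query.Good (Q : Query) : Prop :=
  (Q.encode S Γ p).eval J = true ∧ (J.rel (Q.symTuples Γ p)).Perm (Q.denot S D)

def Query.GoodList (Qs : List Query) : Prop :=
  (Query.encodeList Qs S Γ p).eval J = true ∧
    List.Forall₂ (fun T rows => (J.rel T).Perm rows) (Query.symTuplesList Qs Γ p)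
      (Query.denotList Qs S D)

def Item.GoodList (L : List Item) : Prop :=
  ∀ G xs, Fits J G xs (∀ e ∈ L, e.attr.Det []) (VeriEQL.hasAgg L) →
    (Item.encodeList L S Γ p G).map (Term.eval J) = (Item.denotList L S D xs).map Prod.snd

def Attr.Good (A : Attr) : Prop :=
  ∀ G xs, Fits J G xs (A.Det []) A.hasAgg → (A.encode S Γ p G).eval J = A.denot S D xs

def Pred.Good (φ : Pred) : Prop :=
  ∀ G xs, Fits J G xs (φ.Det []) φ.hasAgg → (φ.encode S Γ p G).eval J = φ.denot S D xs

def Pred.GoodList (φs : List Pred) : Prop :=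
  ∀ G xs, Fits J G xs (Pred.DetList [] φs) (Pred.hasAggList φs) →
    (Pred.encodeList φs S Γ p G).map (Term.eval J) = Pred.denotList φs S D xs

def Expr.Good (E : Expr) : Prop :=
  ∀ G xs, Fits J G xs (E.Det []) E.hasAgg → (E.encode S Γ p G).eval J = E.denot S D xs

def Expr.GoodList (Es : List Expr) : Prop :=
  ∀ G xs, Fits J G xs (Expr.DetList [] Es) (Expr.hasAggList Es) →
    (Expr.encodeList Es S Γ p G).map (Term.eval J) = Expr.denotList Es S D xs

end Good

theorem foldl_vOr_rel (J : Interp) (w : Tuple → Value) (hw : ∀ x, (w x).IsTri) (T : List TupVar)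
    {acc : Value} (hacc : acc.IsTri) :
    (T.map (fun t => vAnd (.bool (!J.del t)) (w (J.tup t)))).foldl vOr acc =
      ((J.rel T).map w).foldl vOr acc := by
  induction T generalizing acc with
  | nil => rfl
  | cons t T ih =>
    rw [List.map_cons, List.foldl_cons, ih (vOr_isTri _ _)]
    cases hd : J.del t with
    | true => simp [Interp.rel, hd, vAnd_false_left, vOr_false_right hacc]
    | false => simp [Interp.rel, hd, vAnd_true_left (hw _)]

theorem Pred.good_inQuery {S : SchemaEnv} {Γ : SymDB} {D : Database} {p : Path} {J : Interp}
    {Es : List Expr} {Q : Query} (hQ : Q.WF S) (hD : NamesOK S D)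
    (hEs : Expr.GoodList S Γ D (0 :: p) J Es) (hG : Q.Good S Γ D (1 :: p) J) :
    (Pred.inQuery Es Q).Good S Γ D p J := by
  intro G xs hf
  simp only [Pred.Det, Pred.hasAgg] at hf
  have hus := hEs G xs hf
  have hnames := Query.denot_names Q S D hQ hD
  have hnd := Query.attrs_nodup Q S hQ
  simp only [Pred.encode, Pred.denot, eval_tAnd, Formula.eval_toTerm, hG.1, eval_tAny,
    List.map_map]
  rw [vAnd_true_left (foldl_vOr_isTri _ (Or.inr ⟨_, rfl⟩))]
  have h1 : (Q.symTuples Γ (1 :: p)).map (Term.eval J ∘ fun t =>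
      tAnd (Formula.not (.del t)).toTerm (tRowEq (Expr.encodeList Es S Γ (0 :: p) G)
        ((Q.attrs S).map (fun a => Term.attr a t)))) =
      (Q.symTuples Γ (1 :: p)).map (fun t => vAnd (.bool (!J.del t))
        ((fun x => vRowEq (Expr.denotList Es S D xs) ((Q.attrs S).map (lookup x))) (J.tup t))) := by
    apply List.map_congr_left
    intro t _
    simp only [Function.comp, eval_tAnd, Formula.eval_toTerm, eval_tRowEq, hus, List.map_map,
      Formula.eval]
    congr 2
  rw [h1, foldl_vOr_rel J
    (fun x => vRowEq (Expr.denotList Es S D xs) ((Q.attrs S).map (lookup x)))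
    (fun x => vRowEq_isTri _ _) _ (Or.inr ⟨_, rfl⟩)]
  have h2 : (J.rel (Q.symTuples Γ (1 :: p))).map
      (fun x => vRowEq (Expr.denotList Es S D xs) ((Q.attrs S).map (lookup x))) =
      ((J.rel (Q.symTuples Γ (1 :: p))).map (fun y => y.map Prod.snd)).map
        (vRowEq (Expr.denotList Es S D xs)) := by
    rw [List.map_map]
    apply List.map_congr_left
    intro x hx
    have hx' := hnames x (hG.2.mem_iff.1 hx)
    have := map_lookup (x := x) (by rw [hx']; exact hnd)
    rw [hx'] at this
    simp only [Function.comp, this]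
  rw [h2, ← vMember_eq]
  exact vMember_perm _ (hG.2.map _)

mutual

theorem Query.solvable : ∀ (Q : Query) {S : SchemaEnv} {Γ : SymDB} {D : Database} (p : Path)
    {V : Set Sym} {I : Interp}, Q.WF S → Env S Γ D V I → Disjoint V (zone p) →
    Solvable V (zone p) I (fun J => Q.Good S Γ D p J)
  | .rel R, S, Γ, D, p, V, I, hwf, hE, hV => by
    simp only [Query.WF] at hwf
    obtain ⟨A, hA, _⟩ := hwf
    obtain ⟨T, hT⟩ := hE.sym R A hA
    refine ⟨I, .refl I _, fun J hJ => ?_⟩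
    obtain ⟨rows, hr, hp⟩ := (hE.congr (hJ.mono Set.subset_union_left)).rel R T hT
    constructor
    · simp only [Query.encode, Formula.eval]
    · simpa only [Query.symTuples, Query.denot, hT, hr, Option.getD_some] using hp
  | .proj L Q, S, Γ, D, p, V, I, hwf, hE, hV => by
    simp only [Query.WF] at hwf
    obtain ⟨hQ, hL, hn, -, hdet⟩ := hwf
    have hk := Solvable.two (i := 1) (j := 0) (by decide) hV
      (Query.solvable Q (1 :: p) hQ hE (hV.mono_right (zone_cons_subset _ _)))
      (fun I₁ hI₁ => Item.solvableList L (0 :: p) hL (hE.congr hI₁)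
        (hV.mono_right (zone_cons_subset _ _)))
    have hT : ∀ t ∈ Q.symTuples Γ (1 :: p), Sym.tup t ∈ V ∪ below p := fun t ht =>
      (Query.symTuples_mem Q Γ _ V hE.mem t ht).imp id (fun h => zone_cons_subset_below _ _ h)
    set T := Q.symTuples Γ (1 :: p) with hTdef
    have hnames : ∀ xs, (Item.denotList L S D xs).map Prod.fst = L.map Item.name := by
      intro xs; simp [Item.denotList_eq_map, Function.comp_def]
    cases ha : VeriEQL.hasAgg L with
    | true =>
      refine hk.node hV T [] hT (by simp)
        (fun X _ => { row := fun _ _ => (Item.denotList L S D (lv T.length X), false) }) ?_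
      rintro J ⟨hJ, hJL⟩ hlev
      have hrow := hlev.row
      simp only [← J.rel_eq_lv] at hrow
      constructor
      · simp only [Query.encode, Formula.eval_and_true, ha, if_true, ← hTdef]
        refine ⟨hJ.1, eval_aggF hn (hnames _) (hJL (plain T) (J.rel T) ⟨Or.inr (hdet ha), Or.inl ?_⟩)
          (hrow 0 0)⟩
        rw [J.grel_plain]
      · simp only [Query.symTuples, Query.denot, ha, if_true, J.rel_fresh, hrow]
        rw [Item.denotList_congr hJ.2 (Ks := []) (by simp) L (hdet ha)]
        simp [lv]
    | false =>
      refine hk.node hV T [] hT (by simp)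
        (fun X _ => { row := fun _ i => (Item.denotList L S D [(X i).1], (X i).2) }) ?_
      rintro J ⟨hJ, hJL⟩ hlev
      constructor
      · simp only [Query.encode, Formula.eval_and_true, ha, Bool.false_eq_true, if_false, ← hTdef]
        refine ⟨hJ.1, eval_projF (h := fun x => Item.denotList L S D [x]) hn (fun _ => hnames _)
          (fun t _ => hJL (plain [t]) [J.tup t] ?_) (hlev.row 0)⟩
        rw [ha]
        exact fits_noAgg J t _
      · simp only [Query.symTuples, Query.denot, ha, Bool.false_eq_true, if_false, J.rel_fresh,
          hlev.row, ← hTdef]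
        rw [lv_map T.length (J.rowAt T) (fun x => Item.denotList L S D [x]), ← J.rel_eq_lv]
        exact hJ.2.map _
  | .select φ Q, S, Γ, D, p, V, I, hwf, hE, hV => by
    simp only [Query.WF] at hwf
    have hk := Solvable.two (i := 1) (j := 0) (by decide) hV
      (Query.solvable Q (1 :: p) hwf.1 hE (hV.mono_right (zone_cons_subset _ _)))
      (fun I₁ hI₁ => Pred.solvable φ (0 :: p) hwf.2 (hE.congr hI₁)
        (hV.mono_right (zone_cons_subset _ _)))
    have hT : ∀ t ∈ Q.symTuples Γ (1 :: p), Sym.tup t ∈ V ∪ below p := fun t ht =>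
      (Query.symTuples_mem Q Γ _ V hE.mem t ht).imp id (fun h => zone_cons_subset_below _ _ h)
    set T := Q.symTuples Γ (1 :: p) with hTdef
    refine hk.node hV T [] hT (by simp) (fun X _ =>
      { row := fun _ i => filterRow (fun x => decide (φ.denot S D [x] = .bool true)) (X i) }) ?_
    rintro J ⟨hJ, hJφ⟩ hlev
    constructor
    · simp only [Query.encode, Formula.eval_and_true, ← hTdef]
      refine ⟨hJ.1, eval_filterF (f := fun x => decide (φ.denot S D [x] = .bool true)) rfl
        (fun t _ hd => ?_) (fun i _ => hlev.row 0 i)⟩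
      rw [hJφ (plain [t]) [J.tup t] (fits_live hd _ _)]
      simp
    · simp only [Query.symTuples, Query.denot, J.rel_fresh, hlev.row, ← hTdef]
      refine List.Perm.trans (List.Perm.of_eq ?_) (hJ.2.filter _)
      rw [J.rel_eq_lv, ← lv_filter]
      rfl
  | .rename R Q, S, Γ, D, p, V, I, hwf, hE, hV => by
    simp only [Query.WF] at hwf
    have hk := (Query.solvable Q (0 :: p) hwf.1 hE
      (hV.mono_right (zone_cons_subset _ _))).below_of_zone
    have hT : ∀ t ∈ Q.symTuples Γ (0 :: p), Sym.tup t ∈ V ∪ below p := fun t ht =>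
      (Query.symTuples_mem Q Γ _ V hE.mem t ht).imp id (fun h => zone_cons_subset_below _ _ h)
    have hnames := Query.denot_names Q S D hwf.1 hE.names
    set T := Q.symTuples Γ (0 :: p) with hTdef
    refine hk.node hV T [] hT (by simp) (fun X _ =>
      { row := fun _ i =>
          (renameTuple (Q.attrs S) (VeriEQL.rename R) (X i).1, (X i).2) }) ?_
    intro J hJ hlev
    constructor
    · simp only [Query.encode, Formula.eval_and_true, ← hTdef]
      exact ⟨hJ.1, eval_copyAll_rename hwf.2 (hlev.row 0)⟩
    · simp only [Query.symTuples, Query.denot, J.rel_fresh, hlev.row, ← hTdef]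
      rw [lv_rename (Query.attrs_nodup Q S hwf.1)
        (fun x hx => hnames x (hJ.2.mem_iff.1 (by rw [J.rel_eq_lv]; exact hx))), ← J.rel_eq_lv]
      exact hJ.2.map _
  | .coll op Q₁ Q₂, S, Γ, D, p, V, I, hwf, hE, hV => by
    simp only [Query.WF] at hwf
    have hk := Solvable.two (i := 0) (j := 1) (by decide) hV
      (Query.solvable Q₁ (0 :: p) hwf.1 hE (hV.mono_right (zone_cons_subset _ _)))
      (fun I₁ hI₁ => Query.solvable Q₂ (1 :: p) hwf.2.1 (hE.congr hI₁)
        (hV.mono_right (zone_cons_subset _ _)))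
    have hn₁ := Query.denot_names Q₁ S D hwf.1 hE.names
    have hn₂ := Query.denot_names Q₂ S D hwf.2.1 hE.names
    rw [← hwf.2.2] at hn₂
    refine (Solvable.coll op (Query.attrs_nodup Q₁ S hwf.1) hV hk
      (fun t ht => (Query.symTuples_mem Q₁ Γ _ V hE.mem t ht).imp id
        (fun h => zone_cons_subset_below _ _ h))
      (fun t ht => (Query.symTuples_mem Q₂ Γ _ V hE.mem t ht).imp id
        (fun h => zone_cons_subset_below _ _ h))
      (fun J hJ => ⟨fun x hx => hn₁ x (hJ.1.2.mem_iff.1 hx),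
        fun x hx => hn₂ x (hJ.2.2.mem_iff.1 hx)⟩)).mono subset_rfl subset_rfl ?_
    rintro J ⟨⟨hJ₁, hJ₂⟩, hF, hrel⟩
    constructor
    · simp only [Query.encode, Formula.eval_and_true]
      exact ⟨⟨hJ₁.1, hJ₂.1⟩, hF⟩
    · simp only [Query.symTuples, Query.denot]
      refine List.Perm.trans ?_ (hrel.trans (collRel_perm op hJ₁.2 hJ₂.2))
      cases op <;> exact List.Perm.refl _
  | .distinct Q, S, Γ, D, p, V, I, hwf, hE, hV => by
    simp only [Query.WF] at hwf
    have hk := (Query.solvable Q (0 :: p) hwf hE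
      (hV.mono_right (zone_cons_subset _ _))).below_of_zone
    have hT : ∀ t ∈ Q.symTuples Γ (0 :: p), Sym.tup t ∈ V ∪ below p := fun t ht =>
      (Query.symTuples_mem Q Γ _ V hE.mem t ht).imp id (fun h => zone_cons_subset_below _ _ h)
    have hnames := Query.denot_names Q S D hwf hE.names
    set T := Q.symTuples Γ (0 :: p) with hTdef
    refine hk.node hV T [] hT (by simp) (fun X _ => { row := fun _ i => dedupRow X i }) ?_
    intro J hJ hlev
    constructor
    · simp only [Query.encode, Formula.eval_and_true, ← hTdef]
      exact ⟨hJ.1, eval_dedupF (Query.attrs_nodup Q S hwf) rfl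
        (fun x hx => hnames x (hJ.2.mem_iff.1 hx)) (hlev.row 0)⟩
    · simp only [Query.symTuples, Query.denot, J.rel_fresh, hlev.row, ← hTdef]
      refine List.Perm.trans (List.Perm.of_eq ?_) (dedup_perm hJ.2)
      rw [J.rel_eq_lv, ← lv_dedup]
      rfl
  | .prod Q₁ Q₂, S, Γ, D, p, V, I, hwf, hE, hV => by
    simp only [Query.WF] at hwf
    have hk := Solvable.two (i := 0) (j := 1) (by decide) hV
      (Query.solvable Q₁ (0 :: p) hwf.1 hE (hV.mono_right (zone_cons_subset _ _)))
      (fun I₁ hI₁ => Query.solvable Q₂ (1 :: p) hwf.2.1 (hE.congr hI₁)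
        (hV.mono_right (zone_cons_subset _ _)))
    have hn₁ := Query.denot_names Q₁ S D hwf.1 hE.names
    have hT₁ : ∀ t ∈ Q₁.symTuples Γ (0 :: p), Sym.tup t ∈ V ∪ below p := fun t ht =>
      (Query.symTuples_mem Q₁ Γ _ V hE.mem t ht).imp id (fun h => zone_cons_subset_below _ _ h)
    have hT₂ : ∀ t ∈ Q₂.symTuples Γ (1 :: p), Sym.tup t ∈ V ∪ below p := fun t ht =>
      (Query.symTuples_mem Q₂ Γ _ V hE.mem t ht).imp id (fun h => zone_cons_subset_below _ _ h)
    set T₁ := Q₁.symTuples Γ (0 :: p) with hT₁def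
    set T₂ := Q₂.symTuples Γ (1 :: p) with hT₂def
    refine hk.node hV T₁ T₂ hT₁ hT₂ (fun X Y => { row := fun _ q => prodRow T₂.length X Y q }) ?_
    rintro J ⟨hJ₁, hJ₂⟩ hlev
    constructor
    · simp only [Query.encode, Formula.eval_and_true, ← hT₁def, ← hT₂def]
      exact ⟨⟨hJ₁.1, hJ₂.1⟩, eval_prodF hwf.2.2 (fun x hx => hn₁ x (hJ₁.2.mem_iff.1 hx))
        (hlev.row 0)⟩
    · simp only [Query.symTuples, Query.denot, J.rel_fresh, hlev.row, ← hT₁def, ← hT₂def]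
      refine List.Perm.trans (List.Perm.of_eq ?_) (cross_perm hJ₁.2 hJ₂.2)
      rw [J.rel_eq_lv T₁, J.rel_eq_lv T₂, ← lv_prod]
  | .join k φ Q₁ Q₂, S, Γ, D, p, V, I, hwf, hE, hV => by
    simp only [Query.WF] at hwf
    have hk := Solvable.three hV
      (Query.solvable Q₁ (0 :: p) hwf.1 hE (hV.mono_right (zone_cons_subset _ _)))
      (fun I₁ hI₁ => Query.solvable Q₂ (1 :: p) hwf.2.1 (hE.congr hI₁)
        (hV.mono_right (zone_cons_subset _ _)))
      (fun I₁ hI₁ => Pred.solvable φ (2 :: p) hwf.2.2.1 (hE.congr hI₁)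
        (hV.mono_right (zone_cons_subset _ _)))
    have hn₁ := Query.denot_names Q₁ S D hwf.1 hE.names
    have hn₂ := Query.denot_names Q₂ S D hwf.2.1 hE.names
    have hT₁ : ∀ t ∈ Q₁.symTuples Γ (0 :: p), Sym.tup t ∈ V ∪ below p := fun t ht =>
      (Query.symTuples_mem Q₁ Γ _ V hE.mem t ht).imp id (fun h => zone_cons_subset_below _ _ h)
    have hT₂ : ∀ t ∈ Q₂.symTuples Γ (1 :: p), Sym.tup t ∈ V ∪ below p := fun t ht =>
      (Query.symTuples_mem Q₂ Γ _ V hE.mem t ht).imp id (fun h => zone_cons_subset_below _ _ h)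
    set T₁ := Q₁.symTuples Γ (0 :: p) with hT₁def
    set T₂ := Q₂.symTuples Γ (1 :: p) with hT₂def
    refine hk.node hV T₁ T₂ hT₁ hT₂ (fun X Y =>
      { row := joinRow (Q₁.attrs S) (Q₂.attrs S)
          (fun x => decide (φ.denot S D [x] = .bool true)) T₁.length T₂.length X Y }) ?_
    rintro J ⟨⟨hJ₁, hJ₂⟩, hJφ⟩ hlev
    have hx₁ : ∀ x ∈ J.rel T₁, x.map Prod.fst = Q₁.attrs S :=
      fun x hx => hn₁ x (hJ₁.2.mem_iff.1 hx)
    have hx₂ : ∀ x ∈ J.rel T₂, x.map Prod.fst = Q₂.attrs S :=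
      fun x hx => hn₂ x (hJ₂.2.mem_iff.1 hx)
    constructor
    · simp only [Query.encode, Formula.eval_and_true, ← hT₁def, ← hT₂def]
      refine ⟨⟨hJ₁.1, hJ₂.1⟩, eval_joinF k hwf.2.2.2 hx₁ (fun t hd => ?_) hlev.row⟩
      rw [hJφ (plain [t]) [J.tup t] (fits_live hd _ _)]
      simp
    · obtain ⟨h1, h2, h3⟩ := rel_join hwf.2.2.2 hx₁ hx₂ hlev.row
      simp only [Query.symTuples, Query.denot, ← hT₁def, ← hT₂def]
      refine List.Perm.trans (List.Perm.trans (List.Perm.of_eq ?_)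
        (joinList_perm k (Q₁.attrs S) (Q₂.attrs S) _ hJ₁.2 hJ₂.2))
        (joinRel_perm_joinList _ _ _ _ _ _).symm
      cases k <;> (simp only [joinList, J.rel_append, h1, h2, h3]; rfl)
  | .groupBy Q Es L φ, S, Γ, D, p, V, I, hwf, hE, hV => by
    simp only [Query.WF] at hwf
    obtain ⟨hQ, hEs, hL, hφ, hn, hagg, hdL, hdφ⟩ := hwf
    have hk := Solvable.four hV
      (Query.solvable Q (0 :: p) hQ hE (hV.mono_right (zone_cons_subset _ _)))
      (fun I₁ hI₁ => Expr.solvableList Es (1 :: p) hEs (hE.congr hI₁)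
        (hV.mono_right (zone_cons_subset _ _)))
      (fun I₁ hI₁ => Item.solvableList L (2 :: p) hL (hE.congr hI₁)
        (hV.mono_right (zone_cons_subset _ _)))
      (fun I₁ hI₁ => Pred.solvable φ (3 :: p) hφ (hE.congr hI₁)
        (hV.mono_right (zone_cons_subset _ _)))
    have hT : ∀ t ∈ Q.symTuples Γ (0 :: p), Sym.tup t ∈ V ∪ below p := fun t ht =>
      (Query.symTuples_mem Q Γ _ V hE.mem t ht).imp id (fun h => zone_cons_subset_below _ _ h)
    set T := Q.symTuples Γ (0 :: p) with hTdef
    let κ : Tuple → List Value := fun z => Expr.denotList Es S D [z]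
    let h : Relation → Tuple := fun xs => Item.denotList L S D xs
    let f : Relation → Bool := fun xs => decide (φ.denot S D xs = .bool true)
    refine hk.node hV T [] hT (by simp) (fun X _ =>
      { row := fun _ k => (h ((lv T.length X).filter (fun z => decide (κ z = κ (X k).1))),
            !(lead κ X k && f ((lv T.length X).filter (fun z => decide (κ z = κ (X k).1)))))
        grp := inGroup κ X }) ?_
    rintro J ⟨⟨⟨hJ, hJE⟩, hJL⟩, hJφ⟩ hlev
    have hrow := hlev.row
    simp only [← J.rel_eq_lv] at hrow
    constructor
    · simp only [Query.encode, Formula.eval_and_true, ← hTdef]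
      refine ⟨hJ.1, eval_groupF (κ := κ) (h := h) (f := f) (l := Es.length) hn ?_ ?_ ?_ ?_ ?_
        hlev.grp (hrow 0)⟩
      · intro x; simp [κ, Expr.denotList_eq_map]
      · intro t _ hd; exact hJE (plain [t]) [J.tup t] (fits_live hd _ _)
      · intro xs; simp [h, Item.denotList_eq_map, Function.comp_def]
      · intro G hG; exact hJL G (J.grel G) (fits_group hG _ _)
      · intro G hG; rw [hJφ G (J.grel G) (fits_group hG _ _)]; simp [f]
    · simp only [Query.symTuples, Query.denot, J.rel_fresh, hlev.row, ← hTdef]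
      rw [lv_groups κ (J.rowAt T) T.length f h, ← J.rel_eq_lv]
      exact groupBy_perm hJ.2 hagg hdL hdφ
  | .withQ Qs Rs Q, S, Γ, D, p, V, I, hwf, hE, hV => by
    simp only [Query.WF] at hwf
    have hd : Disjoint (V ∪ zone (0 :: p)) (zone (1 :: p)) := Set.disjoint_union_left.2
      ⟨hV.mono_right (zone_cons_subset _ _), zone_cons_disjoint (by decide) p⟩
    refine ((Query.solvableList Qs (0 :: p) hwf.1 hE (hV.mono_right (zone_cons_subset _ _))).bind
      (G₂ := fun J => Q.Good (update S Rs (Query.attrsList Qs S))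
        (update Γ Rs (Query.symTuplesList Qs Γ (0 :: p))) (update D Rs (Query.denotList Qs S D))
        (1 :: p) J) hd ?_).mono subset_rfl
        (Set.union_subset (zone_cons_subset _ _) (zone_cons_subset _ _)) ?_
    · intro I₁ hI₁ hG₁
      have hG := hG₁ I₁ (.refl I₁ _)
      have hE₁ := hE.congr (hI₁.mono
        (hV.mono_right (zone_cons_subset 0 p)).subset_compl_right)
      refine Query.solvable Q (1 :: p) hwf.2.2 ⟨?_, ?_, ?_, ?_⟩ hd
      · exact update_rel _ Rs (Query.denotList_names Qs S D hwf.1 hE.names) hE.names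
      · intro R A hR
        refine (update_rel (fun _ _ => True) Rs ?_
          (fun R A hA => (hE.sym R A hA).imp fun T hT => ⟨hT, trivial⟩) R A hR).imp
          fun _ h => h.1
        have h1 := (Query.denotList_names Qs S D hwf.1 hE.names).length_eq
        have h2 := hG.2.length_eq
        exact List.forall₂_iff_get.2 ⟨h1.trans h2.symm, fun _ _ _ => trivial⟩
      · exact update_rel _ Rs hG.2 hE₁.rel
      · exact update_forall Rs (Query.symTuplesList_mem Qs Γ (0 :: p) V hE.mem)
          (fun R T hR t ht => Or.inl (hE.mem R T hR t ht))
    · rintro J ⟨hJ₁, hJ₂⟩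
      constructor
      · simp only [Query.encode, Formula.eval_and_true]
        exact ⟨hJ₁.1, hJ₂.1⟩
      · simpa only [Query.symTuples, Query.denot] using hJ₂.2

theorem Query.solvableList : ∀ (Qs : List Query) {S : SchemaEnv} {Γ : SymDB} {D : Database}
    (p : Path) {V : Set Sym} {I : Interp}, Query.WFList Qs S → Env S Γ D V I →
    Disjoint V (zone p) → Solvable V (zone p) I (fun J => Query.GoodList S Γ D p J Qs)
  | [], S, Γ, D, p, V, I, hwf, hE, hV => by
    refine Solvable.of_forall fun J => ⟨?_, ?_⟩
    · simp only [Query.encodeList, Formula.eval]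
    · simp only [Query.symTuplesList, Query.denotList]
      exact List.Forall₂.nil
  | Q :: Qs, S, Γ, D, p, V, I, hwf, hE, hV => by
    simp only [Query.WFList] at hwf
    refine (Solvable.two (i := 0) (j := 1) (by decide) hV
      (Query.solvable Q (0 :: p) hwf.1 hE (hV.mono_right (zone_cons_subset _ _)))
      (fun I₁ hI₁ => Query.solvableList Qs (1 :: p) hwf.2 (hE.congr hI₁)
        (hV.mono_right (zone_cons_subset _ _)))).zone_of_below ?_
    rintro J ⟨h1, h2⟩
    refine ⟨?_, ?_⟩
    · simp only [Query.encodeList, Formula.eval_and_true]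
      exact ⟨h1.1, h2.1⟩
    · simp only [Query.symTuplesList, Query.denotList]
      exact List.Forall₂.cons h1.2 h2.2

theorem Item.solvableList : ∀ (L : List Item) {S : SchemaEnv} {Γ : SymDB} {D : Database}
    (p : Path) {V : Set Sym} {I : Interp}, Item.WFList L S → Env S Γ D V I →
    Disjoint V (zone p) → Solvable V (zone p) I (fun J => Item.GoodList S Γ D p J L)
  | [], S, Γ, D, p, V, I, hwf, hE, hV => by
    refine Solvable.of_forall fun J G xs _ => ?_
    simp only [Item.encodeList, Item.denotList, List.map_nil]
  | .id A :: L, S, Γ, D, p, V, I, hwf, hE, hV => by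
    simp only [Item.WFList, Item.WF] at hwf
    have hV' : Disjoint V (zone (0 :: 0 :: p)) :=
      hV.mono_right ((zone_cons_subset _ _).trans (zone_cons_subset _ _))
    refine (Solvable.two (i := 0) (j := 1) (by decide) hV
      ((Attr.solvable A (0 :: 0 :: p) hwf.1 hE hV').mono subset_rfl (zone_cons_subset _ _)
        (fun _ h => h))
      (fun I₁ hI₁ => Item.solvableList L (1 :: p) hwf.2 (hE.congr hI₁)
        (hV.mono_right (zone_cons_subset _ _)))).zone_of_below ?_
    rintro J ⟨h1, h2⟩ G xs hf
    simp only [Item.encodeList, Item.denotList, Item.encode, Item.denot, List.map_cons]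
    rw [h1 G xs (hf.imp (fun h => h _ List.mem_cons_self) (fun h => by
        simp only [VeriEQL.hasAgg, List.any_cons, Bool.or_eq_false_iff] at h; exact h.1)),
      h2 G xs (hf.imp (fun h e he => h e (List.mem_cons_of_mem _ he)) (fun h => by
        simp only [VeriEQL.hasAgg, List.any_cons, Bool.or_eq_false_iff] at h; exact h.2))]
  | .named a A :: L, S, Γ, D, p, V, I, hwf, hE, hV => by
    simp only [Item.WFList, Item.WF] at hwf
    have hV' : Disjoint V (zone (0 :: 0 :: p)) :=
      hV.mono_right ((zone_cons_subset _ _).trans (zone_cons_subset _ _))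
    refine (Solvable.two (i := 0) (j := 1) (by decide) hV
      ((Attr.solvable A (0 :: 0 :: p) hwf.1 hE hV').mono subset_rfl (zone_cons_subset _ _)
        (fun _ h => h))
      (fun I₁ hI₁ => Item.solvableList L (1 :: p) hwf.2 (hE.congr hI₁)
        (hV.mono_right (zone_cons_subset _ _)))).zone_of_below ?_
    rintro J ⟨h1, h2⟩ G xs hf
    simp only [Item.encodeList, Item.denotList, Item.encode, Item.denot, List.map_cons]
    rw [h1 G xs (hf.imp (fun h => h _ List.mem_cons_self) (fun h => by
        simp only [VeriEQL.hasAgg, List.any_cons, Bool.or_eq_false_iff] at h; exact h.1)),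
      h2 G xs (hf.imp (fun h e he => h e (List.mem_cons_of_mem _ he)) (fun h => by
        simp only [VeriEQL.hasAgg, List.any_cons, Bool.or_eq_false_iff] at h; exact h.2))]

theorem Attr.solvable : ∀ (A : Attr) {S : SchemaEnv} {Γ : SymDB} {D : Database} (p : Path)
    {V : Set Sym} {I : Interp}, A.WF S → Env S Γ D V I → Disjoint V (zone p) →
    Solvable V (zone p) I (fun J => A.Good S Γ D p J)
  | .cast φ, S, Γ, D, p, V, I, hwf, hE, hV => by
    simp only [Attr.WF] at hwf
    refine (Pred.solvable φ (0 :: p) hwf hE (hV.mono_right (zone_cons_subset _ _))).mono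
      subset_rfl (zone_cons_subset _ _) ?_
    intro J h G xs hf
    simp only [Attr.Det, Attr.hasAgg] at hf
    simp only [Attr.encode, Attr.denot, Term.eval_ite, Term.eval_isNull, Term.eval_isTrue,
      h G xs hf, decide_eq_true_eq, Term.eval_nil, Term.eval_int]
  | .expr E, S, Γ, D, p, V, I, hwf, hE, hV => by
    simp only [Attr.WF] at hwf
    refine (Expr.solvable E (0 :: p) hwf hE (hV.mono_right (zone_cons_subset _ _))).mono
      subset_rfl (zone_cons_subset _ _) ?_
    intro J h G xs hf
    simp only [Attr.Det, Attr.hasAgg] at hf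
    simp only [Attr.encode, Attr.denot, h G xs hf]
  | .agg g E, S, Γ, D, p, V, I, hwf, hE, hV => by
    simp only [Attr.WF] at hwf
    refine (Expr.solvable E (0 :: p) hwf hE (hV.mono_right (zone_cons_subset _ _))).mono
      subset_rfl (zone_cons_subset _ _) ?_
    intro J h G xs hf
    simp only [Attr.hasAgg, Fits, Bool.true_eq_false, or_false] at hf
    simp only [Attr.encode, Attr.denot]
    rw [eval_tAgg J g _ (fun y => E.denot S D [y]) G]
    · exact vAgg_perm g (hf.2.map _)
    · intro ct _ hl
      simp only [Interp.live, Bool.and_eq_true, Bool.not_eq_true'] at hl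
      exact h _ _ (fits_live hl.2 _ _)
  | .arith op A₁ A₂, S, Γ, D, p, V, I, hwf, hE, hV => by
    simp only [Attr.WF] at hwf
    refine (Solvable.two (i := 0) (j := 1) (by decide) hV
      (Attr.solvable A₁ (0 :: p) hwf.1 hE (hV.mono_right (zone_cons_subset _ _)))
      (fun I₁ hI₁ => Attr.solvable A₂ (1 :: p) hwf.2 (hE.congr hI₁)
        (hV.mono_right (zone_cons_subset _ _)))).zone_of_below ?_
    rintro J ⟨h1, h2⟩ G xs hf
    simp only [Attr.Det, Attr.hasAgg] at hf
    simp only [Attr.encode, Attr.denot, eval_tArith]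
    rw [h1 G xs (hf.imp And.left (fun h => (Bool.or_eq_false_iff.1 h).1)),
      h2 G xs (hf.imp And.right (fun h => (Bool.or_eq_false_iff.1 h).2))]

theorem Pred.solvable : ∀ (φ : Pred) {S : SchemaEnv} {Γ : SymDB} {D : Database} (p : Path)
    {V : Set Sym} {I : Interp}, φ.WF S → Env S Γ D V I → Disjoint V (zone p) →
    Solvable V (zone p) I (fun J => φ.Good S Γ D p J)
  | .lit b, S, Γ, D, p, V, I, hwf, hE, hV => by
    refine Solvable.of_forall fun J G xs _ => ?_
    simp only [Pred.encode, Pred.denot, Term.eval]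
  | .null, S, Γ, D, p, V, I, hwf, hE, hV => by
    refine Solvable.of_forall fun J G xs _ => ?_
    simp only [Pred.encode, Pred.denot, Term.eval_nil]
  | .cmp op A₁ A₂, S, Γ, D, p, V, I, hwf, hE, hV => by
    simp only [Pred.WF] at hwf
    refine (Solvable.two (i := 0) (j := 1) (by decide) hV
      (Attr.solvable A₁ (0 :: p) hwf.1 hE (hV.mono_right (zone_cons_subset _ _)))
      (fun I₁ hI₁ => Attr.solvable A₂ (1 :: p) hwf.2 (hE.congr hI₁)
        (hV.mono_right (zone_cons_subset _ _)))).zone_of_below ?_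
    rintro J ⟨h1, h2⟩ G xs hf
    simp only [Pred.Det, Pred.hasAgg] at hf
    simp only [Pred.encode, Pred.denot, eval_tCmp]
    rw [h1 G xs (hf.imp And.left (fun h => (Bool.or_eq_false_iff.1 h).1)),
      h2 G xs (hf.imp And.right (fun h => (Bool.or_eq_false_iff.1 h).2))]
  | .isNull E, S, Γ, D, p, V, I, hwf, hE, hV => by
    simp only [Pred.WF] at hwf
    refine (Expr.solvable E (0 :: p) hwf hE (hV.mono_right (zone_cons_subset _ _))).mono
      subset_rfl (zone_cons_subset _ _) ?_
    intro J h G xs hf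
    simp only [Pred.Det, Pred.hasAgg] at hf
    simp only [Pred.encode, Pred.denot, Formula.eval_toTerm, Term.eval_isNull, h G xs hf]
  | .inVals Es rows, S, Γ, D, p, V, I, hwf, hE, hV => by
    simp only [Pred.WF] at hwf
    refine (Expr.solvableList Es (0 :: p) hwf.1 hE (hV.mono_right (zone_cons_subset _ _))).mono
      subset_rfl (zone_cons_subset _ _) ?_
    intro J h G xs hf
    simp only [Pred.Det, Pred.hasAgg] at hf
    simp only [Pred.encode, Pred.denot, eval_tAny, vMember_eq, List.map_map]
    congr 1
    apply List.map_congr_left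
    intro r _
    have hr : Term.eval J ∘ Term.const = id := by funext v; simp [Term.eval]
    simp only [Function.comp, eval_tRowEq, h G xs hf, List.map_map]
    simp only [hr, List.map_id]
  | .inQuery Es Q, S, Γ, D, p, V, I, hwf, hE, hV => by
    simp only [Pred.WF] at hwf
    exact (Solvable.two (i := 0) (j := 1) (by decide) hV
      (Expr.solvableList Es (0 :: p) hwf.1 hE (hV.mono_right (zone_cons_subset _ _)))
      (fun I₁ hI₁ => Query.solvable Q (1 :: p) hwf.2.1 (hE.congr hI₁)
        (hV.mono_right (zone_cons_subset _ _)))).zone_of_below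
      (fun J hJ => Pred.good_inQuery hwf.2.1 hE.names hJ.1 hJ.2)
  | .and φ₁ φ₂, S, Γ, D, p, V, I, hwf, hE, hV => by
    simp only [Pred.WF] at hwf
    refine (Solvable.two (i := 0) (j := 1) (by decide) hV
      (Pred.solvable φ₁ (0 :: p) hwf.1 hE (hV.mono_right (zone_cons_subset _ _)))
      (fun I₁ hI₁ => Pred.solvable φ₂ (1 :: p) hwf.2 (hE.congr hI₁)
        (hV.mono_right (zone_cons_subset _ _)))).zone_of_below ?_
    rintro J ⟨h1, h2⟩ G xs hf
    simp only [Pred.Det, Pred.hasAgg] at hf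
    simp only [Pred.encode, Pred.denot, eval_tAnd]
    rw [h1 G xs (hf.imp And.left (fun h => (Bool.or_eq_false_iff.1 h).1)),
      h2 G xs (hf.imp And.right (fun h => (Bool.or_eq_false_iff.1 h).2))]
  | .or φ₁ φ₂, S, Γ, D, p, V, I, hwf, hE, hV => by
    simp only [Pred.WF] at hwf
    refine (Solvable.two (i := 0) (j := 1) (by decide) hV
      (Pred.solvable φ₁ (0 :: p) hwf.1 hE (hV.mono_right (zone_cons_subset _ _)))
      (fun I₁ hI₁ => Pred.solvable φ₂ (1 :: p) hwf.2 (hE.congr hI₁)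
        (hV.mono_right (zone_cons_subset _ _)))).zone_of_below ?_
    rintro J ⟨h1, h2⟩ G xs hf
    simp only [Pred.Det, Pred.hasAgg] at hf
    simp only [Pred.encode, Pred.denot, eval_tOr]
    rw [h1 G xs (hf.imp And.left (fun h => (Bool.or_eq_false_iff.1 h).1)),
      h2 G xs (hf.imp And.right (fun h => (Bool.or_eq_false_iff.1 h).2))]
  | .not φ, S, Γ, D, p, V, I, hwf, hE, hV => by
    simp only [Pred.WF] at hwf
    refine (Pred.solvable φ (0 :: p) hwf hE (hV.mono_right (zone_cons_subset _ _))).mono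
      subset_rfl (zone_cons_subset _ _) ?_
    intro J h G xs hf
    simp only [Pred.Det, Pred.hasAgg] at hf
    simp only [Pred.encode, Pred.denot, eval_tNot, h G xs hf]

theorem Pred.solvableList : ∀ (φs : List Pred) {S : SchemaEnv} {Γ : SymDB} {D : Database}
    (p : Path) {V : Set Sym} {I : Interp}, Pred.WFList φs S → Env S Γ D V I →
    Disjoint V (zone p) → Solvable V (zone p) I (fun J => Pred.GoodList S Γ D p J φs)
  | [], S, Γ, D, p, V, I, hwf, hE, hV => by
    refine Solvable.of_forall fun J G xs _ => ?_
    simp only [Pred.encodeList, Pred.denotList, List.map_nil]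
  | φ :: φs, S, Γ, D, p, V, I, hwf, hE, hV => by
    simp only [Pred.WFList] at hwf
    refine (Solvable.two (i := 0) (j := 1) (by decide) hV
      (Pred.solvable φ (0 :: p) hwf.1 hE (hV.mono_right (zone_cons_subset _ _)))
      (fun I₁ hI₁ => Pred.solvableList φs (1 :: p) hwf.2 (hE.congr hI₁)
        (hV.mono_right (zone_cons_subset _ _)))).zone_of_below ?_
    rintro J ⟨h1, h2⟩ G xs hf
    simp only [Pred.DetList, Pred.hasAggList] at hf
    simp only [Pred.encodeList, Pred.denotList, List.map_cons]
    rw [h1 G xs (hf.imp And.left (fun h => (Bool.or_eq_false_iff.1 h).1)),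
      h2 G xs (hf.imp And.right (fun h => (Bool.or_eq_false_iff.1 h).2))]

theorem Expr.solvable : ∀ (E : Expr) {S : SchemaEnv} {Γ : SymDB} {D : Database} (p : Path)
    {V : Set Sym} {I : Interp}, E.WF S → Env S Γ D V I → Disjoint V (zone p) →
    Solvable V (zone p) I (fun J => E.Good S Γ D p J)
  | .attr a, S, Γ, D, p, V, I, hwf, hE, hV => by
    refine Solvable.of_forall fun J G xs hf => ?_
    simp only [Fits, Expr.Det, List.not_mem_nil, or_false] at hf
    simp only [Expr.encode, Expr.denot]
    exact hf.1 a
  | .val v, S, Γ, D, p, V, I, hwf, hE, hV => by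
    refine Solvable.of_forall fun J G xs _ => ?_
    simp only [Expr.encode, Expr.denot, Term.eval]
  | .arith op E₁ E₂, S, Γ, D, p, V, I, hwf, hE, hV => by
    simp only [Expr.WF] at hwf
    refine (Solvable.two (i := 0) (j := 1) (by decide) hV
      (Expr.solvable E₁ (0 :: p) hwf.1 hE (hV.mono_right (zone_cons_subset _ _)))
      (fun I₁ hI₁ => Expr.solvable E₂ (1 :: p) hwf.2 (hE.congr hI₁)
        (hV.mono_right (zone_cons_subset _ _)))).zone_of_below ?_
    rintro J ⟨h1, h2⟩ G xs hf
    simp only [Expr.Det, List.not_mem_nil, false_or, Expr.hasAgg] at hf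
    simp only [Expr.encode, Expr.denot, eval_tArith]
    rw [h1 G xs (hf.imp And.left (fun h => (Bool.or_eq_false_iff.1 h).1)),
      h2 G xs (hf.imp And.right (fun h => (Bool.or_eq_false_iff.1 h).2))]
  | .ite φ E₁ E₂, S, Γ, D, p, V, I, hwf, hE, hV => by
    simp only [Expr.WF] at hwf
    refine (Solvable.three hV
      (Pred.solvable φ (0 :: p) hwf.1 hE (hV.mono_right (zone_cons_subset _ _)))
      (fun I₁ hI₁ => Expr.solvable E₁ (1 :: p) hwf.2.1 (hE.congr hI₁)
        (hV.mono_right (zone_cons_subset _ _)))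
      (fun I₁ hI₁ => Expr.solvable E₂ (2 :: p) hwf.2.2 (hE.congr hI₁)
        (hV.mono_right (zone_cons_subset _ _)))).zone_of_below ?_
    rintro J ⟨⟨h1, h2⟩, h3⟩ G xs hf
    simp only [Expr.Det, List.not_mem_nil, false_or, Expr.hasAgg] at hf
    simp only [Expr.encode, Expr.denot, Term.eval_ite, Term.eval_isTrue, decide_eq_true_eq]
    rw [h1 G xs (hf.imp (fun h => h.1) (fun h => by simp only [Bool.or_eq_false_iff] at h; tauto)),
      h2 G xs (hf.imp (fun h => h.2.1) (fun h => by simp only [Bool.or_eq_false_iff] at h; tauto)),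
      h3 G xs (hf.imp (fun h => h.2.2) (fun h => by simp only [Bool.or_eq_false_iff] at h; tauto))]
  | .case φs Es E, S, Γ, D, p, V, I, hwf, hE, hV => by
    simp only [Expr.WF] at hwf
    refine (Solvable.three hV
      (Pred.solvableList φs (0 :: p) hwf.1 hE (hV.mono_right (zone_cons_subset _ _)))
      (fun I₁ hI₁ => Expr.solvableList Es (1 :: p) hwf.2.1 (hE.congr hI₁)
        (hV.mono_right (zone_cons_subset _ _)))
      (fun I₁ hI₁ => Expr.solvable E (2 :: p) hwf.2.2.1 (hE.congr hI₁)
        (hV.mono_right (zone_cons_subset _ _)))).zone_of_below ?_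
    rintro J ⟨⟨h1, h2⟩, h3⟩ G xs hf
    simp only [Expr.Det, List.not_mem_nil, false_or, Expr.hasAgg] at hf
    simp only [Expr.encode, Expr.denot, eval_tCase]
    rw [h1 G xs (hf.imp (fun h => h.1) (fun h => by simp only [Bool.or_eq_false_iff] at h; tauto)),
      h2 G xs (hf.imp (fun h => h.2.1) (fun h => by simp only [Bool.or_eq_false_iff] at h; tauto)),
      h3 G xs (hf.imp (fun h => h.2.2) (fun h => by simp only [Bool.or_eq_false_iff] at h; tauto))]

theorem Expr.solvableList : ∀ (Es : List Expr) {S : SchemaEnv} {Γ : SymDB} {D : Database}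
    (p : Path) {V : Set Sym} {I : Interp}, Expr.WFList Es S → Env S Γ D V I →
    Disjoint V (zone p) → Solvable V (zone p) I (fun J => Expr.GoodList S Γ D p J Es)
  | [], S, Γ, D, p, V, I, hwf, hE, hV => by
    refine Solvable.of_forall fun J G xs _ => ?_
    simp only [Expr.encodeList, Expr.denotList, List.map_nil]
  | E :: Es, S, Γ, D, p, V, I, hwf, hE, hV => by
    simp only [Expr.WFList] at hwf
    refine (Solvable.two (i := 0) (j := 1) (by decide) hV
      (Expr.solvable E (0 :: p) hwf.1 hE (hV.mono_right (zone_cons_subset _ _)))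
      (fun I₁ hI₁ => Expr.solvableList Es (1 :: p) hwf.2 (hE.congr hI₁)
        (hV.mono_right (zone_cons_subset _ _)))).zone_of_below ?_
    rintro J ⟨h1, h2⟩ G xs hf
    simp only [Expr.DetList, Expr.hasAggList] at hf
    simp only [Expr.encodeList, Expr.denotList, List.map_cons]
    rw [h1 G xs (hf.imp And.left (fun h => (Bool.or_eq_false_iff.1 h).1)),
      h2 G xs (hf.imp And.right (fun h => (Bool.or_eq_false_iff.1 h).2))]

end

/-! ### Complete queries -/

def TopQuery.Good (S : SchemaEnv) (Γ : SymDB) (D : Database) (J : Interp) (Q : TopQuery) : Prop :=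
  (Q.encode S Γ).eval J = true ∧ Q.SameResult (J.rel (Q.symTuples Γ)) (Q.denot S D)

theorem TopQuery.solvable (Q : TopQuery) {S : SchemaEnv} {Γ : SymDB} {D : Database} {V : Set Sym}
    {I : Interp} (hwf : Q.WF S) (hE : Env S Γ D V I) (hV : Disjoint V (zone [])) :
    Solvable V (zone []) I (fun J => Q.Good S Γ D J) := by
  cases Q with
  | sub Q => exact Query.solvable Q [] hwf hE hV
  | orderBy Q Es asc =>
    have hk := Solvable.two (i := 0) (j := 1) (by decide) hV
      (Query.solvable Q [0] hwf.1 hE (hV.mono_right (zone_cons_subset _ _)))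
      (fun I₁ hI₁ => Expr.solvableList Es [1] hwf.2 (hE.congr hI₁)
        (hV.mono_right (zone_cons_subset _ _)))
    have hT : ∀ t ∈ Q.symTuples Γ [0], Sym.tup t ∈ V ∪ below [] := fun t ht =>
      (Query.symTuples_mem Q Γ _ V hE.mem t ht).imp id (fun h => zone_cons_subset_below _ _ h)
    set T := Q.symTuples Γ [0] with hTdef
    let κ : Tuple → List Value := fun x => Expr.denotList Es S D [x]
    have hκ : ∀ x, (κ x).length = Es.length := fun x => by simp [κ, Expr.denotList_eq_map]
    obtain ⟨hperm, hsorted⟩ := sortRel_spec hκ asc (Q.denot S D)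
    set s := sortRel κ asc (Q.denot S D) with hs
    let F : (ℕ → Row) → ℕ → ℕ := fun X => Classical.epsilon (IsFind T.length X s)
    refine hk.node hV T [] hT (by simp) (fun X _ =>
      { row := fun k i => if k = 0 then moveRow T.length X i else moveRow T.length X (F X i)
        find := F X }) ?_
    rintro J ⟨hJ, hJE⟩ hlev
    have hfind : IsFind T.length (J.rowAt T) s (F (J.rowAt T)) := by
      refine Classical.epsilon_spec (exists_isFind _ _ (hperm.trans ?_))
      rw [← J.rel_eq_lv]
      exact hJ.2.symm
    constructor
    · simp only [TopQuery.encode, Formula.eval_and_true, ← hTdef]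
      refine ⟨hJ.1, eval_moveDelToEndF (hlev.row 0), eval_findF hκ hsorted
        (X := J.rowAt T) (by rw [hlev.find]; exact hfind)
        (fun t hd => hJE (plain [t]) [J.tup t] (fits_live hd _ _)) (hlev.row 0) ?_⟩
      intro i
      rw [hlev.row, hlev.find]
      rfl
    · simp only [TopQuery.symTuples, TopQuery.denot, TopQuery.SameResult, ← hTdef, J.rel_fresh,
        hlev.row]
      exact hfind.eq

theorem Conforms.namesOK {S : Schema} {D : Database} (h : Conforms S D) : NamesOK S.names D := by
  intro N A hA
  have hN := h N
  simp only [Schema.names, Option.map_eq_some_iff] at hA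
  obtain ⟨cols, hc, rfl⟩ := hA
  rw [hc] at hN
  generalize D N = d at hN
  cases hN with
  | some hN =>
    refine ⟨_, rfl, fun x hx => ?_⟩
    replace hx := hN x hx
    clear hN hc
    induction hx with
    | nil => rfl
    | cons h₁ _ ih => rw [List.map_cons, List.map_cons, h₁.1, ih]

/-- The symbols of initial symbolic databases. -/
def baseSyms : Set Sym := {s | ∃ n, s = .tup (.base n)}

theorem disjoint_baseSyms (p : Path) : Disjoint baseSyms (zone p) := by
  rw [Set.disjoint_left]
  rintro _ ⟨n, rfl⟩ ⟨q, hq, _⟩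
  simp [Sym.path] at hq

theorem Interp.Realizes.env {S : Schema} {Γ : SymDB} {D : Database} {I : Interp}
    (h : I.Realizes Γ D) (hD : Conforms S D) (hΓ : SymOver S Γ) : Env S.names Γ D baseSyms I := by
  refine ⟨hD.namesOK, ?_, ?_, ?_⟩
  · intro N A hA
    have hN := hΓ N
    simp only [Schema.names, Option.map_eq_some_iff] at hA
    obtain ⟨cols, hc, rfl⟩ := hA
    rw [hc] at hN
    generalize Γ N = T at hN
    cases hN with
    | some _ => exact ⟨_, rfl⟩
  · intro N T hT
    have hN := h N
    rw [hT] at hN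
    generalize D N = d at hN
    cases hN with
    | some hN => exact ⟨_, rfl, hN.2⟩
  · intro N T hT t ht
    have hN := hΓ N
    rw [hT] at hN
    generalize S N = A at hN
    cases hN with
    | some hN =>
      obtain ⟨n, rfl⟩ := hN t ht
      exact ⟨n, rfl⟩

end VeriEQL

theorem mainTheorem2 (S : VeriEQL.Schema) (D : VeriEQL.Database) (Γ : VeriEQL.SymDB)
    (Q : VeriEQL.TopQuery) (o : VeriEQL.RelName) (R : List VeriEQL.TupVar) (Φ : VeriEQL.Formula)
    (I : VeriEQL.Interp)
    (hD : VeriEQL.Conforms S D) (hΓ : VeriEQL.SymOver S Γ) (hQ : Q.WF S.names)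
    (hR : Q.symTuples Γ = R) (hΦ : Q.encode S.names Γ = Φ)
    (hI : ∀ s ∈ I.dom, ∃ n, s = VeriEQL.Sym.tup (VeriEQL.TupVar.base n))
    (hID : I.Realizes Γ D) :
    ∃ I' : VeriEQL.Interp, I'.Extends I ∧
      (∀ t ∈ R, VeriEQL.Sym.tup t ∈ I'.dom) ∧
      Q.SameResult (I'.rel R) (Q.denot S.names D) ∧
      VeriEQL.Models I' (Function.update D o (some (I'.rel R))) Φ := by
  subst hR hΦ
  obtain ⟨I', hI', hG⟩ := VeriEQL.TopQuery.solvable Q hQ (hID.env hD hΓ)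
    (VeriEQL.disjoint_baseSyms [])
  obtain ⟨hF, hrel⟩ := hG { I' with dom := Set.univ } (fun s _ => by
    cases s <;> simp [VeriEQL.Interp.AgreeOn])
  exact ⟨{ I' with dom := Set.univ },
    ⟨Set.subset_univ _, fun s hs =>
      hI' s ((VeriEQL.disjoint_baseSyms []).subset_compl_right (hI s hs))⟩,
    fun _ _ => Set.mem_univ _, hrel, fun _ _ => Set.mem_univ _, hF⟩
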